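/- Let $n,k\ge 1$ be integers and let $P=\sum_{|\alpha|\le k}a_\alpha\partial^\alpha$ be a constant coefficient partial differential operator on $\mathbb R^n$ with complex coefficients which is elliptic of order $k$, formally self-adjoint and bounded from below. Let $\Omega\subset\mathbb R^n$ be a nonempty bounded open set, let $H^k_0(\Omega)$ be the closure of $C_c^\infty(\Omega)$ in the norm of $H^k(\Omega)$, and let $H^k_P(\Omega)=\{w\in L^2(\Omega): Pw\in L^2(\Omega)\}$, where $Pw$ is taken in the sense of distributions. Let $V\in L^\infty(\Omega)$ be complex-valued and such that in some neighbourhood of $\partial\Omega$ it only takes values (almost everywhere) in some closed complex half-plane not containing zero. Let $e\in\{0,1,\dots,k-1\}$, and for each multi-index $\alpha$ with $1\le|\alpha|\le e$ let $W_\alpha\in W^{|\alpha|,\infty}(\Omega)$ be complex-valued and vanish (almost everywhere) outside some compact subset of $\Omega$. Put \[ W=\sum_{1\le|\alpha|\le e}W_\alpha\partial^\alpha \] ($W=0$ if $e=0$). Let $\mu,\nu\in\{0,1\}$, and for $\lambda>0$ let $B=B(\lambda)$ be the operator \[ B=\begin{bmatrix}P+\mu W&\lambda^{-\nu}W+V\\0&P\end{bmatrix}\colon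 H^k_0(\Omega)\times H^k_P(\Omega)\longrightarrow L^2(\Omega)\times L^2(\Omega). \] Then there is $\lambda_0>0$ such that for all real $\lambda\ge\lambda_0$ the operator $B$ is well defined on all of $H^k_0(\Omega)\times H^k_P(\Omega)$, the operator $B+\lambda$ is bijective, and its inverse is \[ (B+\lambda)^{-1}=\begin{bmatrix}R_{11}&R_{12}\\R_{21}&R_{22}\end{bmatrix}\colon L^2(\Omega)\times L^2(\Omega)\longrightarrow L^2(\Omega)\times L^2(\Omega) \] with bounded operators $R_{ij}=R_{ij}(\lambda)$ on $L^2(\Omega)$. Here $R_{11}$, $R_{12}$ and $R_{22}$ are compact, and $\chi R_{21}$ is compact for every $\chi\in C_c^\infty(\Omega)$. The operators $\partial^\alpha R_{11}$ and $\partial^\alpha R_{12}$ are bounded on $L^2(\Omega)$ for $|\alpha|\le k$ and compact for $1\le|\alpha|<k$, and $\partial^\alpha\chi R_{21}$ and $\partial^\alpha\chi R_{22}$ are compact on $L^2(\Omega)$ for $1\le|\alpha|<k$ and every $\chi\in C_c^\infty(\Omega)$. Furthermore, for all $\lambda\ge\lambda_0$, every multi-index $\alpha$ with $|\alpha|\le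 k$, every $\varepsilon>0$ and every $\chi\in C_c^\infty(\Omega)$, the operator norms on $L^2(\Omega)$ satisfy \[ \|\partial^\alpha R_{11}\|\le C\lambda^{|\alpha|/k-1},\qquad \|\partial^\alpha R_{12}\|\le C_\varepsilon\lambda^{\varepsilon+(1-\nu)e/k+|\alpha|/k-2},\qquad \|R_{22}\|\le C_\varepsilon\lambda^{\varepsilon+e/k-1}, \] \[ \|R_{21}\|\le C,\qquad \|\chi R_{21}\|\le C_\chi\lambda^{-1/k}, \] where the constants do not depend on $\lambda$; besides the data $n,k,P,\Omega,V,e,W,\mu,\nu$, the constant $C_\varepsilon$ depends only on $\varepsilon$ and $C_\chi$ only on $\chi$. -/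

import Mathlib

open MeasureTheory TopologicalSpace
open scoped Distributions LineDeriv ENNReal

noncomputable section

/-- The Euclidean space `ℝⁿ`. -/
abbrev Rn (n : ℕ) : Type := EuclideanSpace ℝ (Fin n)

/-- The complex Hilbert space `L²(Ω)`. -/
abbrev L2 {n : ℕ} (Ω : Opens (Rn n)) : Type := Lp ℂ 2 (volume.restrict (Ω : Set (Rn n)))

/-- The length `|α|` of a multi-index. -/
def mlen {n : ℕ} (α : Fin n → ℕ) : ℕ := ∑ i, α i

/-- The finite set of multi-indices `α` with `a ≤ |α| ≤ b`. -/
def multiIndices (n a b : ℕ) : Finset (Fin n → ℕ) :=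
  (Finset.Icc a b).biUnion fun m => Finset.piAntidiag Finset.univ m

theorem mem_multiIndices {n a b : ℕ} {α : Fin n → ℕ} :
    α ∈ multiIndices n a b ↔ a ≤ mlen α ∧ mlen α ≤ b := by
  simp [multiIndices, mlen]

/-- The derivative `∂^α φ = ∂₁^{α₁} ⋯ ∂ₙ^{αₙ} φ` of a test function. -/
def mderiv {n : ℕ} {Ω : Opens (Rn n)} (α : Fin n → ℕ) (φ : 𝓓(Ω, ℂ)) : 𝓓(Ω, ℂ) :=
  (List.finRange n).foldr
    (fun i ψ => (fun η : 𝓓(Ω, ℂ) => ∂_{EuclideanSpace.single i (1 : ℝ)} η)^[α i] ψ) φ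

/-- `g` is the weak derivative `∂^α f` in `Ω`. -/
def HasWeakDeriv {n : ℕ} (Ω : Opens (Rn n)) (α : Fin n → ℕ) (f g : Rn n → ℂ) : Prop :=
  LocallyIntegrableOn f (Ω : Set (Rn n)) ∧ LocallyIntegrableOn g (Ω : Set (Rn n)) ∧
    ∀ φ : 𝓓(Ω, ℂ),
      ∫ x in (Ω : Set (Rn n)), g x * φ x =
        (-1) ^ mlen α * ∫ x in (Ω : Set (Rn n)), f x * mderiv α φ x

/-- The constant coefficient operator `∑_{|α| ≤ k} a_α ∂^α` acting on test functions. -/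
def constCoeffOp {n : ℕ} {Ω : Opens (Rn n)} (k : ℕ) (a : (Fin n → ℕ) → ℂ)
    (φ : 𝓓(Ω, ℂ)) : 𝓓(Ω, ℂ) :=
  ∑ α ∈ multiIndices n 0 k, a α • mderiv α φ

/-- `P = ∑_{|α| ≤ k} a_α ∂^α` is elliptic of order `k`. -/
def IsEllipticOp {n : ℕ} (k : ℕ) (a : (Fin n → ℕ) → ℂ) : Prop :=
  ∀ ξ : Rn n, ξ ≠ 0 → ∑ α ∈ multiIndices n k k, a α * ∏ i, ((ξ i : ℝ) : ℂ) ^ α i ≠ 0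

/-- `P` coincides with its formal adjoint `∑_{|α| ≤ k} (-1)^{|α|} conj(a_α) ∂^α`. -/
def IsFormallySelfAdjointOp {n : ℕ} (k : ℕ) (a : (Fin n → ℕ) → ℂ) : Prop :=
  ∀ α ∈ multiIndices n 0 k, (-1) ^ mlen α * (starRingEnd ℂ) (a α) = a α

/-- `P` is bounded from below: `⟨P φ, φ⟩ ≥ -C ‖φ‖²` for all `φ ∈ C_c^∞(ℝⁿ)`. -/
def IsBoundedBelowOp {n : ℕ} (k : ℕ) (a : (Fin n → ℕ) → ℂ) : Prop :=
  ∃ C : ℝ, ∀ φ : 𝓓((⊤ : Opens (Rn n)), ℂ),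
    -C * ∫ x, ‖φ x‖ ^ 2 ≤ (∫ x, constCoeffOp k a φ x * (starRingEnd ℂ) (φ x)).re

/-- `P u = g` in the sense of distributions in `Ω`. -/
def DistribEq {n : ℕ} (Ω : Opens (Rn n)) (k : ℕ) (a : (Fin n → ℕ) → ℂ) (u g : L2 Ω) : Prop :=
  ∀ φ : 𝓓(Ω, ℂ),
    ∫ x in (Ω : Set (Rn n)), g x * φ x =
      ∫ x in (Ω : Set (Rn n)), u x * constCoeffOp k (fun α => (-1) ^ mlen α * a α) φ x

/-- `u ∈ H^k_0(Ω)`: the closure of `C_c^∞(Ω)` in the norm of `H^k(Ω)`. -/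
def MemH0 {n : ℕ} (Ω : Opens (Rn n)) (k : ℕ) (u : L2 Ω) : Prop :=
  ∃ D : (Fin n → ℕ) → L2 Ω,
    (∀ α ∈ multiIndices n 0 k, HasWeakDeriv Ω α u (D α)) ∧
    ∀ δ : ℝ, 0 < δ → ∃ φ : 𝓓(Ω, ℂ), ∀ α ∈ multiIndices n 0 k,
      eLpNorm (fun x => D α x - mderiv α φ x) 2 (volume.restrict (Ω : Set (Rn n))) <
        ENNReal.ofReal δ

/-- `w ∈ H^k_P(Ω)`: the distribution `P w` belongs to `L²(Ω)`. -/
def MemHP {n : ℕ} (Ω : Opens (Rn n)) (k : ℕ) (a : (Fin n → ℕ) → ℂ) (w : L2 Ω) : Prop :=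
  ∃ g : L2 Ω, DistribEq Ω k a w g

/-- `f ∈ W^{m,p}_c(Ω)`: the function `f` is in `W^{m,p}(Ω)` and vanishes (almost everywhere)
outside some compact subset of `Ω`. -/
def MemSobolevC {n : ℕ} (Ω : Opens (Rn n)) (m : ℕ) (p : ℝ≥0∞) (f : Rn n → ℂ) : Prop :=
  MemLp f p (volume.restrict (Ω : Set (Rn n))) ∧
  (∀ β ∈ multiIndices n 0 m, ∃ g : Rn n → ℂ,
    MemLp g p (volume.restrict (Ω : Set (Rn n))) ∧ HasWeakDeriv Ω β f g) ∧
  ∃ K : Set (Rn n), IsCompact K ∧ K ⊆ Ω ∧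
    ∀ᵐ x ∂volume.restrict (Ω : Set (Rn n)), x ∉ K → f x = 0

/-- In some neighbourhood of `∂Ω`, the function `V` only takes values (almost everywhere) in some
closed half-plane `{z | Re (c z) ≥ δ}`, `c ≠ 0`, `δ > 0`, of `ℂ`. These are exactly the closed
half-planes which do not contain zero. -/
def CoerciveNearBoundary {n : ℕ} (Ω : Opens (Rn n)) (V : Rn n → ℂ) : Prop :=
  ∃ U : Set (Rn n), IsOpen U ∧ frontier (Ω : Set (Rn n)) ⊆ U ∧
    ∃ (c : ℂ) (δ : ℝ), c ≠ 0 ∧ 0 < δ ∧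
      ∀ᵐ x ∂volume.restrict (Ω : Set (Rn n)), x ∈ U → δ ≤ (c * V x).re

/-- `z = W w`, where `W = ∑_{1 ≤ |α| ≤ e} W_α ∂^α`, the derivatives being weak ones.
For `e = 0` this says `z = 0`. -/
def LowerOrderEq {n : ℕ} (Ω : Opens (Rn n)) (e : ℕ) (W : (Fin n → ℕ) → Rn n → ℂ)
    (w z : L2 Ω) : Prop :=
  ∃ D : (Fin n → ℕ) → Rn n → ℂ,
    (∀ α ∈ multiIndices n 1 e, HasWeakDeriv Ω α w (D α)) ∧
    ∀ᵐ x ∂volume.restrict (Ω : Set (Rn n)), z x = ∑ α ∈ multiIndices n 1 e, W α x * D α x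

/-- The graph of the Born approximation
`B = [[P + μ W, λ^{-ν} W + V], [0, P]] : H^k_0(Ω) × H^k_P(Ω) → L²(Ω) × L²(Ω)`:
the pair `p = (u, w)` is in the domain `H^k_0(Ω) × H^k_P(Ω)` and `B (u, w) = q`. -/
def BornGraph {n : ℕ} (Ω : Opens (Rn n)) (k e : ℕ) (a : (Fin n → ℕ) → ℂ)
    (W : (Fin n → ℕ) → Rn n → ℂ) (V : Rn n → ℂ) (μ ν : ℕ) (lam : ℝ)
    (p q : L2 Ω × L2 Ω) : Prop :=
  MemH0 Ω k p.1 ∧ MemHP Ω k a p.2 ∧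
  ∃ Pu Wu Ww : L2 Ω,
    DistribEq Ω k a p.1 Pu ∧ LowerOrderEq Ω e W p.1 Wu ∧ LowerOrderEq Ω e W p.2 Ww ∧
    (∀ᵐ x ∂volume.restrict (Ω : Set (Rn n)),
      q.1 x = (Pu x + (μ : ℂ) * Wu x) + (((lam : ℂ) ^ ν)⁻¹ * Ww x + V x * p.2 x)) ∧
    DistribEq Ω k a p.2 q.2

/-- The operator `T` is `∂^α R`. -/
def IsDerivOp {n : ℕ} (Ω : Opens (Rn n)) (α : Fin n → ℕ) (R T : L2 Ω →L[ℂ] L2 Ω) : Prop :=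
  ∀ f : L2 Ω, HasWeakDeriv Ω α (R f) (T f)

/-- The operator `T` is `χ R`, multiplication by `χ ∈ C_c^∞(Ω)` composed with `R`. -/
def IsCutoffOp {n : ℕ} (Ω : Opens (Rn n)) (χ : 𝓓(Ω, ℂ)) (R T : L2 Ω →L[ℂ] L2 Ω) : Prop :=
  ∀ f : L2 Ω, ∀ᵐ x ∂volume.restrict (Ω : Set (Rn n)), T f x = χ x * R f x

end

/-! Write `λ = s^k`. Ellipticity, self-adjointness and semiboundedness make the symbol satisfy `Re
p(ξ) + s^k ≥ c (|ξ| + s)^k` for large `s`, so `P + s^k` is inverted on `ℝⁿ` by a Fourier multiplier.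
Let `G` be this inverse applied to extensions by zero and restricted to `Ω` (`resolventCut`). It is
not the resolvent of a boundary value problem on `Ω`, but it describes both domains. Let `N ⊆ L²(Ω)`
be the space of distributional solutions of `(P + s^k) x = 0` (`kerP`) and `Π` the orthogonal
projection onto it. Then `Nᗮ` is the closure of `(P + s^k) C_c^∞(Ω)`, and `G` takes `(P + s^k) φ`
back to `φ`. Hence `H^k_0(Ω) = G(Nᗮ)` and `H^k_P(Ω) = G(L²(Ω)) + N` (`memH0_Psi`, `exists_of_memH0`,
`sub_mem_kerP`, `distribEq_add_kerP`).

With `u = G y`, `y ∈ Nᗮ`, and `w = G g + x`, `x ∈ N`, the second row of `(B + λ)(u, w) = (f, g)`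
says only that `g` is the right-hand side. In terms of `z = y + x` the first row becomes `(1 - Π) z
+ V Π z + E z = f - X g`, where `X = (λ^{-ν} W + V) G` and `E` collects the terms with `W` acting on
`G y` and on `x`. The whole problem is to invert this operator on `L²(Ω)` (`bornGraph_sub_iff`).

The decisive point is that elements of `N` concentrate at the boundary: the interior estimate
(`interior_estimate`, `exists_cutoff_factor`) shows that `χ Π = (P + s^k)⁻¹ Q` with `Q` bounded
uniformly in `s`, so `‖χ Π‖ = O(s^{-k})`. Therefore the half-plane condition on `V` near the
boundary makes `V` coercive on all of `N` for large `s` (`exists_coercive_kerP`), while the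
compactly supported `W` is `O(s^{e-k})` on `N`, just as `W G` is, so `E` is small. A triangular
coercivity argument (`exists_inverse_block`) then gives a uniformly bounded inverse `S`.

This yields `R₁₁ = G (1 - Π) S`, `R₁₂ = -R₁₁ X`, `R₂₁ = Π S` and `R₂₂ = G - Π S X`. The norm bounds
are those of the multipliers `∂^α (P + s^k)⁻¹` and of `X`; they hold without the loss `λ^ε`.
Compactness comes from the decay of the multipliers for `|α| < k` and the boundedness of `Ω`
(`isCompactOperator_Psi`). -/

noncomputable section

/-! ### Test functions, plane waves and the Fourier transform on `Ω` -/

namespace BornOp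

variable {n : ℕ} {Ω : Opens (Rn n)}

/-- The partial derivative `∂ᵢ` on test functions. -/
def pd (i : Fin n) : 𝓓(Ω, ℂ) →ₗ[ℂ] 𝓓(Ω, ℂ) :=
  (TestFunction.lineDerivCLM ℂ (EuclideanSpace.single i (1 : ℝ)) : 𝓓(Ω, ℂ) →L[ℂ] 𝓓(Ω, ℂ)).toLinearMap

theorem pd_apply (i : Fin n) (φ : 𝓓(Ω, ℂ)) (x : Rn n) :
    pd i φ x = fderiv ℝ φ x (EuclideanSpace.single i 1) := by
  change TestFunction.lineDerivCLM ℂ (EuclideanSpace.single i (1 : ℝ)) φ x = _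
  rw [TestFunction.lineDerivCLM_eq_fderivCLM, TestFunction.fderivCLM_apply_of_le _ (by simp)]

/-- Unfolding a multi-index into a list of coordinate directions reduces statements about `mderiv`
and about its symbol to induction on one list, which serves all open sets at once. -/
theorem exists_mderiv_eq_foldr (α : Fin n → ℕ) : ∃ L : List (Fin n), L.length = mlen α ∧
    (∀ c : Fin n → ℂ, ∏ i, c i ^ α i = (L.map c).prod) ∧
    ∀ (Ω : Opens (Rn n)) (φ : 𝓓(Ω, ℂ)), mderiv α φ = L.foldr (fun i ψ => pd i ψ) φ := by
  refine ⟨(List.finRange n).flatMap fun i => List.replicate (α i) i, ?_, fun c => ?_,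
    fun Ω φ => ?_⟩
  · rw [List.length_flatMap, mlen, Fin.sum_univ_def]
    simp
  · rw [Fin.prod_univ_def]
    generalize List.finRange n = l
    induction l with
    | nil => simp
    | cons i l ih => simp [ih, List.flatMap_cons]
  · unfold mderiv
    generalize List.finRange n = l
    induction l with
    | nil => simp
    | cons i l ih =>
      rw [List.foldr_cons, ih, List.flatMap_cons, List.foldr_append]
      generalize List.foldr _ φ _ = ψ
      generalize α i = m
      induction m with
      | zero => simp
      | succ m ihm =>
        rw [Function.iterate_succ_apply', ihm, List.replicate_succ, List.foldr_cons]
        rfl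

/-- The symbol `2πiξᵢ` of `∂ᵢ`. -/
def zsym (ξ : Rn n) (i : Fin n) : ℂ := 2 * Real.pi * Complex.I * (ξ i : ℝ)

/-- The symbol of `∂^α`. -/
def mon (α : Fin n → ℕ) (ξ : Rn n) : ℂ := ∏ i, zsym ξ i ^ α i

/-- The plane wave `exp (-2πi⟨x, ξ⟩)`. -/
def wave (ξ x : Rn n) : ℂ := Complex.exp ((-(2 * Real.pi * inner ℝ x ξ) : ℝ) * Complex.I)

theorem norm_wave (ξ x : Rn n) : ‖wave ξ x‖ = 1 := Complex.norm_exp_ofReal_mul_I _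

theorem contDiff_wave (ξ : Rn n) {m : WithTop ℕ∞} : ContDiff ℝ m (wave ξ) := by
  unfold wave
  apply ContDiff.cexp
  apply ContDiff.mul _ contDiff_const
  exact Complex.ofRealCLM.contDiff.comp
    ((contDiff_const.mul (contDiff_id.inner ℝ contDiff_const)).neg)

theorem continuous_wave (x : Rn n) : Continuous fun ξ : Rn n => wave ξ x := by
  unfold wave
  fun_prop

theorem fderiv_wave (ξ x : Rn n) (i : Fin n) :
    fderiv ℝ (wave ξ) x (EuclideanSpace.single i 1) = -zsym ξ i * wave ξ x := by
  have h1 : HasFDerivAt (fun y : Rn n => -(2 * Real.pi * inner ℝ y ξ))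
      (-((2 * Real.pi) • (innerSL ℝ ξ : Rn n →L[ℝ] ℝ))) x := by
    have := ((innerSL ℝ ξ : Rn n →L[ℝ] ℝ).hasFDerivAt (x := x)).const_mul (2 * Real.pi) |>.neg
    refine this.congr_of_eventuallyEq (Filter.Eventually.of_forall fun y => ?_)
    simp [real_inner_comm]
  have h2 := (Complex.ofRealCLM.hasFDerivAt.comp x h1).mul_const Complex.I |>.cexp
  have h3 : HasFDerivAt (wave ξ) _ x := h2
  rw [h3.fderiv]
  simp [wave, zsym, EuclideanSpace.inner_single_right]
  ring

/-- Multiplication of a test function by a smooth function. -/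
def smoothMul (g : Rn n → ℂ) (hg : ContDiff ℝ (⊤ : ℕ∞) g) (φ : 𝓓(Ω, ℂ)) : 𝓓(Ω, ℂ) :=
  ⟨fun x => g x * φ x, hg.mul φ.contDiff, φ.hasCompactSupport.mul_left,
    (tsupport_mul_subset_right (f := g)).trans φ.tsupport_subset⟩

/-- The test function `wave ξ * φ`. -/
def modulate (ξ : Rn n) (φ : 𝓓(Ω, ℂ)) : 𝓓(Ω, ℂ) := smoothMul (wave ξ) (contDiff_wave ξ) φ

@[simp] theorem modulate_apply (ξ : Rn n) (φ : 𝓓(Ω, ℂ)) (x : Rn n) :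
    modulate ξ φ x = wave ξ x * φ x := rfl

theorem modulate_add (ξ : Rn n) (φ ψ : 𝓓(Ω, ℂ)) :
    modulate ξ (φ + ψ) = modulate ξ φ + modulate ξ ψ := by
  ext x; simp [mul_add]

theorem modulate_smul (ξ : Rn n) (c : ℂ) (φ : 𝓓(Ω, ℂ)) :
    modulate ξ (c • φ) = c • modulate ξ φ := by
  ext x; simp; ring

theorem differentiableAt_testFunction (φ : 𝓓(Ω, ℂ)) (x : Rn n) : DifferentiableAt ℝ φ x :=
  (φ.contDiff.differentiable (by simp)).differentiableAt

/-- Conjugation by a plane wave turns `∂ᵢ` into `∂ᵢ` minus a scalar. Testing an equation with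
modulated cut-offs thus reads off Fourier coefficients of cut-off solutions without differentiating
the solutions. -/
theorem pd_modulate (ξ : Rn n) (i : Fin n) (φ : 𝓓(Ω, ℂ)) :
    pd i (modulate ξ φ) = modulate ξ (pd i φ - zsym ξ i • φ) := by
  ext x
  rw [pd_apply]
  have h : (modulate ξ φ : Rn n → ℂ) = fun y => wave ξ y * φ y := rfl
  rw [h, fderiv_fun_mul ((contDiff_wave ξ (m := 1)).differentiable (by simp)).differentiableAt
    (differentiableAt_testFunction φ x)]
  simp only [add_apply, smul_apply, smul_eq_mul,
    fderiv_wave, modulate_apply, sub_apply, pd_apply]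
  ring

/-- The complex conjugate of a test function. -/
def conjT (φ : 𝓓(Ω, ℂ)) : 𝓓(Ω, ℂ) :=
  ⟨fun x => (starRingEnd ℂ) (φ x), Complex.conjCLE.contDiff.comp φ.contDiff,
    φ.hasCompactSupport.comp_left (map_zero _),
    (tsupport_comp_subset (map_zero (starRingEnd ℂ)) φ).trans φ.tsupport_subset⟩

@[simp] theorem conjT_apply (φ : 𝓓(Ω, ℂ)) (x : Rn n) : conjT φ x = (starRingEnd ℂ) (φ x) := rfl

@[simp] theorem conjT_conjT (φ : 𝓓(Ω, ℂ)) : conjT (conjT φ) = φ := by ext x; simp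

theorem pd_conjT (i : Fin n) (φ : 𝓓(Ω, ℂ)) : pd i (conjT φ) = conjT (pd i φ) := by
  ext x
  rw [conjT_apply, pd_apply, pd_apply]
  have h : (conjT φ : Rn n → ℂ) = Complex.conjCLE ∘ φ := rfl
  rw [h, Complex.conjCLE.comp_fderiv]
  rfl

theorem mderiv_conjT (α : Fin n → ℕ) (φ : 𝓓(Ω, ℂ)) :
    mderiv α (conjT φ) = conjT (mderiv α φ) := by
  obtain ⟨L, -, -, hL⟩ := exists_mderiv_eq_foldr α
  rw [hL, hL]
  clear hL
  induction L with
  | nil => rfl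
  | cons i L ih => simp only [List.foldr_cons, ih, pd_conjT]

theorem integrable_testFunction (φ : 𝓓(Ω, ℂ)) (μ : Measure (Rn n)) [IsFiniteMeasureOnCompacts μ] :
    Integrable φ μ :=
  φ.continuous.integrable_of_hasCompactSupport φ.hasCompactSupport

theorem integral_pd (i : Fin n) (φ : 𝓓(Ω, ℂ)) : ∫ x, pd i φ x = 0 := by
  have h := integral_mul_fderiv_eq_neg_fderiv_mul_of_integrable (μ := (volume : Measure (Rn n)))
    (f := fun _ : Rn n => (1 : ℂ)) (g := φ) (v := EuclideanSpace.single i 1)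
    (by simp) (by
      simp only [one_mul, ← pd_apply]
      exact integrable_testFunction _ _) (by simpa using integrable_testFunction _ _)
    (fun x _ => by fun_prop) (fun x _ => differentiableAt_testFunction φ x)
  simpa [pd_apply] using h

theorem setIntegral_testFunction (φ : 𝓓(Ω, ℂ)) (f : Rn n → ℂ) :
    ∫ x in (Ω : Set (Rn n)), f x * φ x = ∫ x, f x * φ x := by
  apply setIntegral_eq_integral_of_forall_compl_eq_zero
  intro x hx
  rw [image_eq_zero_of_notMem_tsupport (fun h => hx (φ.tsupport_subset h)), mul_zero]

/-- The Fourier transform of `f` restricted to `Ω`. -/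
def FT (Ω : Opens (Rn n)) (f : Rn n → ℂ) (ξ : Rn n) : ℂ :=
  ∫ x in (Ω : Set (Rn n)), f x * wave ξ x

/-- The derivative `∂ᵢ (wave ξ · φ)` has integral zero, and the conjugation rule splits it into the
two sides of the formula. -/
theorem FT_pd (i : Fin n) (φ : 𝓓(Ω, ℂ)) (ξ : Rn n) :
    FT Ω (pd i φ) ξ = zsym ξ i * FT Ω φ ξ := by
  have key : ∀ ψ : 𝓓(Ω, ℂ), FT Ω ψ ξ = ∫ x, modulate ξ ψ x := by
    intro ψ
    simp only [FT, modulate_apply]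
    rw [← setIntegral_testFunction ψ]
    exact integral_congr_ae (Filter.Eventually.of_forall fun x => mul_comm _ _)
  have h := integral_pd i (modulate ξ φ)
  rw [pd_modulate, sub_eq_add_neg, modulate_add, ← neg_smul, modulate_smul] at h
  simp only [add_apply, smul_apply, smul_eq_mul] at h
  rw [integral_add (integrable_testFunction _ _) ((integrable_testFunction _ _).const_mul _),
    integral_const_mul, ← key, ← key] at h
  linear_combination h

theorem FT_mderiv (α : Fin n → ℕ) (φ : 𝓓(Ω, ℂ)) (ξ : Rn n) :
    FT Ω (mderiv α φ) ξ = mon α ξ * FT Ω φ ξ := by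
  obtain ⟨L, -, hp, hL⟩ := exists_mderiv_eq_foldr α
  rw [hL, mon, hp]
  clear hL hp
  induction L with
  | nil => simp
  | cons i L ih => simp only [List.foldr_cons, FT_pd, ih, List.map_cons, List.prod_cons, mul_assoc]

theorem norm_zsym_le (ξ : Rn n) (i : Fin n) : ‖zsym ξ i‖ ≤ 2 * Real.pi * ‖ξ‖ := by
  have : ‖ξ i‖ ≤ ‖ξ‖ := PiLp.norm_apply_le ξ i
  rw [zsym, norm_mul, norm_mul, norm_mul, Complex.norm_I, Complex.norm_real, Complex.norm_real]
  simp only [Complex.norm_ofNat, Real.norm_eq_abs, abs_of_pos Real.pi_pos, mul_one] at this ⊢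
  gcongr

theorem norm_mon_le (α : Fin n → ℕ) (ξ : Rn n) :
    ‖mon α ξ‖ ≤ (2 * Real.pi) ^ mlen α * ‖ξ‖ ^ mlen α := by
  rw [mon, norm_prod, ← mul_pow, mlen, ← Finset.prod_pow_eq_pow_sum]
  refine Finset.prod_le_prod (fun i _ => norm_nonneg _) fun i _ => ?_
  rw [norm_pow]
  gcongr
  exact norm_zsym_le ξ i

theorem continuous_mon (α : Fin n → ℕ) : Continuous (mon α) := by
  unfold mon zsym
  fun_prop

/-- Families of test functions which grow at most like `(1 + |ξ|)^(m-1)`. -/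
def IsRem (m : ℕ) (X : Rn n → 𝓓(Ω, ℂ)) : Prop :=
  ∃ (ι : Type) (_ : Fintype ι) (q : ι → Rn n → ℂ) (c : ι → 𝓓(Ω, ℂ)),
    (∀ l, ∃ C : ℝ, ∀ ξ, ‖q l ξ‖ * (1 + ‖ξ‖) ≤ C * (1 + ‖ξ‖) ^ m) ∧ ∀ ξ, X ξ = ∑ l, q l ξ • c l

theorem IsRem.zero (m : ℕ) : IsRem m (fun _ => (0 : 𝓓(Ω, ℂ))) :=
  ⟨Empty, inferInstance, fun l => l.elim, fun l => l.elim, fun l => l.elim, by simp⟩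

theorem IsRem.single {m : ℕ} {q : Rn n → ℂ} (c : 𝓓(Ω, ℂ)) {C : ℝ}
    (h : ∀ ξ, ‖q ξ‖ * (1 + ‖ξ‖) ≤ C * (1 + ‖ξ‖) ^ m) : IsRem m fun ξ => q ξ • c :=
  ⟨Unit, inferInstance, fun _ => q, fun _ => c, fun _ => ⟨C, h⟩, by simp⟩

theorem IsRem.add {m : ℕ} {X Y : Rn n → 𝓓(Ω, ℂ)} (hX : IsRem m X) (hY : IsRem m Y) :
    IsRem m fun ξ => X ξ + Y ξ := by
  obtain ⟨ι, _, q, c, hq, hX⟩ := hX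
  obtain ⟨ι', _, q', c', hq', hY⟩ := hY
  refine ⟨ι ⊕ ι', inferInstance, Sum.elim q q', Sum.elim c c', ?_, fun ξ => ?_⟩
  · rintro (l | l)
    exacts [hq l, hq' l]
  · simp [Fintype.sum_sum_type, hX, hY]

theorem IsRem.sum {m : ℕ} {κ : Type*} (s : Finset κ) {X : κ → Rn n → 𝓓(Ω, ℂ)}
    (hX : ∀ i ∈ s, IsRem m (X i)) : IsRem m fun ξ => ∑ i ∈ s, X i ξ := by
  classical
  induction s using Finset.induction_on with
  | empty => simpa using IsRem.zero m
  | insert a s ha ih =>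
    simp only [Finset.sum_insert ha]
    exact (hX a (by simp)).add (ih fun i hi => hX i (by simp [hi]))

theorem IsRem.pd {m : ℕ} {X : Rn n → 𝓓(Ω, ℂ)} (hX : IsRem m X) (i : Fin n) :
    IsRem m fun ξ => pd i (X ξ) := by
  obtain ⟨ι, _, q, c, hq, hX⟩ := hX
  exact ⟨ι, inferInstance, q, fun l => BornOp.pd i (c l), hq, fun ξ => by simp [hX]⟩

theorem IsRem.smul {m d : ℕ} {X : Rn n → 𝓓(Ω, ℂ)} (hX : IsRem m X) {z : Rn n → ℂ} {B : ℝ}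
    (hz : ∀ ξ, ‖z ξ‖ ≤ B * (1 + ‖ξ‖) ^ d) : IsRem (m + d) fun ξ => z ξ • X ξ := by
  obtain ⟨ι, _, q, c, hq, hX⟩ := hX
  refine ⟨ι, inferInstance, fun l ξ => z ξ * q l ξ, c, fun l => ?_,
    fun ξ => by simp [hX, Finset.smul_sum, mul_smul]⟩
  obtain ⟨C, hC⟩ := hq l
  refine ⟨B * C, fun ξ => ?_⟩
  calc ‖z ξ * q l ξ‖ * (1 + ‖ξ‖) = ‖z ξ‖ * (‖q l ξ‖ * (1 + ‖ξ‖)) := by rw [norm_mul, mul_assoc]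
    _ ≤ (B * (1 + ‖ξ‖) ^ d) * (C * (1 + ‖ξ‖) ^ m) :=
      mul_le_mul (hz ξ) (hC ξ) (by positivity) ((norm_nonneg _).trans (hz ξ))
    _ = _ := by ring

theorem IsRem.mono {m m' : ℕ} {X : Rn n → 𝓓(Ω, ℂ)} (hX : IsRem m X) (h : m ≤ m') :
    IsRem m' X := by
  obtain ⟨d, rfl⟩ := Nat.exists_eq_add_of_le h
  have := hX.smul (z := fun _ => 1) (d := d) (B := 1) fun ξ => by
    simp [one_le_pow₀ (show 1 ≤ 1 + ‖ξ‖ by linarith [norm_nonneg ξ])]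
  simpa using this

/-- Leibniz rule: unless all derivatives hit the plane wave, at least one falls on `χ` and a power
of `ξ` is lost. The growth condition in `IsRem` carries the factor `1 + ‖ξ‖` on the left instead of
an exponent `m - 1`, so that no truncated subtraction occurs and order `0` makes sense. -/
theorem mderiv_modulate (α : Fin n → ℕ) (χ : 𝓓(Ω, ℂ)) :
    ∃ X : Rn n → 𝓓(Ω, ℂ), IsRem (mlen α) X ∧
      ∀ ξ, mderiv α (modulate ξ χ) = modulate ξ (((-1) ^ mlen α * mon α ξ) • χ + X ξ) := by
  obtain ⟨L, hlen, hp, hL⟩ := exists_mderiv_eq_foldr α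
  have hs : ∀ ξ, (-1) ^ mlen α * mon α ξ = (L.map fun i => -zsym ξ i).prod := by
    intro ξ
    rw [← hp, mon, mlen, ← Finset.prod_pow_eq_pow_sum, ← Finset.prod_mul_distrib]
    exact Finset.prod_congr rfl fun i _ => by rw [← mul_pow]; ring
  simp only [hL, hs]
  rw [← hlen]
  clear hs hL hp hlen
  induction L with
  | nil => exact ⟨fun _ => 0, IsRem.zero _, fun ξ => by simp⟩
  | cons i L ih =>
    obtain ⟨X, hX, h⟩ := ih
    have hpr : ∀ ξ : Rn n, ‖(L.map fun i => -zsym ξ i).prod‖ ≤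
        (2 * Real.pi) ^ L.length * (1 + ‖ξ‖) ^ L.length := by
      intro ξ
      rw [← mul_pow]
      clear h hX
      induction L with
      | nil => simp
      | cons i L ih =>
        rw [List.map_cons, List.prod_cons, norm_mul, List.length_cons, pow_succ', norm_neg]
        refine mul_le_mul ((norm_zsym_le ξ i).trans ?_) ih (norm_nonneg _) (by positivity)
        gcongr
        linarith
    -- Of the product `(∂ᵢ - zᵢ)(m χ + X)` only `-zᵢ m χ` is principal; the other three terms form
    -- the new remainder.
    refine ⟨fun ξ => pd i (X ξ) + ((L.map fun i => -zsym ξ i).prod • pd i χ +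
      (-zsym ξ i) • X ξ), ?_, fun ξ => ?_⟩
    · rw [List.length_cons]
      refine ((hX.pd i).mono (by simp)).add (.add ?_ ?_)
      · refine IsRem.single _ (C := (2 * Real.pi) ^ L.length) fun ξ => ?_
        rw [pow_succ, ← mul_assoc]
        gcongr
        exact hpr ξ
      · refine hX.smul (d := 1) (B := 2 * Real.pi) fun ξ => ?_
        rw [norm_neg, pow_one]
        refine (norm_zsym_le ξ i).trans ?_
        gcongr
        linarith
    · rw [List.foldr_cons, h, pd_modulate]
      congr 1
      simp only [map_add, map_smul, List.map_cons, List.prod_cons]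
      module

end BornOp

end

/-! ### Lower bound for the symbol -/

noncomputable section

namespace BornOp

variable {n : ℕ} {Ω : Opens (Rn n)}

/-- The symbol of the constant coefficient operator `∑ a_α ∂^α`. -/
def psym (k : ℕ) (a : (Fin n → ℕ) → ℂ) (ξ : Rn n) : ℂ :=
  ∑ α ∈ multiIndices n 0 k, a α * mon α ξ

/-- The principal symbol. -/
def leadSym (k : ℕ) (a : (Fin n → ℕ) → ℂ) (ξ : Rn n) : ℂ :=
  ∑ α ∈ multiIndices n k k, a α * mon α ξ

theorem continuous_psym (k : ℕ) (a : (Fin n → ℕ) → ℂ) : Continuous (psym k a) :=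
  continuous_finsetSum _ fun α _ => continuous_const.mul (continuous_mon α)

theorem setIntegral_eq_wave_mul (φ : 𝓓(Ω, ℂ)) (ξ : Rn n) (f : Rn n → ℂ) :
    ∫ x in (Ω : Set (Rn n)), f x * modulate ξ φ x = FT Ω (fun x => φ x * f x) ξ := by
  simp only [FT, modulate_apply]
  exact integral_congr_ae (Filter.Eventually.of_forall fun x => by ring)

theorem FT_constCoeffOp (k : ℕ) (a : (Fin n → ℕ) → ℂ) (φ : 𝓓(Ω, ℂ)) (ξ : Rn n) :
    FT Ω (constCoeffOp k a φ) ξ = psym k a ξ * FT Ω φ ξ := by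
  have hint : ∀ ψ : 𝓓(Ω, ℂ), IntegrableOn (fun x => ψ x * wave ξ x) (Ω : Set (Rn n)) := by
    intro ψ
    have := integrable_testFunction (modulate ξ ψ) (volume.restrict (Ω : Set (Rn n)))
    exact this.congr (Filter.Eventually.of_forall fun x => mul_comm _ _)
  have h : ∀ x, constCoeffOp k a φ x = ∑ α ∈ multiIndices n 0 k, a α * mderiv α φ x := by
    intro x
    simp [constCoeffOp]
  simp only [FT, h, Finset.sum_mul, mul_assoc]
  rw [integral_finsetSum _ fun α _ => (hint _).const_mul _]
  simp only [integral_const_mul, psym, Finset.sum_mul]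
  exact Finset.sum_congr rfl fun α _ => by
    have := FT_mderiv α φ ξ
    rw [FT, FT] at this
    rw [this, mul_assoc]

theorem constCoeffOp_modulate (k : ℕ) (b : (Fin n → ℕ) → ℂ) (χ : 𝓓(Ω, ℂ)) :
    ∃ X : Rn n → 𝓓(Ω, ℂ), IsRem k X ∧ ∀ ξ, constCoeffOp k b (modulate ξ χ) =
      modulate ξ (psym k (fun α => (-1) ^ mlen α * b α) ξ • χ + X ξ) := by
  choose X hX h using fun α : Fin n → ℕ => mderiv_modulate α χ
  refine ⟨fun ξ => ∑ α ∈ multiIndices n 0 k, b α • X α ξ, ?_, fun ξ => ?_⟩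
  · refine IsRem.sum _ fun α hα => ?_
    have := (hX α).smul (z := fun _ => b α) (B := ‖b α‖) (d := 0) fun ξ => by simp
    exact this.mono (mem_multiIndices.1 hα).2
  · have hm : ∀ ψ : (Fin n → ℕ) → 𝓓(Ω, ℂ), modulate ξ (∑ α ∈ multiIndices n 0 k, b α • ψ α) =
        ∑ α ∈ multiIndices n 0 k, b α • modulate ξ (ψ α) := by
      intro ψ
      ext x
      simp only [modulate_apply, sum_apply, smul_apply, smul_eq_mul,
        Finset.mul_sum]
      exact Finset.sum_congr rfl fun α _ => by ring
    rw [constCoeffOp, Finset.sum_congr rfl fun α _ => by rw [h α ξ], ← hm]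
    congr 1
    simp only [smul_add, Finset.sum_add_distrib, psym, Finset.sum_smul, smul_smul]
    congr 1
    exact Finset.sum_congr rfl fun α _ => by congr 1; ring

theorem neg_one_pow_mul_self (m : ℕ) (z : ℂ) : (-1) ^ m * ((-1) ^ m * z) = z := by
  rw [← mul_assoc, ← mul_pow]; simp

theorem adjoint_modulate (k : ℕ) (a : (Fin n → ℕ) → ℂ) (χ : 𝓓(Ω, ℂ)) :
    ∃ X : Rn n → 𝓓(Ω, ℂ), IsRem k X ∧ ∀ ξ,
      constCoeffOp k (fun α => (-1) ^ mlen α * a α) (modulate ξ χ) =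
        modulate ξ (psym k a ξ • χ + X ξ) := by
  simpa only [neg_one_pow_mul_self] using
    constCoeffOp_modulate k (fun α => (-1) ^ mlen α * a α) χ

theorem mon_smul (α : Fin n → ℕ) (t : ℝ) (ξ : Rn n) :
    mon α (t • ξ) = (t : ℂ) ^ mlen α * mon α ξ := by
  rw [mon, mon, mlen, ← Finset.prod_pow_eq_pow_sum, ← Finset.prod_mul_distrib]
  refine Finset.prod_congr rfl fun i _ => ?_
  rw [← mul_pow]
  congr 1
  simp [zsym]
  ring

theorem mon_neg (α : Fin n → ℕ) (ξ : Rn n) : mon α (-ξ) = (-1) ^ mlen α * mon α ξ := by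
  have := mon_smul α (-1) ξ
  simpa using this

theorem conj_mon (α : Fin n → ℕ) (ξ : Rn n) :
    (starRingEnd ℂ) (mon α ξ) = (-1) ^ mlen α * mon α ξ := by
  rw [mon, map_prod, mlen, ← Finset.prod_pow_eq_pow_sum, ← Finset.prod_mul_distrib]
  refine Finset.prod_congr rfl fun i _ => ?_
  rw [map_pow, ← mul_pow]
  congr 1
  simp [zsym, map_ofNat]

theorem leadSym_smul (k : ℕ) (a : (Fin n → ℕ) → ℂ) (t : ℝ) (ξ : Rn n) :
    leadSym k a (t • ξ) = (t : ℂ) ^ k * leadSym k a ξ := by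
  rw [leadSym, leadSym, Finset.mul_sum]
  refine Finset.sum_congr rfl fun α hα => ?_
  obtain ⟨h1, h2⟩ := mem_multiIndices.1 hα
  rw [mon_smul, le_antisymm h2 h1]
  ring

/-- Only monomials of degree at most `k - 1` survive in the difference. -/
theorem norm_psym_sub_leadSym_le {k : ℕ} (a : (Fin n → ℕ) → ℂ) :
    ∃ C : ℝ, 0 ≤ C ∧ ∀ ξ, ‖psym k a ξ - leadSym k a ξ‖ * (1 + ‖ξ‖) ≤ C * (1 + ‖ξ‖) ^ k := by
  have hsub : multiIndices n k k ⊆ multiIndices n 0 k := fun α hα =>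
    mem_multiIndices.2 ⟨Nat.zero_le _, (mem_multiIndices.1 hα).2⟩
  refine ⟨∑ α ∈ multiIndices n 0 k \ multiIndices n k k, ‖a α‖ * (2 * Real.pi) ^ mlen α,
    Finset.sum_nonneg fun _ _ => by positivity, fun ξ => ?_⟩
  have : psym k a ξ - leadSym k a ξ =
      ∑ α ∈ multiIndices n 0 k \ multiIndices n k k, a α * mon α ξ := by
    rw [psym, leadSym, ← Finset.sum_sdiff hsub, add_sub_cancel_right]
  rw [this, Finset.sum_mul]
  refine (mul_le_mul_of_nonneg_right (norm_sum_le _ _) (by positivity)).trans ?_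
  rw [Finset.sum_mul]
  refine Finset.sum_le_sum fun α hα => ?_
  rw [Finset.mem_sdiff, mem_multiIndices, mem_multiIndices] at hα
  have hlt : mlen α + 1 ≤ k := by omega
  rw [norm_mul]
  calc ‖a α‖ * ‖mon α ξ‖ * (1 + ‖ξ‖)
      ≤ ‖a α‖ * ((2 * Real.pi) ^ mlen α * (1 + ‖ξ‖) ^ mlen α) * (1 + ‖ξ‖) := by
        gcongr
        refine (norm_mon_le α ξ).trans ?_
        gcongr
        linarith
    _ = ‖a α‖ * (2 * Real.pi) ^ mlen α * (1 + ‖ξ‖) ^ (mlen α + 1) := by ring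
    _ ≤ _ := by
        gcongr
        linarith [norm_nonneg ξ]

variable {k : ℕ} {a : (Fin n → ℕ) → ℂ}

theorem conj_leadSym (hsa : IsFormallySelfAdjointOp k a) (ξ : Rn n) :
    (starRingEnd ℂ) (leadSym k a ξ) = leadSym k a ξ := by
  rw [leadSym, map_sum]
  refine Finset.sum_congr rfl fun α hα => ?_
  rw [map_mul, conj_mon]
  linear_combination (mon α ξ) *
    hsa α (mem_multiIndices.2 ⟨Nat.zero_le _, (mem_multiIndices.1 hα).2⟩)

theorem leadSym_ne_zero (hell : IsEllipticOp k a) {ξ : Rn n} (hξ : ξ ≠ 0) :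
    leadSym k a ξ ≠ 0 := by
  have : leadSym k a ξ = (2 * Real.pi * Complex.I) ^ k *
      ∑ α ∈ multiIndices n k k, a α * ∏ i, ((ξ i : ℝ) : ℂ) ^ α i := by
    rw [leadSym, Finset.mul_sum]
    refine Finset.sum_congr rfl fun α hα => ?_
    obtain ⟨h1, h2⟩ := mem_multiIndices.1 hα
    have : k = mlen α := le_antisymm h1 h2
    rw [mon, this, mlen, ← Finset.prod_pow_eq_pow_sum]
    simp only [zsym, mul_pow, Finset.prod_mul_distrib]
    ring
  rw [this]
  refine mul_ne_zero (pow_ne_zero _ ?_) (hell ξ hξ)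
  simp [Real.pi_ne_zero]

theorem exists_testFunction_eq_one {K : Set (Rn n)} (hK : IsCompact K) (hKΩ : K ⊆ Ω) :
    ∃ χ : 𝓓(Ω, ℂ), ∃ U : Set (Rn n), IsOpen U ∧ K ⊆ U ∧ ∀ x ∈ U, χ x = 1 := by
  obtain ⟨L, hL, hKL, hLΩ⟩ := exists_compact_between hK Ω.isOpen hKΩ
  obtain ⟨M, hM, hLM, hMΩ⟩ := exists_compact_between hL Ω.isOpen hLΩ
  obtain ⟨f, hf, -, hsupp, hone⟩ := exists_contMDiff_support_eq_eq_one_iff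
    (modelWithCornersSelf ℝ (Rn n)) (n := (⊤ : ℕ∞)) isOpen_interior hL.isClosed hLM
  have hts : tsupport f ⊆ M := by
    rw [tsupport, hsupp]
    exact closure_minimal interior_subset hM.isClosed
  refine ⟨⟨fun x => (f x : ℂ), Complex.ofRealCLM.contDiff.comp hf.contDiff, ?_, ?_⟩,
    interior L, isOpen_interior, hKL, fun x hx => ?_⟩
  · have : HasCompactSupport f := hM.of_isClosed_subset (isClosed_tsupport _) hts
    exact this.comp_left Complex.ofReal_zero
  · exact (tsupport_comp_subset Complex.ofReal_zero f).trans (hts.trans hMΩ)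
  · change ((f x : ℝ) : ℂ) = 1
    rw [(hone x).1 (interior_subset hx), Complex.ofReal_one]

theorem psym_neg (ξ : Rn n) : psym k (fun α => (-1) ^ mlen α * a α) ξ = psym k a (-ξ) := by
  refine Finset.sum_congr rfl fun α _ => ?_
  rw [mon_neg]
  ring

/-- The semiboundedness is tested on a modulated bump: `⟨P(wave · χ), wave · χ⟩` equals the symbol
times `‖χ‖²` up to a remainder of order `k - 1`, while the norm of the test function does not depend
on the frequency. -/
theorem psym_bounded_below (hk : 1 ≤ k) (hbb : IsBoundedBelowOp k a) :
    ∃ C : ℝ, ∀ ξ, -(C * (1 + ‖ξ‖) ^ k) ≤ (psym k a ξ).re * (1 + ‖ξ‖) := by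
  obtain ⟨C, hC⟩ := hbb
  obtain ⟨χ, U, hU, hKU, hχ⟩ := exists_testFunction_eq_one (Ω := (⊤ : Opens (Rn n)))
    (isCompact_singleton (x := 0)) (fun _ _ => trivial)
  obtain ⟨X, ⟨ι, _, q, c, hq, hX⟩, hP⟩ := constCoeffOp_modulate k a χ
  choose Cq hCq using hq
  have hint : ∀ ψ : 𝓓((⊤ : Opens (Rn n)), ℂ),
      Integrable fun x => ψ x * (starRingEnd ℂ) (χ x) := by
    intro ψ
    exact (ψ.continuous.mul (conjT χ).continuous).integrable_of_hasCompactSupport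
      (ψ.hasCompactSupport.mul_right)
  set A : ℝ := ∫ x, ‖χ x‖ ^ 2 with hA
  have hA0 : 0 < A := by
    have hcont : Continuous fun x => ‖χ x‖ ^ 2 := by fun_prop
    refine hcont.integral_pos_of_hasCompactSupport_nonneg_nonzero (x := 0) ?_
      (fun x => by positivity) ?_
    · have := χ.hasCompactSupport.comp_left (g := fun z : ℂ => ‖z‖ ^ 2) (by simp)
      exact this
    · simp [hχ 0 (hKU rfl)]
  set d : ι → ℂ := fun l => ∫ x, c l x * (starRingEnd ℂ) (χ x) with hd
  have hχχ : ∫ x, χ x * (starRingEnd ℂ) (χ x) = (A : ℂ) := by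
    rw [hA, ← integral_complex_ofReal]
    refine integral_congr_ae (Filter.Eventually.of_forall fun x => ?_)
    simp [Complex.mul_conj, Complex.normSq_eq_norm_sq]
  refine ⟨(|C| * A + ∑ l, Cq l * ‖d l‖) / A, fun η => ?_⟩
  -- The wave of frequency `ξ` is `exp (-2πi⟨x, ξ⟩)`, on which `P` acts by its symbol at `-ξ`; hence
  -- the change of sign.
  set ξ := -η with hξ
  have hn : ‖η‖ = ‖ξ‖ := by simp [hξ]
  have hpη : psym k (fun α => (-1) ^ mlen α * a α) ξ = psym k a η := by
    rw [psym_neg, hξ, neg_neg]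
  have h1 := hC (modulate ξ χ)
  have e1 : ∫ x, ‖modulate ξ χ x‖ ^ 2 = A := by simp [hA, norm_wave]
  have e2 : ∫ x, constCoeffOp k a (modulate ξ χ) x * (starRingEnd ℂ) (modulate ξ χ x) =
      psym k a η * A + ∑ l, q l ξ * d l := by
    have : ∀ x, constCoeffOp k a (modulate ξ χ) x * (starRingEnd ℂ) (modulate ξ χ x) =
        psym k a η * (χ x * (starRingEnd ℂ) (χ x)) +
          ∑ l, q l ξ * (c l x * (starRingEnd ℂ) (χ x)) := by
      intro x
      have hw : wave ξ x * (starRingEnd ℂ) (wave ξ x) = 1 := by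
        rw [Complex.mul_conj, Complex.normSq_eq_norm_sq, norm_wave]; simp
      rw [hP, hX, hpη]
      simp only [modulate_apply, add_apply, smul_apply, sum_apply, smul_eq_mul, map_mul]
      have : ∑ l, q l ξ * (c l x * (starRingEnd ℂ) (χ x)) =
          (∑ l, q l ξ * c l x) * (starRingEnd ℂ) (χ x) := by
        rw [Finset.sum_mul]
        exact Finset.sum_congr rfl fun l _ => by ring
      rw [this]
      linear_combination ((psym k a η * χ x + ∑ l, q l ξ * c l x) *
        (starRingEnd ℂ) (χ x)) * hw
    simp only [this]
    rw [integral_add ((hint χ).const_mul _)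
      (integrable_finsetSum _ fun l _ => (hint (c l)).const_mul _), integral_const_mul, hχχ,
      integral_finsetSum _ fun l _ => (hint (c l)).const_mul _]
    simp only [integral_const_mul, hd]
  rw [e1, e2, Complex.add_re, Complex.re_mul_ofReal] at h1
  have h2 : (∑ l, q l ξ * d l).re * (1 + ‖ξ‖) ≤ (∑ l, Cq l * ‖d l‖) * (1 + ‖ξ‖) ^ k := by
    calc _ ≤ (∑ l, ‖q l ξ‖ * ‖d l‖) * (1 + ‖ξ‖) := by
          refine mul_le_mul_of_nonneg_right ?_ (by positivity)
          refine (Complex.re_le_norm _).trans ((norm_sum_le _ _).trans ?_)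
          simp
      _ = ∑ l, ‖q l ξ‖ * (1 + ‖ξ‖) * ‖d l‖ := by
          rw [Finset.sum_mul]
          exact Finset.sum_congr rfl fun l _ => by ring
      _ ≤ ∑ l, Cq l * (1 + ‖ξ‖) ^ k * ‖d l‖ :=
          Finset.sum_le_sum fun l _ => mul_le_mul_of_nonneg_right (hCq l ξ) (norm_nonneg _)
      _ = _ := by
          rw [Finset.sum_mul]
          exact Finset.sum_congr rfl fun l _ => by ring
  have h3 : C * A * (1 + ‖ξ‖) ≤ |C| * A * (1 + ‖ξ‖) ^ k := by
    have : (1 + ‖ξ‖) ≤ (1 + ‖ξ‖) ^ k :=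
      le_self_pow₀ (by linarith [norm_nonneg ξ]) (by omega)
    calc C * A * (1 + ‖ξ‖) ≤ |C| * A * (1 + ‖ξ‖) := by gcongr; exact le_abs_self C
      _ ≤ _ := by gcongr
  rw [hn]
  have h4 : -(C * A) * (1 + ‖ξ‖) ≤ ((psym k a η).re * A + (∑ l, q l ξ * d l).re) * (1 + ‖ξ‖) :=
    mul_le_mul_of_nonneg_right (by linarith) (by positivity)
  rw [← mul_le_mul_iff_left₀ hA0]
  have : (|C| * A + ∑ l, Cq l * ‖d l‖) / A * (1 + ‖ξ‖) ^ k * A =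
      (|C| * A + ∑ l, Cq l * ‖d l‖) * (1 + ‖ξ‖) ^ k := by field_simp
  rw [neg_mul, this]
  linarith

/-- Self-adjointness makes the principal symbol real and ellipticity makes it nonzero. Were it
negative at `ξ`, it would tend to `-∞` like `t^k` along the ray `tξ`, whereas the lower bound and
the lower order terms only allow `t^(k-1)`. -/
theorem leadSym_re_pos (hk : 1 ≤ k) (hell : IsEllipticOp k a) (hsa : IsFormallySelfAdjointOp k a)
    (hbb : IsBoundedBelowOp k a) {ξ : Rn n} (hξ : ξ ≠ 0) : 0 < (leadSym k a ξ).re := by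
  have him : (leadSym k a ξ).im = 0 := Complex.conj_eq_iff_im.1 (conj_leadSym hsa ξ)
  have hne : (leadSym k a ξ).re ≠ 0 := fun h =>
    leadSym_ne_zero hell hξ (Complex.ext h him)
  refine lt_of_le_of_ne ?_ hne.symm
  by_contra! hneg
  obtain ⟨C, hC⟩ := psym_bounded_below hk hbb
  obtain ⟨C', hC', hlow⟩ := norm_psym_sub_leadSym_le (k := k) a
  set D : ℝ := (|C| + C') * (1 + ‖ξ‖) ^ k
  have hD : 0 ≤ D := by positivity
  have hpos : 0 < ‖ξ‖ := norm_pos_iff.2 hξ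
  -- All estimates at `tξ` are homogeneous enough to be divided by `t^k`, leaving a bound uniform in
  -- `t`.
  have key : ∀ t : ℝ, 1 ≤ t → -D ≤ (leadSym k a ξ).re * (1 + t * ‖ξ‖) := by
    intro t ht
    have ht0 : 0 < t := by linarith
    have hnt : ‖t • ξ‖ = t * ‖ξ‖ := by rw [norm_smul, Real.norm_of_nonneg ht0.le]
    have h1 := hC (t • ξ)
    have h2 := hlow (t • ξ)
    have h3 : (psym k a (t • ξ)).re ≤ t ^ k * (leadSym k a ξ).re +
        ‖psym k a (t • ξ) - leadSym k a (t • ξ)‖ := by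
      have := Complex.re_le_norm (psym k a (t • ξ) - leadSym k a (t • ξ))
      rw [Complex.sub_re, leadSym_smul, ← Complex.ofReal_pow, Complex.re_ofReal_mul] at this
      rw [leadSym_smul, ← Complex.ofReal_pow]
      linarith
    rw [hnt] at h1 h2
    have h4 : (1 + t * ‖ξ‖) ^ k ≤ t ^ k * (1 + ‖ξ‖) ^ k := by
      rw [← mul_pow]; gcongr; nlinarith
    have h5 : (psym k a (t • ξ)).re * (1 + t * ‖ξ‖) ≤
        t ^ k * (leadSym k a ξ).re * (1 + t * ‖ξ‖) + C' * (1 + t * ‖ξ‖) ^ k := by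
      refine (mul_le_mul_of_nonneg_right h3 (by positivity)).trans ?_
      rw [add_mul]
      linarith
    have h6 : (|C| + C') * (1 + t * ‖ξ‖) ^ k ≤ t ^ k * D := by
      calc _ ≤ (|C| + C') * (t ^ k * (1 + ‖ξ‖) ^ k) := by gcongr
        _ = _ := by ring
    have h7 : C * (1 + t * ‖ξ‖) ^ k ≤ |C| * (1 + t * ‖ξ‖) ^ k := by
      gcongr; exact le_abs_self C
    have h8 : t ^ k * -D ≤ t ^ k * ((leadSym k a ξ).re * (1 + t * ‖ξ‖)) := by linarith
    exact le_of_mul_le_mul_left h8 (by positivity)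
  set r := (leadSym k a ξ).re
  have hr : 0 < -r * ‖ξ‖ := mul_pos (by linarith) hpos
  -- This `t` makes the right side `r + r‖ξ‖ - D`, which is less than `-D` as `r < 0`.
  have := key (1 + D / (-r * ‖ξ‖)) (le_add_of_nonneg_right (by positivity))
  have e : r * (1 + (1 + D / (-r * ‖ξ‖)) * ‖ξ‖) = r + r * ‖ξ‖ - D := by
    field_simp
    ring
  rw [e] at this
  linarith

/-- Compactness of the unit sphere gives a positive minimum, and homogeneity extends it to all `ξ`.
-/
theorem exists_leadSym_ge (hk : 1 ≤ k) (hell : IsEllipticOp k a)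
    (hsa : IsFormallySelfAdjointOp k a) (hbb : IsBoundedBelowOp k a) :
    ∃ c : ℝ, 0 < c ∧ ∀ ξ, c * ‖ξ‖ ^ k ≤ (leadSym k a ξ).re := by
  have hcont : Continuous fun ξ => (leadSym k a ξ).re :=
    Complex.continuous_re.comp
      (continuous_finsetSum _ fun α _ => continuous_const.mul (continuous_mon α))
  obtain ⟨c, hc, h⟩ := (isCompact_sphere (0 : Rn n) 1).exists_forall_le' hcont.continuousOn
    (a := 0) fun ξ hξ => leadSym_re_pos hk hell hsa hbb (by
      rintro rfl
      simp at hξ)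
  refine ⟨c, hc, fun ξ => ?_⟩
  rcases eq_or_ne ξ 0 with rfl | hξ
  · have := leadSym_smul k a 0 (0 : Rn n)
    rw [zero_smul, Complex.ofReal_zero, zero_pow (by omega), zero_mul] at this
    simp [this, show k ≠ 0 by omega]
  · have hpos : 0 < ‖ξ‖ := norm_pos_iff.2 hξ
    have h1 := h (‖ξ‖⁻¹ • ξ) (by simp [norm_smul, hpos.ne'])
    have h2 := leadSym_smul k a ‖ξ‖ (‖ξ‖⁻¹ • ξ)
    rw [smul_inv_smul₀ hpos.ne', ← Complex.ofReal_pow] at h2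
    rw [h2, Complex.re_ofReal_mul, mul_comm]
    gcongr

/-- Lower bound of the symbol of `P + s^k`. -/
theorem exists_psym_add_ge (hk : 1 ≤ k) (hell : IsEllipticOp k a)
    (hsa : IsFormallySelfAdjointOp k a) (hbb : IsBoundedBelowOp k a) :
    ∃ c : ℝ, 0 < c ∧ ∃ s₀ : ℝ, 1 ≤ s₀ ∧ ∀ s, s₀ ≤ s → ∀ ξ,
      c * (‖ξ‖ + s) ^ k ≤ (psym k a ξ).re + s ^ k := by
  obtain ⟨c, hc, hlead⟩ := exists_leadSym_ge hk hell hsa hbb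
  obtain ⟨C, hC, hlow⟩ := norm_psym_sub_leadSym_le (k := k) a
  obtain ⟨j, rfl⟩ : ∃ j, k = j + 1 := ⟨k - 1, by omega⟩
  set c₁ := min c 1
  have hc₁ : 0 < c₁ := lt_min hc one_pos
  -- By convexity `(|ξ| + s)^k ≤ 2^(k-1) (|ξ|^k + s^k)`, so the principal part plus `s^k` is at
  -- least `2 c₂ (|ξ| + s)^k`. The lower order terms, at most `C (|ξ| + s)^(k-1)`, use up one of the
  -- two copies as soon as `s ≥ C / c₂`.
  set c₂ := c₁ / 2 ^ (j + 1)
  have hc₂ : 0 < c₂ := by positivity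
  refine ⟨c₂, hc₂, max 1 (C / c₂), le_max_left _ _, fun s hs ξ => ?_⟩
  have hs1 : 1 ≤ s := (le_max_left _ _).trans hs
  have hsC : C ≤ c₂ * s := by
    have := (le_max_right _ _).trans hs
    rwa [div_le_iff₀' hc₂] at this
  have hr := norm_nonneg ξ
  have h1 : ‖psym (j + 1) a ξ - leadSym (j + 1) a ξ‖ ≤ c₂ * (‖ξ‖ + s) ^ (j + 1) := by
    have h := hlow ξ
    rw [pow_succ, ← mul_assoc] at h
    have h' := le_of_mul_le_mul_right h (by positivity)
    calc _ ≤ C * (1 + ‖ξ‖) ^ j := h'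
      _ ≤ (c₂ * s) * (‖ξ‖ + s) ^ j := by
        gcongr ?_ * ?_ ^ j
        linarith
      _ ≤ (c₂ * (‖ξ‖ + s)) * (‖ξ‖ + s) ^ j := by gcongr; linarith
      _ = _ := by ring
  have h2 : (leadSym (j + 1) a ξ).re - (psym (j + 1) a ξ).re ≤ c₂ * (‖ξ‖ + s) ^ (j + 1) := by
    rw [norm_sub_rev] at h1
    exact (Complex.re_le_norm _).trans h1
  have h3 : (‖ξ‖ + s) ^ (j + 1) ≤ 2 ^ j * (‖ξ‖ ^ (j + 1) + s ^ (j + 1)) :=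
    add_pow_le hr (by linarith) (j + 1)
  have h4 : 2 * (c₂ * (‖ξ‖ + s) ^ (j + 1)) ≤ c₁ * (‖ξ‖ ^ (j + 1) + s ^ (j + 1)) := by
    calc 2 * (c₂ * (‖ξ‖ + s) ^ (j + 1))
        ≤ 2 * (c₂ * (2 ^ j * (‖ξ‖ ^ (j + 1) + s ^ (j + 1)))) := by gcongr
      _ = _ := by simp only [c₂]; field_simp; ring
  have h5 : c₁ * ‖ξ‖ ^ (j + 1) ≤ (leadSym (j + 1) a ξ).re :=
    (mul_le_mul_of_nonneg_right (min_le_left _ _) (by positivity)).trans (hlead ξ)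
  have h6 : c₁ * s ^ (j + 1) ≤ s ^ (j + 1) :=
    mul_le_of_le_one_left (by positivity) (min_le_right _ _)
  linarith

/-- The matching upper bound turns a weighted estimate for the Fourier transform of a cut-off
solution into an `L²` bound after multiplication by `p + s^k`. -/
theorem exists_norm_psym_add_le (k : ℕ) (a : (Fin n → ℕ) → ℂ) :
    ∃ C : ℝ, 0 ≤ C ∧ ∀ s : ℝ, 1 ≤ s → ∀ ξ,
      ‖psym k a ξ + (s : ℂ) ^ k‖ ≤ C * (‖ξ‖ + s) ^ k := by
  refine ⟨∑ α ∈ multiIndices n 0 k, ‖a α‖ * (2 * Real.pi) ^ mlen α + 1, by positivity,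
    fun s hs ξ => ?_⟩
  have hr := norm_nonneg ξ
  refine (norm_add_le _ _).trans ?_
  rw [add_mul, one_mul, psym, Finset.sum_mul]
  refine add_le_add ((norm_sum_le _ _).trans (Finset.sum_le_sum fun α hα => ?_)) ?_
  · rw [norm_mul, mul_assoc]
    gcongr
    refine (norm_mon_le α ξ).trans ?_
    gcongr
    calc ‖ξ‖ ^ mlen α ≤ (‖ξ‖ + s) ^ mlen α := by gcongr; linarith
      _ ≤ _ := pow_le_pow_right₀ (by linarith) (mem_multiIndices.1 hα).2
  · rw [norm_pow, Complex.norm_real, Real.norm_of_nonneg (by linarith)]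
    gcongr
    linarith

end BornOp

end

/-! ### The Fourier transform and multiplication operators on `L²` -/

noncomputable section

namespace BornOp

variable {n : ℕ} {Ω : Opens (Rn n)}

/-- The complex Hilbert space `L²(ℝⁿ)`. -/
abbrev L2x (n : ℕ) : Type := Lp ℂ 2 (volume : Measure (Rn n))

theorem memLp_indicator_L2 (f : L2 Ω) :
    MemLp ((Ω : Set (Rn n)).indicator f) 2 (volume : Measure (Rn n)) :=
  (memLp_indicator_iff_restrict Ω.isOpen.measurableSet).2 (Lp.memLp f)

/-- Extension by zero. -/
def extL (Ω : Opens (Rn n)) : L2 Ω →ₗᵢ[ℂ] L2x n where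
  toFun f := (memLp_indicator_L2 f).toLp _
  map_add' f g := by
    apply Lp.ext
    have h := Lp.coeFn_add f g
    rw [Filter.EventuallyEq, ae_restrict_iff' Ω.isOpen.measurableSet] at h
    filter_upwards [(memLp_indicator_L2 (f + g)).coeFn_toLp, (memLp_indicator_L2 f).coeFn_toLp,
      (memLp_indicator_L2 g).coeFn_toLp, Lp.coeFn_add ((memLp_indicator_L2 f).toLp _)
      ((memLp_indicator_L2 g).toLp _), h] with x h1 h2 h3 h4 h5
    rw [h1, h4, Pi.add_apply, h2, h3]
    by_cases hx : x ∈ (Ω : Set (Rn n))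
    · simp only [Set.indicator_of_mem hx, h5 hx, Pi.add_apply]
    · simp only [Set.indicator_of_notMem hx, add_zero]
  map_smul' c f := by
    apply Lp.ext
    have h := Lp.coeFn_smul c f
    rw [Filter.EventuallyEq, ae_restrict_iff' Ω.isOpen.measurableSet] at h
    filter_upwards [(memLp_indicator_L2 (c • f)).coeFn_toLp, (memLp_indicator_L2 f).coeFn_toLp,
      Lp.coeFn_smul c ((memLp_indicator_L2 f).toLp _), h] with x h1 h2 h4 h5
    rw [h1, RingHom.id_apply, h4, Pi.smul_apply, h2]
    by_cases hx : x ∈ (Ω : Set (Rn n))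
    · simp only [Set.indicator_of_mem hx, h5 hx, Pi.smul_apply]
    · simp only [Set.indicator_of_notMem hx, smul_zero]
  norm_map' f := by
    change ‖(memLp_indicator_L2 f).toLp _‖ = ‖f‖
    rw [Lp.norm_toLp, Lp.norm_def, eLpNorm_indicator_eq_eLpNorm_restrict Ω.isOpen.measurableSet]

theorem extL_coe (f : L2 Ω) : extL Ω f =ᵐ[volume] (Ω : Set (Rn n)).indicator f :=
  (memLp_indicator_L2 f).coeFn_toLp

/-- The Fourier transform of the extension by zero. -/
def FL (Ω : Opens (Rn n)) : L2 Ω →ₗᵢ[ℂ] L2x n :=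
  (Lp.fourierTransformₗᵢ (Rn n) ℂ).toLinearIsometry.comp (extL Ω)

theorem isFiniteMeasure_restrict (hbd : Bornology.IsBounded (Ω : Set (Rn n))) :
    IsFiniteMeasure (volume.restrict (Ω : Set (Rn n))) :=
  ⟨by rw [Measure.restrict_apply_univ]; exact hbd.measure_lt_top⟩

theorem integrable_L2 (hbd : Bornology.IsBounded (Ω : Set (Rn n))) (f : L2 Ω) :
    IntegrableOn f (Ω : Set (Rn n)) :=
  haveI := isFiniteMeasure_restrict hbd
  (Lp.memLp f).integrable one_le_two

theorem FT_eq_fourier (f : Rn n → ℂ) :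
    FT Ω f = FourierTransform.fourier ((Ω : Set (Rn n)).indicator f) := by
  ext ξ
  rw [FT, Real.fourier_eq, ← integral_indicator Ω.isOpen.measurableSet]
  refine integral_congr_ae (Filter.Eventually.of_forall fun x => ?_)
  by_cases hx : x ∈ (Ω : Set (Rn n))
  · simp only [Set.indicator_of_mem hx]
    rw [Circle.smul_def, Real.fourierChar_apply, smul_eq_mul, wave, mul_comm]
    congr 3
    push_cast
    ring
  · simp only [Set.indicator_of_notMem hx, smul_zero]

theorem continuous_FT {f : Rn n → ℂ} (hf : IntegrableOn f (Ω : Set (Rn n))) :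
    Continuous (FT Ω f) := by
  refine continuous_of_dominated (bound := fun x => ‖f x‖) (fun ξ => ?_) (fun ξ => ?_) hf.norm
    (Filter.Eventually.of_forall fun x => ?_)
  · exact hf.aestronglyMeasurable.mul
      (contDiff_wave ξ (m := 0)).continuous.aestronglyMeasurable
  · exact Filter.Eventually.of_forall fun x => by rw [norm_mul, norm_wave, mul_one]
  · exact continuous_const.mul (continuous_wave x)

/-- As `Ω` is bounded, `L²(Ω) ⊆ L¹(Ω)` and the Fourier integral converges. Both sides are locally
integrable and agree against smooth compactly supported functions, by the distributional definition
on one side and Fubini on the other. -/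
theorem FL_coe (hbd : Bornology.IsBounded (Ω : Set (Rn n))) (f : L2 Ω) :
    FL Ω f =ᵐ[volume] FT Ω f := by
  have hf := integrable_L2 hbd f
  have hif : Integrable ((Ω : Set (Rn n)).indicator f) :=
    (integrable_indicator_iff Ω.isOpen.measurableSet).2 hf
  apply ae_eq_of_integral_contDiff_smul_eq
  · exact (Lp.memLp (FL Ω f)).locallyIntegrable one_le_two
  · exact (continuous_FT hf).locallyIntegrable
  · intro g hg hgc
    have hg₁ : HasCompactSupport (Complex.ofRealCLM ∘ g) := hgc.comp_left rfl
    have hg₂ : ContDiff ℝ (⊤ : ℕ∞) (Complex.ofRealCLM ∘ g) := by fun_prop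
    set v := hg₁.toSchwartzMap hg₂ with hv
    have hvx : ∀ x, v x = (g x : ℂ) := fun x => by simp [hv]
    have h1 : ∫ x, g x • FL Ω f x = Lp.toTemperedDistribution (FL Ω f) v := by
      rw [Lp.toTemperedDistribution_apply]
      simp [hvx]
    have h2 : Lp.toTemperedDistribution (FL Ω f) =
        FourierTransform.fourier (Lp.toTemperedDistribution (extL Ω f)) :=
      (Lp.fourier_toTemperedDistribution_eq (extL Ω f)).symm
    have h3 : ∫ x, FourierTransform.fourier v x • (Ω : Set (Rn n)).indicator f x =
        ∫ x, v x • FourierTransform.fourier ((Ω : Set (Rn n)).indicator f) x := by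
      rw [SchwartzMap.fourier_coe]
      simpa using! VectorFourier.integral_fourierIntegral_smul_eq_flip (L := innerₗ (Rn n))
        Real.continuous_fourierChar continuous_inner v.integrable hif
    rw [h1, h2, TemperedDistribution.fourier_apply, Lp.toTemperedDistribution_apply, FT_eq_fourier,
      integral_congr_ae (g := fun x => FourierTransform.fourier v x •
        (Ω : Set (Rn n)).indicator f x) (by
          filter_upwards [extL_coe f] with x hx
          rw [hx]), h3]
    simp [hvx]

/-- A test function as an element of `L²(Ω)`. -/
def tL2 (φ : 𝓓(Ω, ℂ)) : L2 Ω :=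
  MemLp.toLp φ (φ.continuous.memLp_of_hasCompactSupport φ.hasCompactSupport)

theorem tL2_coe (φ : 𝓓(Ω, ℂ)) : tL2 φ =ᵐ[volume.restrict (Ω : Set (Rn n))] φ :=
  MemLp.coeFn_toLp _

theorem FT_congr {f g : Rn n → ℂ} (h : f =ᵐ[volume.restrict (Ω : Set (Rn n))] g) :
    FT Ω f = FT Ω g := by
  ext ξ
  exact integral_congr_ae (by filter_upwards [h] with x hx; rw [hx])

theorem FL_tL2 (hbd : Bornology.IsBounded (Ω : Set (Rn n))) (φ : 𝓓(Ω, ℂ)) :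
    FL Ω (tL2 φ) =ᵐ[volume] FT Ω φ := by
  rw [← FT_congr (tL2_coe φ)]
  exact FL_coe hbd _

theorem inner_tL2_conjT (φ : 𝓓(Ω, ℂ)) (f : L2 Ω) :
    inner ℂ (tL2 (conjT φ)) f = ∫ x in (Ω : Set (Rn n)), f x * φ x := by
  rw [L2.inner_def]
  refine integral_congr_ae ?_
  filter_upwards [tL2_coe (conjT φ)] with x hx
  rw [hx, RCLike.inner_apply]
  simp

/-- Multiplication by an essentially bounded function on `L²`. -/
def mulOp {X : Type*} [MeasurableSpace X] (μ : Measure X) (m : X → ℂ) :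
    Lp ℂ 2 μ →L[ℂ] Lp ℂ 2 μ :=
  open scoped Classical in
  if h : MemLp m ∞ μ then (ContinuousLinearMap.mul ℂ ℂ).holderL μ ∞ 2 2 (h.toLp m) else 0

section mulOp

variable {X : Type*} [MeasurableSpace X] {μ : Measure X} {m : X → ℂ}

theorem mulOp_coe (h : MemLp m ∞ μ) (f : Lp ℂ 2 μ) :
    mulOp μ m f =ᵐ[μ] fun x => m x * f x := by
  rw [mulOp, dif_pos h]
  filter_upwards [(ContinuousLinearMap.mul ℂ ℂ).coeFn_holder (h.toLp m) f (r := 2),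
    h.coeFn_toLp] with x h1 h2
  change ((ContinuousLinearMap.mul ℂ ℂ).holder 2 (h.toLp m) f) x = _
  rw [h1, h2]
  rfl

theorem norm_mulOp_le {C : ℝ} (hC : 0 ≤ C) (h : ∀ᵐ x ∂μ, ‖m x‖ ≤ C) : ‖mulOp μ m‖ ≤ C := by
  by_cases hm : MemLp m ∞ μ
  · refine ContinuousLinearMap.opNorm_le_bound _ hC fun f => ?_
    refine Lp.norm_le_mul_norm_of_ae_le_mul ?_
    filter_upwards [mulOp_coe hm f, h] with x h1 h2
    rw [h1, norm_mul]
    gcongr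
  -- For a multiplier outside `L^∞` the operator has the default value zero, which satisfies every
  -- bound.
  · rw [mulOp, dif_neg hm, norm_zero]
    exact hC

end mulOp

theorem memLp_top_testFunction (χ : 𝓓(Ω, ℂ)) (μ : Measure (Rn n)) : MemLp χ ∞ μ := χ.memLp_top

end BornOp

end

/-! ### The multipliers `∂^α (P + s^k)⁻¹` -/

noncomputable section

namespace BornOp

variable {n : ℕ} {Ω : Opens (Rn n)} {k : ℕ} {a : (Fin n → ℕ) → ℂ} {c s₀ s : ℝ}

/-- The lower bound `c (|ξ| + s)^k ≤ p(ξ) + s^k` for `s ≥ s₀ ≥ 1`. -/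
structure SymBound (k : ℕ) (a : (Fin n → ℕ) → ℂ) (c s₀ : ℝ) : Prop where
  hk : 1 ≤ k
  hc : 0 < c
  hs₀ : 1 ≤ s₀
  hsa : IsFormallySelfAdjointOp k a
  lower : ∀ s, s₀ ≤ s → ∀ ξ : Rn n, c * (‖ξ‖ + s) ^ k ≤ (psym k a ξ).re + s ^ k

/-- The symbol `p(ξ) + s^k`. -/
def den (k : ℕ) (a : (Fin n → ℕ) → ℂ) (s : ℝ) (ξ : Rn n) : ℂ := psym k a ξ + (s : ℂ) ^ k

/-- The symbol of `∂^α (P + s^k)⁻¹`. -/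
def mSym (k : ℕ) (a : (Fin n → ℕ) → ℂ) (s : ℝ) (α : Fin n → ℕ) (ξ : Rn n) : ℂ :=
  mon α ξ / den k a s ξ

theorem continuous_den : Continuous (den k a s) :=
  (continuous_psym k a).add continuous_const

namespace SymBound

variable (h : SymBound k a c s₀)

include h

theorem one_le (hs : s₀ ≤ s) : 1 ≤ s := h.hs₀.trans hs

theorem norm_den_ge (hs : s₀ ≤ s) (ξ : Rn n) : c * (‖ξ‖ + s) ^ k ≤ ‖den k a s ξ‖ := by
  refine (h.lower s hs ξ).trans (le_trans (le_of_eq ?_) (Complex.re_le_norm _))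
  rw [den, Complex.add_re, ← Complex.ofReal_pow, Complex.ofReal_re]

theorem add_pos (hs : s₀ ≤ s) (ξ : Rn n) : 0 < ‖ξ‖ + s := by
  linarith [norm_nonneg ξ, h.one_le hs]

theorem den_ne_zero (hs : s₀ ≤ s) (ξ : Rn n) : den k a s ξ ≠ 0 := by
  have := h.norm_den_ge hs ξ
  have h2 := h.add_pos hs ξ
  have h3 := h.hc
  exact norm_pos_iff.1 (lt_of_lt_of_le (by positivity) this)

/-- The weight `(‖ξ‖ + s)^(k - |α|)` records decay in `s`, which gives the operator norms, and decay
in `ξ`, which gives compactness when `|α| < k`. -/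
theorem norm_mSym_le (hs : s₀ ≤ s) {α : Fin n → ℕ} (hα : mlen α ≤ k) (ξ : Rn n) :
    ‖mSym k a s α ξ‖ * (‖ξ‖ + s) ^ (k - mlen α) ≤ (2 * Real.pi) ^ k / c := by
  have h1 := h.norm_den_ge hs ξ
  have h2 := h.add_pos hs ξ
  have h3 := h.hc
  have h4 : 0 < ‖den k a s ξ‖ := norm_pos_iff.2 (h.den_ne_zero hs ξ)
  have hpi : 1 ≤ 2 * Real.pi := by linarith [Real.pi_gt_three]
  rw [mSym, norm_div, div_mul_eq_mul_div, div_le_div_iff₀ h4 h3]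
  have h5 : ‖mon α ξ‖ * (‖ξ‖ + s) ^ (k - mlen α) ≤ (2 * Real.pi) ^ k * (‖ξ‖ + s) ^ k := by
    calc _ ≤ ((2 * Real.pi) ^ mlen α * ‖ξ‖ ^ mlen α) * (‖ξ‖ + s) ^ (k - mlen α) := by
          gcongr; exact norm_mon_le α ξ
      _ ≤ ((2 * Real.pi) ^ k * (‖ξ‖ + s) ^ mlen α) * (‖ξ‖ + s) ^ (k - mlen α) := by
          gcongr
          linarith [h.one_le hs]
      _ = _ := by rw [mul_assoc, ← pow_add, Nat.add_sub_cancel' hα]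
  calc _ ≤ (2 * Real.pi) ^ k * (‖ξ‖ + s) ^ k * c := by gcongr
    _ = (2 * Real.pi) ^ k * (c * (‖ξ‖ + s) ^ k) := by ring
    _ ≤ _ := by gcongr

theorem norm_mSym_le' (hs : s₀ ≤ s) {α : Fin n → ℕ} (hα : mlen α ≤ k) (ξ : Rn n) :
    ‖mSym k a s α ξ‖ ≤ (2 * Real.pi) ^ k / c / s ^ (k - mlen α) := by
  have hs1 := h.one_le hs
  rw [le_div_iff₀ (by positivity)]
  refine le_trans ?_ (h.norm_mSym_le hs hα ξ)
  gcongr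
  linarith [norm_nonneg ξ]

theorem continuous_mSym (hs : s₀ ≤ s) (α : Fin n → ℕ) : Continuous (mSym k a s α) :=
  (continuous_mon α).div continuous_den (h.den_ne_zero hs)

theorem memLp_mSym (hs : s₀ ≤ s) {α : Fin n → ℕ} (hα : mlen α ≤ k) :
    MemLp (mSym k a s α) ∞ (volume : Measure (Rn n)) :=
  memLp_top_of_bound (h.continuous_mSym hs α).aestronglyMeasurable _
    (Filter.Eventually.of_forall (h.norm_mSym_le' hs hα))

end SymBound

/-- The adjoint of the Fourier transform on `Ω`. -/
def FLadj (Ω : Opens (Rn n)) : L2x n →L[ℂ] L2 Ω :=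
  ContinuousLinearMap.adjoint (FL Ω).toContinuousLinearMap

theorem inner_FLadj (f : L2 Ω) (v : L2x n) : inner ℂ f (FLadj Ω v) = inner ℂ (FL Ω f) v :=
  ContinuousLinearMap.adjoint_inner_right _ _ _

theorem FLadj_FL (f : L2 Ω) : FLadj Ω (FL Ω f) = f := by
  refine ext_inner_left ℂ fun g => ?_
  rw [inner_FLadj, LinearIsometry.inner_map_map]

theorem norm_FLadj_le : ‖FLadj Ω‖ ≤ 1 := by
  rw [FLadj, LinearIsometryEquiv.norm_map]
  exact LinearIsometry.norm_toContinuousLinearMap_le _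

/-- The operator `v ↦ ∂^α (P + s^k)⁻¹ v` from the Fourier side to `L²(Ω)`. -/
def Psi (Ω : Opens (Rn n)) (k : ℕ) (a : (Fin n → ℕ) → ℂ) (s : ℝ) (α : Fin n → ℕ) :
    L2x n →L[ℂ] L2 Ω := FLadj Ω ∘L mulOp volume (mSym k a s α)

theorem Psi_eq_of_ae (h : SymBound k a c s₀) (hs : s₀ ≤ s) {α : Fin n → ℕ} (hα : mlen α ≤ k)
    {v w : L2x n} (hw : w =ᵐ[volume] fun ξ => mSym k a s α ξ * v ξ) :
    Psi Ω k a s α v = FLadj Ω w := by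
  have : mulOp volume (mSym k a s α) v = w := by
    apply Lp.ext
    filter_upwards [mulOp_coe (h.memLp_mSym hs hα) v, hw] with ξ h1 h2
    rw [h1, h2]
  rw [Psi, ContinuousLinearMap.comp_apply, this]

theorem norm_Psi_le (h : SymBound k a c s₀) (hs : s₀ ≤ s) {α : Fin n → ℕ} (hα : mlen α ≤ k) :
    ‖Psi Ω k a s α‖ ≤ (2 * Real.pi) ^ k / c / s ^ (k - mlen α) := by
  have hc := h.hc
  have hs1 := h.one_le hs
  refine (ContinuousLinearMap.opNorm_comp_le _ _).trans ?_
  rw [← one_mul ((2 * Real.pi) ^ k / c / s ^ (k - mlen α))]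
  gcongr
  · exact norm_FLadj_le
  · exact norm_mulOp_le (by positivity) (Filter.Eventually.of_forall (h.norm_mSym_le' hs hα))

section

variable (hbd : Bornology.IsBounded (Ω : Set (Rn n)))

include hbd

theorem locallyIntegrableOn_L2 (f : L2 Ω) : LocallyIntegrableOn f (Ω : Set (Rn n)) :=
  (integrable_L2 hbd f).locallyIntegrableOn

theorem integral_FLadj_mul (v : L2x n) (φ : 𝓓(Ω, ℂ)) :
    ∫ x in (Ω : Set (Rn n)), FLadj Ω v x * φ x =
      ∫ ξ, v ξ * (starRingEnd ℂ) (FT Ω (conjT φ) ξ) := by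
  rw [← inner_tL2_conjT, inner_FLadj, L2.inner_def]
  refine integral_congr_ae ?_
  filter_upwards [FL_tL2 hbd (conjT φ)] with ξ hξ
  rw [hξ, RCLike.inner_apply]

/-- The derivative is moved to the test function by Parseval. The sign `(-1)^|α|` of weak
derivatives is produced by conjugating a product of imaginary symbols. -/
theorem hasWeakDeriv_FLadj {α : Fin n → ℕ} {v w : L2x n}
    (hw : w =ᵐ[volume] fun ξ => mon α ξ * v ξ) : HasWeakDeriv Ω α (FLadj Ω v) (FLadj Ω w) := by
  refine ⟨locallyIntegrableOn_L2 hbd _, locallyIntegrableOn_L2 hbd _, fun φ => ?_⟩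
  rw [integral_FLadj_mul hbd, integral_FLadj_mul hbd, ← integral_const_mul]
  refine integral_congr_ae ?_
  filter_upwards [hw] with ξ hξ
  rw [hξ, ← mderiv_conjT, FT_mderiv, map_mul, conj_mon]
  linear_combination (-(v ξ) * (starRingEnd ℂ) (FT Ω (conjT φ) ξ)) *
    neg_one_pow_mul_self (mlen α) (mon α ξ)

omit hbd in
theorem mon_zero (ξ : Rn n) : mon 0 ξ = 1 := by simp [mon]

theorem hasWeakDeriv_Psi (h : SymBound k a c s₀) (hs : s₀ ≤ s) {α : Fin n → ℕ} (hα : mlen α ≤ k)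
    (v : L2x n) : HasWeakDeriv Ω α (Psi Ω k a s 0 v) (Psi Ω k a s α v) := by
  have h0 : mlen (0 : Fin n → ℕ) ≤ k := by simp [mlen]
  change HasWeakDeriv Ω α (FLadj Ω (mulOp volume (mSym k a s 0) v))
    (FLadj Ω (mulOp volume (mSym k a s α) v))
  refine hasWeakDeriv_FLadj hbd ?_
  filter_upwards [mulOp_coe (h.memLp_mSym hs h0) v, mulOp_coe (h.memLp_mSym hs hα) v] with ξ h1 h2
  rw [h1, h2, mSym, mSym, mon_zero]
  ring

omit hbd in
theorem finset_sum_Lp_coe {X κ : Type*} [MeasurableSpace X] {μ : Measure X} (t : Finset κ)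
    (f : κ → Lp ℂ 2 μ) : (∑ i ∈ t, f i : Lp ℂ 2 μ) =ᵐ[μ] fun x => ∑ i ∈ t, f i x := by
  classical
  induction t using Finset.induction_on with
  | empty =>
    simp only [Finset.sum_empty]
    exact Lp.coeFn_zero ℂ 2 μ
  | insert i t hi ih =>
    simp only [Finset.sum_insert hi]
    filter_upwards [Lp.coeFn_add (f i) (∑ i ∈ t, f i), ih] with x h1 h2
    rw [h1, Pi.add_apply, h2]

theorem integrable_L2_mul (f : L2 Ω) (φ : 𝓓(Ω, ℂ)) :
    IntegrableOn (fun x => f x * φ x) (Ω : Set (Rn n)) := by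
  have := (integrable_L2 hbd f).bdd_mul (c := ‖(φ : BoundedContinuousFunction (Rn n) ℂ)‖)
    (φ.aestronglyMeasurable (μ := volume.restrict (Ω : Set (Rn n))))
    (Filter.Eventually.of_forall fun x =>
      (φ : BoundedContinuousFunction (Rn n) ℂ).norm_coe_le_norm x)
  exact this.congr (Filter.Eventually.of_forall fun x => mul_comm _ _)

theorem distribEq_of_hasWeakDeriv {u : L2 Ω} {D : (Fin n → ℕ) → L2 Ω}
    (hD : ∀ α ∈ multiIndices n 0 k, HasWeakDeriv Ω α u (D α)) :
    DistribEq Ω k a u (∑ α ∈ multiIndices n 0 k, a α • D α) := by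
  intro φ
  have h1 : ∫ x in (Ω : Set (Rn n)), (∑ α ∈ multiIndices n 0 k, a α • D α : L2 Ω) x * φ x =
      ∫ x in (Ω : Set (Rn n)), ∑ α ∈ multiIndices n 0 k, a α * (D α x * φ x) := by
    refine integral_congr_ae ?_
    have h2 : ∀ᵐ x ∂volume.restrict (Ω : Set (Rn n)), ∀ α ∈ multiIndices n 0 k,
        (a α • D α : L2 Ω) x = a α * D α x := by
      rw [Filter.eventually_all_finset]
      intro α _
      filter_upwards [Lp.coeFn_smul (a α) (D α)] with x hx
      rw [hx, Pi.smul_apply, smul_eq_mul]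
    filter_upwards [finset_sum_Lp_coe (multiIndices n 0 k) fun α => a α • D α, h2] with x h1 h2
    rw [h1, Finset.sum_mul]
    exact Finset.sum_congr rfl fun α hα => by rw [h2 α hα, mul_assoc]
  have h3 : ∫ x in (Ω : Set (Rn n)), u x * constCoeffOp k (fun α => (-1) ^ mlen α * a α) φ x =
      ∫ x in (Ω : Set (Rn n)), ∑ α ∈ multiIndices n 0 k,
        ((-1) ^ mlen α * a α) * (u x * mderiv α φ x) := by
    refine integral_congr_ae (Filter.Eventually.of_forall fun x => ?_)
    simp only [constCoeffOp, sum_apply, smul_apply, smul_eq_mul, Finset.mul_sum]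
    exact Finset.sum_congr rfl fun α _ => by ring
  rw [h1, h3, integral_finsetSum _ fun α _ => (integrable_L2_mul hbd _ _).const_mul _,
    integral_finsetSum _ fun α _ => (integrable_L2_mul hbd _ _).const_mul _]
  refine Finset.sum_congr rfl fun α hα => ?_
  rw [integral_const_mul, integral_const_mul, (hD α hα).2.2 φ]
  ring

omit hbd in
-- This is `p / (p + s^k) = 1 - s^k / (p + s^k)` under the inverse Fourier transform.
theorem sum_smul_Psi (h : SymBound k a c s₀) (hs : s₀ ≤ s) (v : L2x n) :
    ∑ α ∈ multiIndices n 0 k, a α • Psi Ω k a s α v = FLadj Ω v - ((s : ℂ) ^ k) • Psi Ω k a s 0 v := by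
  have h0 : mlen (0 : Fin n → ℕ) ≤ k := by simp [mlen]
  simp only [Psi, ContinuousLinearMap.comp_apply, ← map_smul, ← map_sum, ← map_sub]
  congr 1
  apply Lp.ext
  have h2 : ∀ᵐ ξ : Rn n, ∀ α ∈ multiIndices n 0 k,
      (a α • mulOp volume (mSym k a s α) v : L2x n) ξ = a α * (mSym k a s α ξ * v ξ) := by
    rw [Filter.eventually_all_finset]
    intro α hα
    filter_upwards [Lp.coeFn_smul (a α) (mulOp volume (mSym k a s α) v),
      mulOp_coe (h.memLp_mSym hs (mem_multiIndices.1 hα).2) v] with x hx hx'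
    rw [hx, Pi.smul_apply, smul_eq_mul, hx']
  simp only [map_smul]
  filter_upwards [finset_sum_Lp_coe (multiIndices n 0 k) fun α =>
      (a α • mulOp volume (mSym k a s α) v : L2x n), h2,
    Lp.coeFn_sub v (((s : ℂ) ^ k) • mulOp volume (mSym k a s 0) v),
    Lp.coeFn_smul ((s : ℂ) ^ k) (mulOp volume (mSym k a s 0) v),
    mulOp_coe (h.memLp_mSym hs h0) v] with ξ h1 h2 h3 h4 h5
  rw [h1, Finset.sum_congr rfl h2, h3, Pi.sub_apply, h4, Pi.smul_apply, smul_eq_mul, h5]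
  have hden := h.den_ne_zero hs ξ
  simp only [mSym, mon_zero]
  have : ∑ α ∈ multiIndices n 0 k, a α * (mon α ξ / den k a s ξ * v ξ) =
      psym k a ξ / den k a s ξ * v ξ := by
    rw [psym, Finset.sum_div, Finset.sum_mul]
    exact Finset.sum_congr rfl fun α _ => by ring
  rw [this]
  field_simp
  rw [den]
  ring

theorem distribEq_Psi (h : SymBound k a c s₀) (hs : s₀ ≤ s) (v : L2x n) :
    DistribEq Ω k a (Psi Ω k a s 0 v) (FLadj Ω v - ((s : ℂ) ^ k) • Psi Ω k a s 0 v) := by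
  rw [← sum_smul_Psi h hs v]
  exact distribEq_of_hasWeakDeriv hbd fun α hα =>
    hasWeakDeriv_Psi hbd h hs (mem_multiIndices.1 hα).2 v

/-- `(P + s^k) φ` for a test function `φ`. -/
def shiftOp (k : ℕ) (a : (Fin n → ℕ) → ℂ) (s : ℝ) (φ : 𝓓(Ω, ℂ)) : 𝓓(Ω, ℂ) :=
  constCoeffOp k a φ + ((s : ℂ) ^ k) • φ

omit hbd in
theorem FT_shiftOp (φ : 𝓓(Ω, ℂ)) (ξ : Rn n) :
    FT Ω (shiftOp k a s φ) ξ = den k a s ξ * FT Ω φ ξ := by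
  have hint : ∀ ψ : 𝓓(Ω, ℂ), IntegrableOn (fun x => ψ x * wave ξ x) (Ω : Set (Rn n)) := by
    intro ψ
    have := integrable_testFunction (modulate ξ ψ) (volume.restrict (Ω : Set (Rn n)))
    exact this.congr (Filter.Eventually.of_forall fun x => mul_comm _ _)
  have h1 := FT_constCoeffOp k a φ ξ
  simp only [FT] at h1 ⊢
  simp only [shiftOp, add_apply, smul_apply, smul_eq_mul, add_mul, mul_assoc]
  rw [integral_add (hint _) ((hint _).const_mul _), h1, integral_const_mul, den, add_mul]

/-- For test functions supported in `Ω`, extension by zero commutes with `P`, so the inverse on the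
whole space recovers `φ` exactly. This is what links `G` with `H^k_0(Ω)`. -/
theorem Psi_FL_shiftOp (h : SymBound k a c s₀) (hs : s₀ ≤ s) {α : Fin n → ℕ} (hα : mlen α ≤ k)
    (φ : 𝓓(Ω, ℂ)) : Psi Ω k a s α (FL Ω (tL2 (shiftOp k a s φ))) = tL2 (mderiv α φ) := by
  rw [Psi_eq_of_ae h hs hα (w := FL Ω (tL2 (mderiv α φ))), FLadj_FL]
  filter_upwards [FL_tL2 hbd (mderiv α φ), FL_tL2 hbd (shiftOp k a s φ)] with ξ h1 h2
  rw [h1, h2, FT_mderiv, FT_shiftOp, mSym]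
  have := h.den_ne_zero hs ξ
  field_simp

end

end BornOp

end

/-! ### Compactness of the multipliers -/

noncomputable section

namespace BornOp

variable {n : ℕ} {Ω : Opens (Rn n)} {k : ℕ} {a : (Fin n → ℕ) → ℂ} {c s₀ s : ℝ}

theorem isCompactOperator_rankOne {E F : Type*} [NormedAddCommGroup E] [InnerProductSpace ℂ E]
    [NormedAddCommGroup F] [InnerProductSpace ℂ F] (x : E) (y : F) :
    IsCompactOperator (InnerProductSpace.rankOne ℂ x y) := by
  have h := (isCompactOperator_id (E := ℂ)).comp_clm (innerSL ℂ y)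
  exact h.clm_comp (ContinuousLinearMap.toSpanSingleton ℂ x)

theorem isCompactOperator_sum {E F κ : Type*} [NormedAddCommGroup E] [NormedSpace ℂ E]
    [NormedAddCommGroup F] [NormedSpace ℂ F] (t : Finset κ) {T : κ → E →L[ℂ] F}
    (hT : ∀ i ∈ t, IsCompactOperator (T i)) : IsCompactOperator (∑ i ∈ t, T i : E →L[ℂ] F) := by
  classical
  induction t using Finset.induction_on with
  | empty => simpa using isCompactOperator_zero
  | insert i t hi ih =>
    rw [Finset.sum_insert hi]
    exact (hT i (by simp)).add (ih fun j hj => hT j (by simp [hj]))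

theorem adjoint_mulOp {X : Type*} [MeasurableSpace X] {μ : Measure X} {m : X → ℂ}
    (h : MemLp m ∞ μ) :
    ContinuousLinearMap.adjoint (mulOp μ m) = mulOp μ fun x => (starRingEnd ℂ) (m x) := by
  symm
  rw [ContinuousLinearMap.eq_adjoint_iff]
  intro f g
  rw [L2.inner_def, L2.inner_def]
  refine integral_congr_ae ?_
  have hs : MemLp (fun x => (starRingEnd ℂ) (m x)) ∞ μ := h.star
  filter_upwards [mulOp_coe hs f, mulOp_coe h g] with x h1 h2
  rw [h1, h2, RCLike.inner_apply, RCLike.inner_apply, map_mul, Complex.conj_conj]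
  ring

theorem norm_wave_sub_le (ξ η x : Rn n) :
    ‖wave ξ x - wave η x‖ ≤ 2 * Real.pi * ‖x‖ * ‖ξ - η‖ := by
  have h : wave ξ x - wave η x = wave η x *
      (Complex.exp (((-(2 * Real.pi * inner ℝ x (ξ - η)) : ℝ) : ℂ) * Complex.I) - 1) := by
    rw [mul_sub, mul_one, wave, wave, ← Complex.exp_add, inner_sub_right (𝕜 := ℝ)]
    congr 2
    push_cast
    ring
  rw [h, norm_mul, norm_wave, one_mul, mul_comm _ Complex.I]
  refine (Real.norm_exp_I_mul_ofReal_sub_one_le).trans ?_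
  rw [norm_neg, norm_mul, Real.norm_of_nonneg (by positivity : (0 : ℝ) ≤ 2 * Real.pi)]
  rw [mul_assoc (2 * Real.pi) ‖x‖]
  refine mul_le_mul_of_nonneg_left (a := 2 * Real.pi) ?_ (by positivity)
  exact norm_inner_le_norm (𝕜 := ℝ) x (ξ - η)

theorem memLp_wave (hbd : Bornology.IsBounded (Ω : Set (Rn n))) (ξ : Rn n) :
    MemLp (fun x => (starRingEnd ℂ) (wave ξ x)) 2 (volume.restrict (Ω : Set (Rn n))) := by
  have := isFiniteMeasure_restrict hbd
  refine MemLp.of_bound (C := 1) ?_ (Filter.Eventually.of_forall fun x => ?_)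
  · exact (Complex.continuous_conj.comp (contDiff_wave ξ (m := 0)).continuous).aestronglyMeasurable
  · simp [norm_wave]

section

variable (hbd : Bornology.IsBounded (Ω : Set (Rn n)))

include hbd

theorem inner_wave (ξ : Rn n) (f : L2 Ω) :
    inner ℂ ((memLp_wave hbd ξ).toLp _ : L2 Ω) f = FT Ω f ξ := by
  rw [L2.inner_def]
  refine integral_congr_ae ?_
  filter_upwards [(memLp_wave hbd ξ).coeFn_toLp] with x hx
  rw [hx, RCLike.inner_apply]
  simp

theorem exists_norm_FT_sub_le : ∃ C : ℝ, 0 ≤ C ∧ ∀ (f : L2 Ω) (ξ η : Rn n),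
    ‖FT Ω f ξ - FT Ω f η‖ ≤ C * ‖f‖ * ‖ξ - η‖ := by
  have := isFiniteMeasure_restrict hbd
  obtain ⟨R, hR⟩ := hbd.exists_norm_le
  refine ⟨2 * Real.pi * |R| * (measureUnivNNReal (volume.restrict (Ω : Set (Rn n))) : ℝ) ^ (2 : ℝ)⁻¹,
    by positivity, fun f ξ η => ?_⟩
  rw [← inner_wave hbd, ← inner_wave hbd, ← inner_sub_left]
  refine (norm_inner_le_norm _ _).trans ?_
  have : ‖((memLp_wave hbd ξ).toLp _ : L2 Ω) - (memLp_wave hbd η).toLp _‖ ≤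
      (measureUnivNNReal (volume.restrict (Ω : Set (Rn n))) : ℝ) ^ (2 : ℝ)⁻¹ *
        (2 * Real.pi * |R| * ‖ξ - η‖) := by
    have := Lp.norm_le_of_ae_bound (p := 2) (μ := volume.restrict (Ω : Set (Rn n)))
      (f := ((memLp_wave hbd ξ).toLp _ : L2 Ω) - (memLp_wave hbd η).toLp _)
      (C := 2 * Real.pi * |R| * ‖ξ - η‖) (by positivity) ?_
    · simpa using! this
    · filter_upwards [Lp.coeFn_sub ((memLp_wave hbd ξ).toLp _ : L2 Ω) ((memLp_wave hbd η).toLp _),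
        (memLp_wave hbd ξ).coeFn_toLp, (memLp_wave hbd η).coeFn_toLp,
        ae_restrict_mem Ω.isOpen.measurableSet] with x h1 h2 h3 h4
      rw [h1, Pi.sub_apply, h2, h3, ← map_sub, RCLike.norm_conj]
      refine (norm_wave_sub_le ξ η x).trans ?_
      gcongr
      exact (hR x h4).trans (le_abs_self R)
  refine (mul_le_mul_of_nonneg_right this (norm_nonneg f)).trans (le_of_eq ?_)
  ring

/-- The Fourier transform of `f ∈ L²(Ω)` is Lipschitz in `ξ` with constant `O(‖f‖)`, because `Ω` is
bounded. Sampling it at the values of a simple function approximating the identity on the ball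
yields finite rank operators that converge in norm; the claim follows by passing to adjoints. -/
theorem isCompactOperator_FLadj_ball (R : ℝ) : IsCompactOperator
    (FLadj Ω ∘L mulOp volume ((Metric.ball (0 : Rn n) R).indicator fun _ => (1 : ℂ))) := by
  set B := Metric.ball (0 : Rn n) R with hB
  have hBm : MeasurableSet B := measurableSet_ball
  have hBfin : volume B < ∞ := measure_ball_lt_top
  have : IsFiniteMeasure (volume.restrict B) := ⟨by rwa [Measure.restrict_apply_univ]⟩
  have hind : MemLp (B.indicator fun _ => (1 : ℂ)) ∞ volume :=
    (memLp_top_const (1 : ℂ)).indicator hBm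
  obtain ⟨C, hC, hlip⟩ := exists_norm_FT_sub_le hbd
  have hid : MemLp (id : Rn n → Rn n) 2 (volume.restrict B) := by
    refine MemLp.of_bound (C := R) (by fun_prop) ?_
    filter_upwards [ae_restrict_mem hBm] with ξ hξ
    exact (mem_ball_zero_iff.1 hξ).le
  let σ : ℕ → SimpleFunc (Rn n) (Rn n) :=
    SimpleFunc.approxOn id measurable_id Set.univ 0 (Set.mem_univ _)
  have hσ : Filter.Tendsto (fun j => eLpNorm (⇑(σ j) - id) 2 (volume.restrict B))
      Filter.atTop (nhds 0) := by
    refine SimpleFunc.tendsto_approxOn_Lp_eLpNorm measurable_id (Set.mem_univ _) (by simp)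
      (by simp) ?_
    simpa using! hid.eLpNorm_lt_top
  have hmem : ∀ j, MemLp (⇑(σ j) - id) 2 (volume.restrict B) := by
    intro j
    exact ((σ j).memLp_of_isFiniteMeasure 2 _).sub hid
  let u : ℕ → Rn n → L2x n := fun j c =>
    indicatorConstLp 2 (hBm.inter ((σ j).measurableSet_fiber c))
      ((measure_mono Set.inter_subset_left).trans_lt hBfin).ne (1 : ℂ)
  -- `T j f` is `ξ ↦ FT f (σ j ξ)` on the ball: evaluation at each sample point is a bounded
  -- functional, namely the inner product with a plane wave.
  let T : ℕ → L2 Ω →L[ℂ] L2x n := fun j =>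
    ∑ c ∈ (σ j).range, InnerProductSpace.rankOne ℂ (u j c) ((memLp_wave hbd c).toLp _ : L2 Ω)
  have hT : ∀ j f, T j f =ᵐ[volume] B.indicator fun ξ => FT Ω f (σ j ξ) := by
    intro j f
    have h1 : T j f = ∑ c ∈ (σ j).range, FT Ω f c • u j c := by
      simp only [T, sum_apply, InnerProductSpace.rankOne_apply, inner_wave hbd]
    have h2 : ∀ᵐ ξ : Rn n, ∀ c ∈ (σ j).range, (FT Ω f c • u j c : L2x n) ξ =
        FT Ω f c * (B ∩ σ j ⁻¹' {c}).indicator (fun _ => 1) ξ := by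
      rw [Filter.eventually_all_finset]
      intro c _
      filter_upwards [Lp.coeFn_smul (FT Ω f c) (u j c), indicatorConstLp_coeFn (p := 2)
        (hs := hBm.inter ((σ j).measurableSet_fiber c))
        (hμs := ((measure_mono Set.inter_subset_left).trans_lt hBfin).ne) (c := (1 : ℂ))]
        with ξ h1 h2
      rw [h1, Pi.smul_apply, smul_eq_mul, h2]
    rw [h1]
    filter_upwards [finset_sum_Lp_coe (σ j).range fun c => (FT Ω f c • u j c : L2x n), h2]
      with ξ h3 h4
    rw [h3, Finset.sum_congr rfl h4]
    by_cases hξ : ξ ∈ B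
    · rw [Set.indicator_of_mem hξ, Finset.sum_eq_single (σ j ξ)]
      · simp [hξ]
      · intro c _ hc
        rw [Set.indicator_of_notMem, mul_zero]
        exact fun h => hc h.2.symm
      · exact fun h => absurd ((σ j).mem_range_self ξ) h
    · rw [Set.indicator_of_notMem hξ]
      refine Finset.sum_eq_zero fun c _ => ?_
      rw [Set.indicator_of_notMem (fun h => hξ h.1), mul_zero]
  set M : L2 Ω →L[ℂ] L2x n := mulOp volume (B.indicator fun _ => (1 : ℂ)) ∘L
    (FL Ω).toContinuousLinearMap with hM
  have hbound : ∀ j, ‖M - T j‖ ≤ C * (eLpNorm (⇑(σ j) - id) 2 (volume.restrict B)).toReal := by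
    intro j
    refine ContinuousLinearMap.opNorm_le_bound _ (by positivity) fun f => ?_
    have hg : MemLp (B.indicator (⇑(σ j) - id)) 2 volume :=
      (memLp_indicator_iff_restrict hBm).2 (hmem j)
    have h := Lp.norm_le_mul_norm_of_ae_le_mul (f := (M - T j) f) (g := hg.toLp _)
      (c := C * ‖f‖) ?_
    · rw [Lp.norm_toLp, eLpNorm_indicator_eq_eLpNorm_restrict hBm] at h
      linarith
    · filter_upwards [hg.coeFn_toLp, hT j f, FL_coe hbd f, mulOp_coe hind (FL Ω f),
        Lp.coeFn_sub (M f) (T j f)] with ξ h1 h2 h3 h4 h5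
      have h6 : (M - T j) f = M f - T j f := rfl
      have h7 : M f = mulOp volume (B.indicator fun _ => (1 : ℂ)) (FL Ω f) := rfl
      rw [h6, h5, Pi.sub_apply, h7, h4, h3, h2, h1]
      by_cases hξ : ξ ∈ B
      · simp only [Set.indicator_of_mem hξ, one_mul, Pi.sub_apply, id]
        rw [norm_sub_rev (σ j ξ)]
        exact hlip f ξ (σ j ξ)
      · simp [Set.indicator_of_notMem hξ]
  have hMT : ContinuousLinearMap.adjoint M =
      FLadj Ω ∘L mulOp volume (B.indicator fun _ => (1 : ℂ)) := by
    have e1 : (fun ξ => (starRingEnd ℂ) (B.indicator (fun _ => (1 : ℂ)) ξ)) =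
        B.indicator fun _ => (1 : ℂ) := by
      ext ξ
      by_cases hξ : ξ ∈ B <;> simp [hξ]
    rw [hM, ContinuousLinearMap.adjoint_comp, adjoint_mulOp hind, e1]
    rfl
  rw [← hMT]
  refine isCompactOperator_of_tendsto (l := Filter.atTop)
    (F := fun j => ContinuousLinearMap.adjoint (T j)) ?_ (Filter.Eventually.of_forall fun j => ?_)
  · refine (ContinuousLinearMap.adjoint.continuous.tendsto M).comp ?_
    rw [tendsto_iff_norm_sub_tendsto_zero]
    refine squeeze_zero (fun _ => norm_nonneg _)
      (fun j => (norm_sub_rev _ _).trans_le (hbound j)) ?_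
    have := (ENNReal.tendsto_toReal ENNReal.zero_ne_top).comp hσ
    simpa using! this.const_mul C
  · simp only [T, map_sum, InnerProductSpace.adjoint_rankOne]
    exact isCompactOperator_sum _ fun c _ => isCompactOperator_rankOne _ _

/-- The symbol is `O((‖ξ‖ + s)⁻¹)` when `|α| < k`, so cutting frequencies off at radius `j` changes
the operator by `O(1 / (j + 1))` in norm, and the truncated operators are compact. -/
theorem isCompactOperator_Psi (h : SymBound k a c s₀) (hs : s₀ ≤ s) {α : Fin n → ℕ}
    (hα : mlen α < k) : IsCompactOperator (Psi Ω k a s α) := by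
  set A : ℝ := (2 * Real.pi) ^ k / c
  have hA : 0 ≤ A := by have := h.hc; positivity
  have hs1 := h.one_le hs
  let F : ℕ → L2x n →L[ℂ] L2 Ω := fun j =>
    (FLadj Ω ∘L mulOp volume ((Metric.ball (0 : Rn n) j).indicator fun _ => (1 : ℂ))) ∘L
      mulOp volume (mSym k a s α)
  have hF : ∀ j : ℕ, ‖F j - Psi Ω k a s α‖ ≤ A / (j + 1) := by
    intro j
    have hind : MemLp ((Metric.ball (0 : Rn n) j).indicator fun _ => (1 : ℂ)) ∞ volume :=
      (memLp_top_const (1 : ℂ)).indicator measurableSet_ball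
    refine ContinuousLinearMap.opNorm_le_bound _ (by positivity) fun v => ?_
    have e : (F j - Psi Ω k a s α) v = FLadj Ω (mulOp volume ((Metric.ball (0 : Rn n) j).indicator
        fun _ => (1 : ℂ)) (mulOp volume (mSym k a s α) v) - mulOp volume (mSym k a s α) v) := by
      rw [map_sub]; rfl
    rw [e]
    refine ((FLadj Ω).le_of_opNorm_le norm_FLadj_le _).trans ?_
    rw [one_mul]
    refine Lp.norm_le_mul_norm_of_ae_le_mul ?_
    filter_upwards [mulOp_coe hind (mulOp volume (mSym k a s α) v),
      mulOp_coe (h.memLp_mSym hs hα.le) v, Lp.coeFn_sub (mulOp volume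
        ((Metric.ball (0 : Rn n) j).indicator fun _ => (1 : ℂ)) (mulOp volume (mSym k a s α) v))
        (mulOp volume (mSym k a s α) v)] with ξ h1 h2 h3
    rw [h3, Pi.sub_apply, h1, h2]
    by_cases hξ : ξ ∈ Metric.ball (0 : Rn n) j
    · simp only [Set.indicator_of_mem hξ, one_mul, sub_self, norm_zero]
      positivity
    · simp only [Set.indicator_of_notMem hξ, zero_mul, zero_sub, norm_neg, norm_mul]
      gcongr
      rw [mem_ball_zero_iff, not_lt] at hξ
      rw [le_div_iff₀ (by positivity)]
      refine le_trans ?_ (h.norm_mSym_le hs hα.le ξ)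
      gcongr
      -- Outside the ball `‖ξ‖ ≥ j`, and `s ≥ 1` supplies the additional one; the exponent `k - |α|`
      -- is at least one.
      refine le_trans (by linarith : (j : ℝ) + 1 ≤ ‖ξ‖ + s) (le_self_pow₀ ?_ (by omega))
      linarith [norm_nonneg ξ]
  refine isCompactOperator_of_tendsto (l := Filter.atTop) (F := F) ?_
    (Filter.Eventually.of_forall fun j => (isCompactOperator_FLadj_ball hbd j).comp_clm _)
  rw [tendsto_iff_norm_sub_tendsto_zero]
  refine squeeze_zero (fun _ => norm_nonneg _) hF ?_
  have := (tendsto_one_div_add_atTop_nhds_zero_nat (𝕜 := ℝ)).const_mul A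
  simpa [div_eq_mul_inv] using this

end

end BornOp

end

/-! ### Interior estimates uniform in `s` -/

noncomputable section

namespace BornOp

variable {n : ℕ} {Ω : Opens (Rn n)} {k : ℕ} {a : (Fin n → ℕ) → ℂ} {c s₀ s : ℝ}

/-- Multiplication by a bounded function on `L²(Ω)`. -/
def cutOp (Ω : Opens (Rn n)) (χ : Rn n → ℂ) : L2 Ω →L[ℂ] L2 Ω :=
  mulOp (volume.restrict (Ω : Set (Rn n))) χ

theorem cutOp_coe (χ : 𝓓(Ω, ℂ)) (f : L2 Ω) :
    cutOp Ω χ f =ᵐ[volume.restrict (Ω : Set (Rn n))] fun x => χ x * f x :=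
  mulOp_coe (memLp_top_testFunction χ _) f

/-- Serves for the unbounded multiplier `p + s^k`, which does not act on all of `L²` but does act on
the range of suitable operators `A`. -/
theorem exists_clm_of_eLpNorm_le {X E : Type*} [MeasurableSpace X] {μ : Measure X}
    [NormedAddCommGroup E] [NormedSpace ℂ E] (A : E →L[ℂ] Lp ℂ 2 μ) {m : X → ℂ}
    (hm : AEStronglyMeasurable m μ) {C : ℝ} (hC : 0 ≤ C)
    (h : ∀ f, eLpNorm (fun x => m x * A f x) 2 μ ≤ ENNReal.ofReal (C * ‖f‖)) :
    ∃ Q : E →L[ℂ] Lp ℂ 2 μ, (∀ f, Q f =ᵐ[μ] fun x => m x * A f x) ∧ ‖Q‖ ≤ C := by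
  have hmem : ∀ f, MemLp (fun x => m x * A f x) 2 μ := fun f =>
    ⟨hm.mul (Lp.aestronglyMeasurable _), (h f).trans_lt ENNReal.ofReal_lt_top⟩
  let L : E →ₗ[ℂ] Lp ℂ 2 μ :=
    { toFun := fun f => (hmem f).toLp _
      map_add' := fun f g => by
        apply Lp.ext
        filter_upwards [(hmem (f + g)).coeFn_toLp, (hmem f).coeFn_toLp, (hmem g).coeFn_toLp,
          Lp.coeFn_add ((hmem f).toLp _) ((hmem g).toLp _), Lp.coeFn_add (A f) (A g)]
          with x h1 h2 h3 h4 h5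
        rw [h1, h4, Pi.add_apply, h2, h3, map_add, h5, Pi.add_apply, mul_add]
      map_smul' := fun z f => by
        apply Lp.ext
        filter_upwards [(hmem (z • f)).coeFn_toLp, (hmem f).coeFn_toLp,
          Lp.coeFn_smul z ((hmem f).toLp _), Lp.coeFn_smul z (A f)] with x h1 h2 h4 h5
        rw [h1, RingHom.id_apply, h4, Pi.smul_apply, h2, map_smul, h5, Pi.smul_apply, smul_eq_mul,
          smul_eq_mul]
        ring }
  have hL : ∀ f, ‖L f‖ ≤ C * ‖f‖ := fun f => by
    change ‖(hmem f).toLp _‖ ≤ _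
    rw [Lp.norm_toLp]
    exact ENNReal.toReal_le_of_le_ofReal (by positivity) (h f)
  exact ⟨L.mkContinuous C hL, fun f => (hmem f).coeFn_toLp, L.mkContinuous_norm_le hC hL⟩

section

variable (hbd : Bornology.IsBounded (Ω : Set (Rn n)))

include hbd

omit hbd in
theorem distribEq_add {u v f g : L2 Ω} (hu : DistribEq Ω k a u f) (hv : DistribEq Ω k a v g) :
    DistribEq Ω k a (u + v) (f + g) := by
  have key : ∀ (f g : L2 Ω) (φ : 𝓓(Ω, ℂ)), ∫ x in (Ω : Set (Rn n)), (f + g : L2 Ω) x * φ x =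
      (∫ x in (Ω : Set (Rn n)), f x * φ x) + ∫ x in (Ω : Set (Rn n)), g x * φ x := by
    intro f g φ
    rw [← inner_tL2_conjT, ← inner_tL2_conjT, ← inner_tL2_conjT, inner_add_right]
  intro φ
  rw [key, key, hu φ, hv φ]

omit hbd in
theorem distribEq_smul {u f : L2 Ω} (z : ℂ) (hu : DistribEq Ω k a u f) :
    DistribEq Ω k a (z • u) (z • f) := by
  have key : ∀ (f : L2 Ω) (φ : 𝓓(Ω, ℂ)), ∫ x in (Ω : Set (Rn n)), (z • f : L2 Ω) x * φ x =
      z * ∫ x in (Ω : Set (Rn n)), f x * φ x := by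
    intro f φ
    rw [← inner_tL2_conjT, ← inner_tL2_conjT, inner_smul_right]
  intro φ
  rw [key, key, hu φ]

theorem integrableOn_mul_L2 (f : L2 Ω) (φ : 𝓓(Ω, ℂ)) :
    IntegrableOn (fun x => φ x * f x) (Ω : Set (Rn n)) :=
  (integrable_L2_mul hbd f φ).congr (Filter.Eventually.of_forall fun _ => mul_comm _ _)

/-- Testing the equation for `w` with `wave ξ · χ` gives the Fourier transform of `(P + s^k)(χ w) =
χ g + [P, χ] w`. The commutator appears as a sum of coefficients of order `k - 1` times transforms
of other cut-offs of `w`; neither depends on `s`. -/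
theorem exists_FT_cutoff_identity (k : ℕ) (a : (Fin n → ℕ) → ℂ) (χ : 𝓓(Ω, ℂ)) :
    ∃ (ι : Type) (_ : Fintype ι) (C : ι → ℝ) (q : ι → Rn n → ℂ) (c : ι → 𝓓(Ω, ℂ)),
      (∀ l ξ, ‖q l ξ‖ * (1 + ‖ξ‖) ≤ C l * (1 + ‖ξ‖) ^ k) ∧
      ∀ (s : ℝ) (w g : L2 Ω), DistribEq Ω k a w (g - ((s : ℂ) ^ k) • w) → ∀ ξ,
        den k a s ξ * FT Ω (fun x => χ x * w x) ξ =
          FT Ω (fun x => χ x * g x) ξ - ∑ l, q l ξ * FT Ω (fun x => c l x * w x) ξ := by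
  obtain ⟨X, ⟨ι, _, q, c, hq, hX⟩, hP⟩ := adjoint_modulate k a χ
  choose C hC using hq
  refine ⟨ι, inferInstance, C, q, c, hC, fun s w g hw ξ => ?_⟩
  have h1 := hw (modulate ξ χ)
  have e1 : ∫ x in (Ω : Set (Rn n)), (g - ((s : ℂ) ^ k) • w : L2 Ω) x * modulate ξ χ x =
      FT Ω (fun x => χ x * g x) ξ - (s : ℂ) ^ k * FT Ω (fun x => χ x * w x) ξ := by
    rw [← inner_tL2_conjT, inner_sub_right, inner_smul_right, inner_tL2_conjT, inner_tL2_conjT,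
      setIntegral_eq_wave_mul, setIntegral_eq_wave_mul]
  have e2 : ∫ x in (Ω : Set (Rn n)), w x * constCoeffOp k (fun α => (-1) ^ mlen α * a α)
      (modulate ξ χ) x = psym k a ξ * FT Ω (fun x => χ x * w x) ξ +
        ∑ l, q l ξ * FT Ω (fun x => c l x * w x) ξ := by
    have e3 : ∀ x, w x * constCoeffOp k (fun α => (-1) ^ mlen α * a α) (modulate ξ χ) x =
        psym k a ξ * (w x * modulate ξ χ x) + ∑ l, q l ξ * (w x * modulate ξ (c l) x) := by
      intro x
      rw [hP, hX]
      simp only [modulate_apply, add_apply, smul_apply, sum_apply, smul_eq_mul, mul_add,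
        Finset.mul_sum]
      congr 1
      · ring
      · exact Finset.sum_congr rfl fun l _ => by ring
    simp only [e3]
    rw [integral_add ((integrable_L2_mul hbd _ _).const_mul _)
      (integrable_finsetSum _ fun l _ => (integrable_L2_mul hbd _ _).const_mul _),
      integral_finsetSum _ fun l _ => (integrable_L2_mul hbd _ _).const_mul _]
    simp only [integral_const_mul, setIntegral_eq_wave_mul]
  rw [e1, e2] at h1
  rw [den]
  linear_combination -h1

theorem eLpNorm_FT_cutoff (χ : 𝓓(Ω, ℂ)) (w : L2 Ω) :
    eLpNorm (fun ξ => ‖FT Ω (fun x => χ x * w x) ξ‖) 2 volume ≤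
      ENNReal.ofReal (‖cutOp Ω χ‖ * ‖w‖) := by
  rw [eLpNorm_norm, ← FT_congr (cutOp_coe χ w), ← eLpNorm_congr_ae (FL_coe hbd (cutOp Ω χ w)),
    ← ENNReal.ofReal_toReal (Lp.eLpNorm_ne_top (FL Ω (cutOp Ω χ w))), ← Lp.norm_def,
    LinearIsometry.norm_map]
  exact ENNReal.ofReal_le_ofReal ((cutOp Ω χ).le_opNorm w)

/-- Induction on the weight. Dividing the cut-off identity by `p + s^k` gains `k` powers of `‖ξ‖ +
s`, and the commutator costs `k - 1`, so each step gains one. The cut-off is quantified inside the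
induction because the commutator brings in new cut-offs. -/
theorem interior_estimate (h : SymBound k a c s₀) (j : ℕ) (hj : j ≤ k) :
    ∀ χ : 𝓓(Ω, ℂ), ∃ C : ℝ, 0 ≤ C ∧ ∀ s, s₀ ≤ s → ∀ w g : L2 Ω,
      DistribEq Ω k a w (g - ((s : ℂ) ^ k) • w) →
      eLpNorm (fun ξ => (‖ξ‖ + s) ^ j * ‖FT Ω (fun x => χ x * w x) ξ‖) 2 volume ≤
        ENNReal.ofReal (C * (‖w‖ + ‖g‖)) := by
  have hc := h.hc
  induction j with
  | zero =>
    intro χ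
    refine ⟨‖cutOp Ω χ‖, norm_nonneg _, fun s hs w g _ => ?_⟩
    simp only [pow_zero, one_mul]
    refine (eLpNorm_FT_cutoff hbd χ w).trans (ENNReal.ofReal_le_ofReal ?_)
    gcongr
    linarith [norm_nonneg g]
  | succ j ih =>
    intro χ
    obtain ⟨ι, _, Cq, q, d, hq, hid⟩ := exists_FT_cutoff_identity hbd k a χ
    choose K hK hKle using fun l => ih (by omega) (d l)
    refine ⟨c⁻¹ * (‖cutOp Ω χ‖ + ∑ l, |Cq l| * K l), by
      have : ∀ l, 0 ≤ |Cq l| * K l := fun l => mul_nonneg (abs_nonneg _) (hK l)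
      have := Finset.sum_nonneg fun l (_ : l ∈ Finset.univ) => this l
      positivity, fun s hs w g hw => ?_⟩
    have hcont : ∀ (f : L2 Ω) (φ : 𝓓(Ω, ℂ)), Continuous (FT Ω fun x => φ x * f x) := fun f φ =>
      continuous_FT (integrableOn_mul_L2 hbd f φ)
    have hpt : ∀ ξ, ‖(‖ξ‖ + s) ^ (j + 1) * ‖FT Ω (fun x => χ x * w x) ξ‖‖ ≤
        c⁻¹ * (‖FT Ω (fun x => χ x * g x) ξ‖ +
          ∑ l, |Cq l| * ((‖ξ‖ + s) ^ j * ‖FT Ω (fun x => d l x * w x) ξ‖)) := by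
      intro ξ
      have hD := h.add_pos hs ξ
      have hD1 : 1 ≤ ‖ξ‖ + s := by linarith [norm_nonneg ξ, h.one_le hs]
      set D := ‖ξ‖ + s
      rw [Real.norm_of_nonneg (by positivity), ← div_eq_inv_mul, le_div_iff₀ hc]
      have h1 : c * D ^ k * ‖FT Ω (fun x => χ x * w x) ξ‖ ≤ ‖FT Ω (fun x => χ x * g x) ξ‖ +
          ∑ l, ‖q l ξ‖ * ‖FT Ω (fun x => d l x * w x) ξ‖ := by
        refine (mul_le_mul_of_nonneg_right (h.norm_den_ge hs ξ) (norm_nonneg _)).trans ?_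
        rw [← norm_mul, hid s w g hw ξ]
        refine (norm_sub_le _ _).trans (add_le_add le_rfl ((norm_sum_le _ _).trans ?_))
        simp
      -- Here `s ≥ 1` is essential: it gives `1 + ‖ξ‖ ≤ D`, and so a constant independent of `s`.
      have h2 : ∀ l, ‖q l ξ‖ * D ≤ |Cq l| * D ^ k := by
        intro l
        obtain ⟨i, rfl⟩ : ∃ i, k = i + 1 := ⟨k - 1, by omega⟩
        have h3 := hq l ξ
        rw [pow_succ, ← mul_assoc] at h3
        have h4 := le_of_mul_le_mul_right h3 (by positivity)
        calc ‖q l ξ‖ * D ≤ (Cq l * (1 + ‖ξ‖) ^ i) * D := by gcongr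
          _ ≤ (|Cq l| * D ^ i) * D := by
            gcongr
            · exact le_abs_self _
            · linarith [h.one_le hs]
          _ = _ := by ring
      have h5 : D ^ (j + 1) * ∑ l, ‖q l ξ‖ * ‖FT Ω (fun x => d l x * w x) ξ‖ ≤
          D ^ k * ∑ l, |Cq l| * (D ^ j * ‖FT Ω (fun x => d l x * w x) ξ‖) := by
        rw [Finset.mul_sum, Finset.mul_sum]
        refine Finset.sum_le_sum fun l _ => ?_
        calc _ = (‖q l ξ‖ * D) * (D ^ j * ‖FT Ω (fun x => d l x * w x) ξ‖) := by ring
          _ ≤ (|Cq l| * D ^ k) * (D ^ j * ‖FT Ω (fun x => d l x * w x) ξ‖) := by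
            exact mul_le_mul_of_nonneg_right (h2 l) (by positivity)
          _ = _ := by ring
      have h6 : D ^ (j + 1) * ‖FT Ω (fun x => χ x * g x) ξ‖ ≤
          D ^ k * ‖FT Ω (fun x => χ x * g x) ξ‖ := by gcongr
      have h7 := mul_le_mul_of_nonneg_left h1 (by positivity : 0 ≤ D ^ (j + 1))
      refine le_of_mul_le_mul_left ?_ (by positivity : 0 < D ^ k)
      calc _ = D ^ (j + 1) * (c * D ^ k * ‖FT Ω (fun x => χ x * w x) ξ‖) := by ring
        _ ≤ _ := h7
        _ ≤ _ := by rw [mul_add, mul_add]; exact add_le_add h6 h5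
    refine (eLpNorm_mono_real hpt).trans ?_
    have hm1 : AEStronglyMeasurable (fun ξ => ‖FT Ω (fun x => χ x * g x) ξ‖) volume :=
      (hcont g χ).norm.aestronglyMeasurable
    have hm2 : ∀ l, AEStronglyMeasurable
        (fun ξ => |Cq l| * ((‖ξ‖ + s) ^ j * ‖FT Ω (fun x => d l x * w x) ξ‖)) volume := fun l =>
      (continuous_const.mul (((continuous_norm.add continuous_const).pow j).mul
        (hcont w (d l)).norm)).aestronglyMeasurable
    have e1 : (fun ξ => c⁻¹ * (‖FT Ω (fun x => χ x * g x) ξ‖ +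
        ∑ l, |Cq l| * ((‖ξ‖ + s) ^ j * ‖FT Ω (fun x => d l x * w x) ξ‖))) =
        c⁻¹ • ((fun ξ => ‖FT Ω (fun x => χ x * g x) ξ‖) +
          ∑ l, fun ξ => |Cq l| * ((‖ξ‖ + s) ^ j * ‖FT Ω (fun x => d l x * w x) ξ‖)) := by
      ext ξ
      simp
    rw [e1, eLpNorm_const_smul, mul_assoc c⁻¹, ENNReal.ofReal_mul (by positivity),
      Real.enorm_of_nonneg (by positivity)]
    gcongr
    refine (eLpNorm_add_le hm1 (Finset.aestronglyMeasurable_sum _ fun l _ => hm2 l)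
      one_le_two).trans ?_
    have hKn : ∀ l, 0 ≤ |Cq l| * K l := fun l => mul_nonneg (abs_nonneg _) (hK l)
    have hsum := Finset.sum_nonneg fun l (_ : l ∈ Finset.univ) => hKn l
    rw [add_mul, ENNReal.ofReal_add (by positivity) (by positivity)]
    gcongr
    · refine (eLpNorm_FT_cutoff hbd χ g).trans (ENNReal.ofReal_le_ofReal ?_)
      gcongr
      linarith [norm_nonneg w]
    · refine (eLpNorm_sum_le (fun l _ => hm2 l) one_le_two).trans ?_
      rw [Finset.sum_mul, ENNReal.ofReal_sum_of_nonneg fun l _ => by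
        have := hKn l
        positivity]
      refine Finset.sum_le_sum fun l _ => ?_
      have e2 : (fun ξ => |Cq l| * ((‖ξ‖ + s) ^ j * ‖FT Ω (fun x => d l x * w x) ξ‖)) =
          |Cq l| • fun ξ => ((‖ξ‖ + s) ^ j * ‖FT Ω (fun x => d l x * w x) ξ‖) := by
        ext ξ
        simp
      rw [e2, eLpNorm_const_smul, mul_assoc, ENNReal.ofReal_mul (by positivity),
        Real.enorm_of_nonneg (by positivity)]
      gcongr
      exact hKle l s hs w g hw

/-- Interior regularity: cut-offs of solutions of `(P + s^k) (A f) = B f` factor through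
`(P + s^k)⁻¹` with a uniform bound. -/
theorem exists_cutoff_factor (h : SymBound k a c s₀) (χ : 𝓓(Ω, ℂ)) :
    ∃ C : ℝ, 0 ≤ C ∧ ∀ s, s₀ ≤ s → ∀ {E : Type} [NormedAddCommGroup E] [NormedSpace ℂ E]
      (A B : E →L[ℂ] L2 Ω), (∀ f, DistribEq Ω k a (A f) (B f - ((s : ℂ) ^ k) • A f)) →
      ∃ Q : E →L[ℂ] L2x n, ‖Q‖ ≤ C * (‖A‖ + ‖B‖) ∧ ∀ f, cutOp Ω χ (A f) = Psi Ω k a s 0 (Q f) := by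
  obtain ⟨K, hK, hest⟩ := interior_estimate hbd h k le_rfl χ
  obtain ⟨M, hM, hden⟩ := exists_norm_psym_add_le k a
  refine ⟨M * K, by positivity, fun s hs E _ _ A B hAB => ?_⟩
  have h0 : mlen (0 : Fin n → ℕ) ≤ k := by simp [mlen]
  -- `Q f` is the Fourier transform of `(P + s^k)(χ A f)`, bounded by the interior estimate with the
  -- full weight `j = k`.
  obtain ⟨Q, hQ, hQn⟩ := exists_clm_of_eLpNorm_le
    ((FL Ω).toContinuousLinearMap ∘L cutOp Ω χ ∘L A) (m := den k a s)
    continuous_den.aestronglyMeasurable (C := M * K * (‖A‖ + ‖B‖)) (by positivity) fun f => by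
      have h1 : ∀ᵐ ξ : Rn n, ‖den k a s ξ * FL Ω (cutOp Ω χ (A f)) ξ‖ ≤
          M * ‖(‖ξ‖ + s) ^ k * ‖FT Ω (fun x => χ x * A f x) ξ‖‖ := by
        filter_upwards [FL_coe hbd (cutOp Ω χ (A f))] with ξ hξ
        have hD := h.add_pos hs ξ
        rw [hξ, FT_congr (cutOp_coe χ (A f)), norm_mul, norm_mul, norm_norm,
          Real.norm_of_nonneg (by positivity), ← mul_assoc]
        gcongr
        exact hden s (h.one_le hs) ξ
      refine (eLpNorm_le_mul_eLpNorm_of_ae_le_mul h1 2).trans ?_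
      rw [mul_assoc, mul_assoc, ENNReal.ofReal_mul hM]
      gcongr
      refine (hest s hs (A f) (B f) (hAB f)).trans (ENNReal.ofReal_le_ofReal ?_)
      gcongr
      rw [add_mul]
      exact add_le_add (A.le_opNorm f) (B.le_opNorm f)
  refine ⟨Q, hQn, fun f => ?_⟩
  rw [Psi_eq_of_ae h hs h0 (w := FL Ω (cutOp Ω χ (A f))), FLadj_FL]
  filter_upwards [hQ f] with ξ hξ
  rw [hξ, mSym, mon_zero]
  have := h.den_ne_zero hs ξ
  change _ = 1 / den k a s ξ * (den k a s ξ * FL Ω (cutOp Ω χ (A f)) ξ)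
  field_simp

end

end BornOp

end

/-! ### Inversion of the block operator -/

noncomputable section

namespace BornOp

section Hilbert

variable {H : Type*} [NormedAddCommGroup H] [InnerProductSpace ℂ H] [CompleteSpace H]

theorem exists_inverse_of_coercive (T : H →L[ℂ] H) {κ : ℝ} (hκ : 0 < κ)
    (hT : ∀ z, κ * ‖z‖ ^ 2 ≤ (inner ℂ z (T z)).re) :
    ∃ R : H →L[ℂ] H, T ∘L R = ContinuousLinearMap.id ℂ H ∧ R ∘L T = ContinuousLinearMap.id ℂ H := by
  have hu : IsUnit T := by
    refine ContinuousLinearMap.isUnit_of_forall_le_norm_inner_map T (c := ⟨κ, hκ.le⟩) hκ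
      fun z => ?_
    rw [norm_inner_symm, mul_comm]
    exact (hT z).trans (Complex.re_le_norm _)
  obtain ⟨⟨T', R, h1, h2⟩, rfl⟩ := hu
  exact ⟨R, h1, h2⟩

/-- The operator `(1 - Π) + V Π + E`, with `Π` the projection on a closed subspace on which `V` is
coercive and `E` small, is invertible. -/
theorem exists_inverse_block (M d : ℝ) (hd : 0 < d) (c : ℂ) (hc : c ≠ 0) :
    ∃ η : ℝ, 0 < η ∧ ∃ C : ℝ, 0 ≤ C ∧ ∀ (K : Submodule ℂ H) [K.HasOrthogonalProjection]
      (V E : H →L[ℂ] H), ‖V‖ ≤ M → (∀ h ∈ K, d * ‖h‖ ^ 2 ≤ (inner ℂ h (c • V h)).re) → ‖E‖ ≤ η →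
      ∃ R : H →L[ℂ] H, ‖R‖ ≤ C ∧
        (∀ f, R f - K.starProjection (R f) + V (K.starProjection (R f)) + E (R f) = f) ∧
        ∀ z, R (z - K.starProjection z + V (K.starProjection z) + E z) = z := by
  -- Along `Kᗮ ⊕ K` the operator is triangular up to `E`, with off-diagonal entry of norm at most
  -- `M`. Weighting the `K` component by `t c` lets the coercivity of `c V` dominate this entry:
  -- with `t d = (M² + 1) / 2`, one has `‖y‖² - M ‖y‖ ‖w‖ + t d ‖w‖² ≥ (‖y‖² + ‖w‖²) / 2`.
  set t : ℝ := (M ^ 2 + 1) / (2 * d) with ht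
  have ht0 : 0 < t := by positivity
  set B : ℝ := 1 + t * ‖c‖ with hB
  have hB0 : 0 < B := by positivity
  -- `B` bounds the norm of the weight `J`. Thus `J E` costs at most `1/4` of the coercivity
  -- constant `1/2`, and the remaining `1/4` yields the bound `4 B` for the inverse.
  refine ⟨1 / (4 * B), by positivity, 4 * B, by positivity, fun K _ V E hV hK hE => ?_⟩
  set p : H →L[ℂ] H := K.starProjection with hp
  set J : H →L[ℂ] H := (ContinuousLinearMap.id ℂ H - p) + ((t : ℂ) * c) • p with hJ
  set S : H →L[ℂ] H := (ContinuousLinearMap.id ℂ H - p) + V ∘L p + E with hS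
  have hpp : ∀ z, p (p z) = p z := fun z => by
    rw [hp]; exact K.starProjection_eq_self_iff.2 (K.starProjection_apply_mem z)
  have hJz : ∀ z, J z = (z - p z) + ((t : ℂ) * c) • p z := fun z => rfl
  have hSz : ∀ z, S z = (z - p z) + V (p z) + E z := fun z => rfl
  have hpm : ∀ z, p z ∈ K := fun z => K.starProjection_apply_mem z
  have hpo : ∀ z, z - p z ∈ Kᗮ := fun z => K.sub_starProjection_mem_orthogonal z
  have ho1 : ∀ x y, inner ℂ (p x) (y - p y) = 0 := fun x y =>
    Submodule.inner_right_of_mem_orthogonal (hpm x) (hpo y)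
  have ho2 : ∀ x y, inner ℂ (x - p x) (p y) = 0 := fun x y =>
    Submodule.inner_left_of_mem_orthogonal (hpm y) (hpo x)
  have hpyth : ∀ z, ‖z‖ ^ 2 = ‖z - p z‖ ^ 2 + ‖p z‖ ^ 2 := by
    intro z
    have := norm_add_sq_eq_norm_sq_add_norm_sq_of_inner_eq_zero (𝕜 := ℂ) (z - p z) (p z) (ho2 z z)
    rw [sub_add_cancel] at this
    simpa only [sq] using this
  have hn1 : ∀ z, ‖p z‖ ≤ ‖z‖ := fun z =>
    abs_le_of_sq_le_sq' (by nlinarith [hpyth z, sq_nonneg ‖z - p z‖]) (norm_nonneg z) |>.2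
  have hn2 : ∀ z, ‖z - p z‖ ≤ ‖z‖ := fun z =>
    abs_le_of_sq_le_sq' (by nlinarith [hpyth z, sq_nonneg ‖p z‖]) (norm_nonneg z) |>.2
  have hJn : ∀ z, ‖J z‖ ≤ B * ‖z‖ := by
    intro z
    rw [hJz]
    refine (norm_add_le _ _).trans ?_
    rw [norm_smul, norm_mul, Complex.norm_real, Real.norm_of_nonneg ht0.le, hB, add_mul, one_mul]
    gcongr
    · exact hn2 z
    · exact hn1 z
  have hJinj : ∀ z, J z = 0 → z = 0 := by
    intro z hz
    have h1 : inner ℂ (p z) (J z) = ((t : ℂ) * c) * inner ℂ (p z) (p z) := by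
      rw [hJz, inner_add_right, ho1, inner_smul_right, zero_add]
    have h2 : inner ℂ (z - p z) (J z) = inner ℂ (z - p z) (z - p z) := by
      rw [hJz, inner_add_right, inner_smul_right, ho2, mul_zero, add_zero]
    rw [hz, inner_zero_right] at h1 h2
    have h3 : p z = 0 := by
      have := (mul_eq_zero.1 h1.symm).resolve_left
        (mul_ne_zero (Complex.ofReal_ne_zero.2 ht0.ne') hc)
      exact inner_self_eq_zero.1 this
    have h4 := inner_self_eq_zero.1 h2.symm
    rwa [h3, sub_zero] at h4
  have hcoer : ∀ z, (1 / 4) * ‖z‖ ^ 2 ≤ (inner ℂ z ((J ∘L S) z)).re := by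
    intro z
    set y := z - p z with hy
    set w := p z with hw
    have hz : z = y + w := by rw [hy, sub_add_cancel]
    have hJy : J y = y := by
      rw [hJz, hy, map_sub, hpp, sub_self, smul_zero, sub_zero, add_zero]
    have e1 : (J ∘L S) z = y + J (V w) + J (E z) := by
      rw [ContinuousLinearMap.comp_apply, hSz, map_add, map_add, hJy]
    -- The factor `t c` multiplies only the `K` component of `V w`, hence pairs only with `w`.
    have e2 : inner ℂ z (J (V w)) = inner ℂ y (V w) + t * inner ℂ w (c • V w) := by
      have hyo : ∀ v, inner ℂ y (p v) = 0 := fun v => ho2 z v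
      have hwo : ∀ v, inner ℂ w (v - p v) = 0 := fun v => ho1 z v
      have h1 : inner ℂ y (V w - p (V w)) = inner ℂ y (V w) := by
        rw [inner_sub_right, hyo, sub_zero]
      have h2 : inner ℂ w (p (V w)) = inner ℂ w (V w) := by
        have := hwo (V w)
        rw [inner_sub_right] at this
        exact (sub_eq_zero.1 this).symm
      rw [hJz, inner_add_right, inner_smul_right, hz, inner_add_left, inner_add_left, hwo, hyo, h1,
        h2, inner_smul_right]
      ring
    have e3 : (inner ℂ z y).re = ‖y‖ ^ 2 := by
      rw [hz, inner_add_left, show inner ℂ w y = 0 from ho1 z z, add_zero]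
      exact inner_self_eq_norm_sq (𝕜 := ℂ) y
    have h3 : -(‖y‖ * (M * ‖w‖)) ≤ (inner ℂ y (V w)).re := by
      have h4 : ‖inner ℂ y (V w)‖ ≤ ‖y‖ * (M * ‖w‖) :=
        (norm_inner_le_norm _ _).trans (by gcongr; exact V.le_of_opNorm_le hV w)
      have := (abs_le.1 (Complex.abs_re_le_norm (inner ℂ y (V w)))).1
      linarith
    have h5 : -((1 / 4) * ‖z‖ ^ 2) ≤ (inner ℂ z (J (E z))).re := by
      have h6 : ‖inner ℂ z (J (E z))‖ ≤ ‖z‖ * (B * (1 / (4 * B) * ‖z‖)) :=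
        (norm_inner_le_norm _ _).trans (by
          gcongr
          exact (hJn _).trans (by gcongr; exact E.le_of_opNorm_le hE z))
      have h7 : ‖z‖ * (B * (1 / (4 * B) * ‖z‖)) = (1 / 4) * ‖z‖ ^ 2 := by field_simp
      have := (abs_le.1 (Complex.abs_re_le_norm (inner ℂ z (J (E z))))).1
      linarith
    have h8 : t * (d * ‖w‖ ^ 2) ≤ t * (inner ℂ w (c • V w)).re :=
      mul_le_mul_of_nonneg_left (hK w (hpm z)) ht0.le
    have h9 : t * (d * ‖w‖ ^ 2) = (M ^ 2 + 1) / 2 * ‖w‖ ^ 2 := by rw [ht]; field_simp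
    rw [e1, inner_add_right, inner_add_right, e2, Complex.add_re, Complex.add_re, e3,
      Complex.add_re, Complex.re_ofReal_mul]
    have h10 := hpyth z
    -- The excess over half of `‖y‖² + ‖w‖²` is half of this square.
    nlinarith [sq_nonneg (‖y‖ - M * ‖w‖)]
  obtain ⟨R₀, hR1, hR2⟩ := exists_inverse_of_coercive (J ∘L S) (by norm_num : (0 : ℝ) < 1 / 4) hcoer
  have hR1' : ∀ f, J (S (R₀ f)) = f := fun f => DFunLike.congr_fun hR1 f
  have hR2' : ∀ z, R₀ (J (S z)) = z := fun z => DFunLike.congr_fun hR2 z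
  -- `R₀ J` is a left inverse of `S` by construction; injectivity of `J` makes it a right inverse
  -- too.
  have hSR : ∀ f, S (R₀ (J f)) = f := by
    intro f
    refine sub_eq_zero.1 (hJinj _ ?_)
    rw [map_sub, hR1', sub_self]
  refine ⟨R₀ ∘L J, ?_, fun f => ?_, fun z => ?_⟩
  · refine ContinuousLinearMap.opNorm_le_bound _ (by positivity) fun f => ?_
    set z := R₀ (J f) with hz
    have h1 := hcoer z
    have h2 : ‖inner ℂ z ((J ∘L S) z)‖ ≤ ‖z‖ * (B * ‖f‖) := by
      refine (norm_inner_le_norm _ _).trans ?_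
      gcongr
      rw [ContinuousLinearMap.comp_apply, hz, hSR]
      exact hJn f
    have h3 := h1.trans ((Complex.re_le_norm _).trans h2)
    change ‖z‖ ≤ 4 * B * ‖f‖
    rcases (norm_nonneg z).eq_or_lt with h0 | h0
    · rw [← h0]; positivity
    · have : ‖z‖ * ((1 / 4) * ‖z‖) ≤ ‖z‖ * (B * ‖f‖) := by nlinarith
      have := le_of_mul_le_mul_left this h0
      linarith
  · exact hSR f
  · exact hR2' z

end Hilbert

/-! ### Locality and gluing of weak derivatives -/

variable {n : ℕ} {Ω : Opens (Rn n)} {k : ℕ} {a : (Fin n → ℕ) → ℂ} {c s₀ s : ℝ}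

theorem tsupport_pd_subset (i : Fin n) (φ : 𝓓(Ω, ℂ)) : tsupport (pd i φ) ⊆ tsupport φ := by
  have h : (pd i φ : Rn n → ℂ) = fun x => fderiv ℝ φ x (EuclideanSpace.single i 1) := by
    ext x; exact pd_apply i φ x
  rw [h]
  refine closure_minimal (fun x hx => ?_) (isClosed_tsupport _)
  by_contra hx'
  rw [Function.mem_support] at hx
  refine hx ?_
  rw [fderiv_of_notMem_tsupport ℝ hx']
  rfl

theorem tsupport_mderiv_subset (α : Fin n → ℕ) (φ : 𝓓(Ω, ℂ)) :
    tsupport (mderiv α φ) ⊆ tsupport φ := by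
  obtain ⟨L, -, -, hL⟩ := exists_mderiv_eq_foldr α
  rw [hL]
  clear hL
  induction L with
  | nil => rfl
  | cons i L ih => exact (tsupport_pd_subset i _).trans ih

theorem mderiv_zero (φ : 𝓓(Ω, ℂ)) : mderiv 0 φ = φ := by
  obtain ⟨L, hlen, -, hL⟩ := exists_mderiv_eq_foldr (0 : Fin n → ℕ)
  have : L = [] := by
    rw [← List.length_eq_zero_iff, hlen]
    simp [mlen]
  rw [hL, this]
  rfl

theorem ae_eq_on_of_integral_eq {U : Set (Rn n)} (hU : IsOpen U) {g₁ g₂ : Rn n → ℂ}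
    (h₁ : LocallyIntegrableOn g₁ (Ω : Set (Rn n))) (h₂ : LocallyIntegrableOn g₂ (Ω : Set (Rn n)))
    (h : ∀ φ : 𝓓(Ω, ℂ), tsupport φ ⊆ U → ∫ x in (Ω : Set (Rn n)), g₁ x * φ x =
      ∫ x in (Ω : Set (Rn n)), g₂ x * φ x) :
    ∀ᵐ x ∂volume.restrict (Ω : Set (Rn n)), x ∈ U → g₁ x = g₂ x := by
  rw [ae_restrict_iff' Ω.isOpen.measurableSet]
  have key := (hU.inter Ω.isOpen).ae_eq_zero_of_integral_contDiff_smul_eq_zero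
    (f := fun x => g₁ x - g₂ x) (μ := volume)
    ((h₁.sub h₂).mono_set Set.inter_subset_right) ?_
  · filter_upwards [key] with x hx hxΩ hxU
    exact sub_eq_zero.1 (hx ⟨hxU, hxΩ⟩)
  · intro g hg hgc hgs
    let φ : 𝓓(Ω, ℂ) := ⟨fun x => (g x : ℂ), Complex.ofRealCLM.contDiff.comp hg,
      hgc.comp_left Complex.ofReal_zero, (tsupport_comp_subset Complex.ofReal_zero g).trans
        (hgs.trans Set.inter_subset_right)⟩
    have hφs : tsupport φ ⊆ U := (tsupport_comp_subset Complex.ofReal_zero g).trans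
        (hgs.trans Set.inter_subset_left)
    have hint : ∀ f : Rn n → ℂ, LocallyIntegrableOn f (Ω : Set (Rn n)) →
        Integrable fun x => f x * φ x := by
      intro f hf
      have := φ.integrable_bilin (ContinuousLinearMap.mul ℝ ℂ) hf
      exact this.congr (Filter.Eventually.of_forall fun x => mul_comm _ _)
    have := h φ hφs
    rw [setIntegral_testFunction, setIntegral_testFunction, ← sub_eq_zero,
      ← integral_sub (hint g₁ h₁) (hint g₂ h₂)] at this
    rw [← this]
    refine integral_congr_ae (Filter.Eventually.of_forall fun x => ?_)
    change (g x : ℝ) • (g₁ x - g₂ x) = g₁ x * (g x : ℂ) - g₂ x * (g x : ℂ)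
    rw [Complex.real_smul]
    ring

/-- Weak derivatives are local. -/
theorem hasWeakDeriv_ae_eq_on {α : Fin n → ℕ} {U : Set (Rn n)} (hU : IsOpen U)
    {f₁ f₂ g₁ g₂ : Rn n → ℂ} (h₁ : HasWeakDeriv Ω α f₁ g₁) (h₂ : HasWeakDeriv Ω α f₂ g₂)
    (h : ∀ᵐ x ∂volume.restrict (Ω : Set (Rn n)), x ∈ U → f₁ x = f₂ x) :
    ∀ᵐ x ∂volume.restrict (Ω : Set (Rn n)), x ∈ U → g₁ x = g₂ x := by
  refine ae_eq_on_of_integral_eq hU h₁.2.1 h₂.2.1 fun φ hφ => ?_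
  rw [h₁.2.2, h₂.2.2]
  congr 1
  refine integral_congr_ae ?_
  filter_upwards [h] with x hx
  by_cases hxs : x ∈ tsupport (mderiv α φ)
  · rw [hx (hφ (tsupport_mderiv_subset α φ hxs))]
  · rw [image_eq_zero_of_notMem_tsupport hxs, mul_zero, mul_zero]

theorem hasWeakDeriv_ae_eq {α : Fin n → ℕ} {f g₁ g₂ : Rn n → ℂ} (h₁ : HasWeakDeriv Ω α f g₁)
    (h₂ : HasWeakDeriv Ω α f g₂) : g₁ =ᵐ[volume.restrict (Ω : Set (Rn n))] g₂ := by
  filter_upwards [hasWeakDeriv_ae_eq_on isOpen_univ h₁ h₂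
    (Filter.Eventually.of_forall fun x _ => rfl)] with x hx using hx (Set.mem_univ x)

theorem hasWeakDeriv_zero_self {f : Rn n → ℂ} (hf : LocallyIntegrableOn f (Ω : Set (Rn n))) :
    HasWeakDeriv Ω 0 f f :=
  ⟨hf, hf, fun φ => by simp [mderiv_zero, mlen]⟩

theorem exists_nat_cover {X ι : Type*} [TopologicalSpace X] [SecondCountableTopology X]
    [Nonempty ι] (U : ι → Set X) (hU : ∀ i, IsOpen (U i)) :
    ∃ j : ℕ → ι, ⋃ m, U (j m) = ⋃ i, U i := by
  obtain ⟨T, hT, hTU⟩ := isOpen_iUnion_countable U hU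
  rcases T.eq_empty_or_nonempty with rfl | hne
  · refine ⟨fun _ => Classical.arbitrary ι, le_antisymm ?_ ?_⟩
    · exact Set.iUnion_subset fun m => Set.subset_iUnion U _
    · rw [← hTU]; simp
  · obtain ⟨j, hj⟩ := hT.exists_eq_range hne
    refine ⟨j, ?_⟩
    rw [← hTU, hj, Set.biUnion_range]

/-- A function whose cut-offs have weak derivatives in `L²` has a weak derivative. -/
theorem exists_hasWeakDeriv_of_cutoff (hbd : Bornology.IsBounded (Ω : Set (Rn n))) (w : L2 Ω)
    (α : Fin n → ℕ) (h : ∀ χ : 𝓓(Ω, ℂ), ∃ d : L2 Ω, HasWeakDeriv Ω α (cutOp Ω χ w) d) :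
    ∃ D : Rn n → ℂ, HasWeakDeriv Ω α w D := by
  classical
  rcases isEmpty_or_nonempty (Ω : Set (Rn n)) with hemp | hne
  · refine ⟨0, locallyIntegrableOn_L2 hbd w, ?_, fun φ => ?_⟩
    · exact fun x hx => (hemp.false ⟨x, hx⟩).elim
    · have : (Ω : Set (Rn n)) = ∅ := Set.isEmpty_coe_sort.1 hemp
      simp [this]
  choose d hd using h
  have hloc : ∀ χ₁ χ₂ : 𝓓(Ω, ℂ), ∀ U : Set (Rn n), IsOpen U → (∀ x ∈ U, χ₁ x = χ₂ x) →
      ∀ᵐ x ∂volume.restrict (Ω : Set (Rn n)), x ∈ U → d χ₁ x = d χ₂ x := by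
    intro χ₁ χ₂ U hU hχ
    refine hasWeakDeriv_ae_eq_on hU (hd χ₁) (hd χ₂) ?_
    filter_upwards [cutOp_coe χ₁ w, cutOp_coe χ₂ w] with x h1 h2 hx
    rw [h1, h2, hχ x hx]
  choose χ U hUo hxU hχU using fun x : (Ω : Set (Rn n)) =>
    exists_testFunction_eq_one (Ω := Ω) (isCompact_singleton (x := (x : Rn n)))
      (Set.singleton_subset_iff.2 x.2)
  obtain ⟨j, hj⟩ := exists_nat_cover U hUo
  have hcov : ∀ x ∈ (Ω : Set (Rn n)), ∃ m, x ∈ U (j m) := by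
    intro x hx
    have : x ∈ ⋃ i, U i := Set.mem_iUnion.2 ⟨⟨x, hx⟩, hxU ⟨x, hx⟩ rfl⟩
    rw [← hj] at this
    exact Set.mem_iUnion.1 this
  -- The local derivatives agree almost everywhere where their cut-offs agree. A countable subcover
  -- keeps the union of the exceptional sets null, and choosing the first index makes the glued
  -- function well defined.
  let D : Rn n → ℂ := fun x => if hx : ∃ m, x ∈ U (j m) then d (χ (j (Nat.find hx))) x else 0
  have hD : ∀ (ψ : 𝓓(Ω, ℂ)) (O : Set (Rn n)), IsOpen O → (∀ x ∈ O, ψ x = 1) →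
      ∀ᵐ x ∂volume.restrict (Ω : Set (Rn n)), x ∈ O → D x = d ψ x := by
    intro ψ O hO hψ
    have h1 : ∀ᵐ x ∂volume.restrict (Ω : Set (Rn n)), ∀ m, x ∈ O ∩ U (j m) →
        d (χ (j m)) x = d ψ x := by
      rw [ae_all_iff]
      intro m
      exact hloc _ _ _ (hO.inter (hUo _)) fun x hx => by rw [hχU _ x hx.2, hψ x hx.1]
    filter_upwards [h1, ae_restrict_mem Ω.isOpen.measurableSet] with x hx hxΩ hxO
    have hex := hcov x hxΩ
    simp only [D, dif_pos hex]
    exact hx _ ⟨hxO, Nat.find_spec hex⟩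
  refine ⟨D, locallyIntegrableOn_L2 hbd w, fun x hx => ?_, fun φ => ?_⟩
  · refine ⟨U ⟨x, hx⟩ ∩ (Ω : Set (Rn n)), Filter.inter_mem (mem_nhdsWithin_of_mem_nhds
      ((hUo _).mem_nhds (hxU ⟨x, hx⟩ rfl))) self_mem_nhdsWithin, ?_⟩
    have h1 : IntegrableOn (d (χ ⟨x, hx⟩)) (U ⟨x, hx⟩ ∩ (Ω : Set (Rn n))) :=
      (integrable_L2 hbd _).mono_set Set.inter_subset_right
    refine h1.congr ?_
    have h2 := hD (χ ⟨x, hx⟩) (U ⟨x, hx⟩) (hUo _) (hχU _)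
    rw [ae_restrict_iff' Ω.isOpen.measurableSet] at h2
    rw [Filter.EventuallyEq, ae_restrict_iff' ((hUo _).inter Ω.isOpen).measurableSet]
    filter_upwards [h2] with y hy hyU
    exact (hy hyU.2 hyU.1).symm
  -- A single cut-off equal to one near the support of `φ` replaces the glued derivative in the
  -- integral.
  · obtain ⟨ψ, O, hO, hφO, hψ⟩ := exists_testFunction_eq_one φ.hasCompactSupport φ.tsupport_subset
    have h1 : ∫ x in (Ω : Set (Rn n)), D x * φ x = ∫ x in (Ω : Set (Rn n)), d ψ x * φ x := by
      refine integral_congr_ae ?_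
      filter_upwards [hD ψ O hO hψ] with x hx
      by_cases hxs : x ∈ tsupport φ
      · rw [hx (hφO hxs)]
      · rw [image_eq_zero_of_notMem_tsupport hxs, mul_zero, mul_zero]
    rw [h1, (hd ψ).2.2 φ]
    congr 1
    refine integral_congr_ae ?_
    filter_upwards [cutOp_coe ψ w] with x hx
    by_cases hxs : x ∈ tsupport (mderiv α φ)
    · rw [hx, hψ x (hφO (tsupport_mderiv_subset α φ hxs)), one_mul]
    · rw [image_eq_zero_of_notMem_tsupport hxs, mul_zero, mul_zero]

end BornOp

end

/-! ### The kernel of `P + s^k` and the two domains -/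

noncomputable section

namespace BornOp

variable {n : ℕ} {Ω : Opens (Rn n)} {k : ℕ} {a : (Fin n → ℕ) → ℂ} {c s₀ s : ℝ}

theorem tL2_add (φ ψ : 𝓓(Ω, ℂ)) : tL2 (φ + ψ) = tL2 φ + tL2 ψ := rfl

theorem tL2_smul (z : ℂ) (φ : 𝓓(Ω, ℂ)) : tL2 (z • φ) = z • tL2 φ := rfl

/-- Test functions as elements of `L²(Ω)`, linearly. -/
def tL2Lin (Ω : Opens (Rn n)) : 𝓓(Ω, ℂ) →ₗ[ℂ] L2 Ω where
  toFun := tL2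
  map_add' := tL2_add
  map_smul' := tL2_smul

theorem mderiv_add (α : Fin n → ℕ) (φ ψ : 𝓓(Ω, ℂ)) :
    mderiv α (φ + ψ) = mderiv α φ + mderiv α ψ := by
  obtain ⟨L, -, -, hL⟩ := exists_mderiv_eq_foldr α
  simp only [hL]
  clear hL
  induction L with
  | nil => rfl
  | cons i L ih => simp only [List.foldr_cons, ih, map_add]

theorem mderiv_smul (α : Fin n → ℕ) (z : ℂ) (φ : 𝓓(Ω, ℂ)) :
    mderiv α (z • φ) = z • mderiv α φ := by
  obtain ⟨L, -, -, hL⟩ := exists_mderiv_eq_foldr α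
  simp only [hL]
  clear hL
  induction L with
  | nil => rfl
  | cons i L ih => simp only [List.foldr_cons, ih, map_smul]

/-- The map `φ ↦ (P + s^k) φ` from test functions to `L²(Ω)`. -/
def shiftLin (Ω : Opens (Rn n)) (k : ℕ) (a : (Fin n → ℕ) → ℂ) (s : ℝ) : 𝓓(Ω, ℂ) →ₗ[ℂ] L2 Ω where
  toFun φ := tL2 (shiftOp k a s φ)
  map_add' φ ψ := by
    rw [← tL2_add]
    congr 1
    simp only [shiftOp, constCoeffOp, mderiv_add, smul_add, Finset.sum_add_distrib]
    abel
  map_smul' z φ := by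
    rw [RingHom.id_apply, ← tL2_smul]
    congr 1
    simp only [shiftOp, constCoeffOp, mderiv_smul, smul_add, Finset.smul_sum]
    congr 1
    · exact Finset.sum_congr rfl fun α _ => smul_comm _ _ _
    · exact smul_comm _ _ _

/-- The kernel of `P + s^k` on `L²(Ω)`. -/
def kerP (Ω : Opens (Rn n)) (k : ℕ) (a : (Fin n → ℕ) → ℂ) (s : ℝ) : Submodule ℂ (L2 Ω) :=
  (LinearMap.range (shiftLin Ω k a s))ᗮ

instance : (kerP Ω k a s).HasOrthogonalProjection := by
  unfold kerP
  infer_instance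

theorem shiftOp_conjT (hsa : IsFormallySelfAdjointOp k a) (φ : 𝓓(Ω, ℂ)) :
    shiftOp k a s (conjT φ) =
      conjT (constCoeffOp k (fun α => (-1) ^ mlen α * a α) φ + ((s : ℂ) ^ k) • φ) := by
  ext x
  simp only [shiftOp, constCoeffOp, mderiv_conjT, add_apply, sum_apply, smul_apply, conjT_apply,
    smul_eq_mul, map_add, map_sum, map_mul, map_pow, Complex.conj_ofReal, map_neg, map_one]
  congr 1
  refine Finset.sum_congr rfl fun α hα => ?_
  rw [hsa α hα]

section

variable (hbd : Bornology.IsBounded (Ω : Set (Rn n)))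

include hbd

/-- By formal self-adjointness, orthogonality to `(P + s^k) φ` is the weak equation tested with the
conjugate of `φ`; the conjugation converts the sesquilinear product into the bilinear pairing. -/
theorem mem_kerP (hsa : IsFormallySelfAdjointOp k a) {h : L2 Ω} :
    h ∈ kerP Ω k a s ↔ DistribEq Ω k a h (0 - ((s : ℂ) ^ k) • h) := by
  have key : ∀ φ : 𝓓(Ω, ℂ), inner ℂ (tL2 (shiftOp k a s (conjT φ))) h =
      (∫ x in (Ω : Set (Rn n)), h x * constCoeffOp k (fun α => (-1) ^ mlen α * a α) φ x) -
        ∫ x in (Ω : Set (Rn n)), (0 - ((s : ℂ) ^ k) • h : L2 Ω) x * φ x := by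
    intro φ
    rw [shiftOp_conjT hsa, inner_tL2_conjT]
    have h1 : ∫ x in (Ω : Set (Rn n)), (0 - ((s : ℂ) ^ k) • h : L2 Ω) x * φ x =
        -((s : ℂ) ^ k * ∫ x in (Ω : Set (Rn n)), h x * φ x) := by
      rw [← inner_tL2_conjT, ← inner_tL2_conjT, zero_sub, inner_neg_right, inner_smul_right]
    rw [h1, sub_neg_eq_add, ← integral_const_mul, ← integral_add (integrable_L2_mul hbd _ _)
      ((integrable_L2_mul hbd _ _).const_mul _)]
    refine integral_congr_ae (Filter.Eventually.of_forall fun x => ?_)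
    simp only [add_apply, smul_apply, smul_eq_mul]
    ring
  rw [kerP, Submodule.mem_orthogonal]
  constructor
  · intro hh φ
    have := hh _ ⟨conjT φ, rfl⟩
    change inner ℂ (tL2 (shiftOp k a s (conjT φ))) h = 0 at this
    rw [key] at this
    exact (sub_eq_zero.1 this).symm
  · rintro hh _ ⟨φ, rfl⟩
    change inner ℂ (tL2 (shiftOp k a s φ)) h = 0
    rw [← conjT_conjT φ, key, sub_eq_zero]
    exact (hh _).symm

theorem distribEq_unique {u f g : L2 Ω} (hf : DistribEq Ω k a u f) (hg : DistribEq Ω k a u g) :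
    f = g := by
  apply Lp.ext
  have := ae_eq_on_of_integral_eq isOpen_univ (locallyIntegrableOn_L2 hbd f)
    (locallyIntegrableOn_L2 hbd g) fun φ _ => (hf φ).trans (hg φ).symm
  filter_upwards [this] with x hx using hx (Set.mem_univ x)

-- The double orthogonal complement of the range on test functions is its closure, so vectors
-- orthogonal to the kernel are limits of `(P + s^k) φ`.
omit hbd in
theorem mem_kerP_orthogonal_iff {y : L2 Ω} :
    y ∈ (kerP Ω k a s)ᗮ ↔ y ∈ closure (Set.range fun φ : 𝓓(Ω, ℂ) => tL2 (shiftOp k a s φ)) := by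
  rw [kerP, Submodule.orthogonal_orthogonal_eq_closure, ← SetLike.mem_coe,
    Submodule.topologicalClosure_coe]
  rfl

/-- If `(P + s^k) φ` approximates `y`, then `φ = G (P + s^k) φ` approximates `G y` together with all
derivatives up to order `k`, since these are bounded multipliers. -/
theorem memH0_Psi (h : SymBound k a c s₀) (hs : s₀ ≤ s) {y : L2 Ω} (hy : y ∈ (kerP Ω k a s)ᗮ) :
    MemH0 Ω k (Psi Ω k a s 0 (FL Ω y)) := by
  rw [mem_kerP_orthogonal_iff] at hy
  refine ⟨fun α => Psi Ω k a s α (FL Ω y), fun α hα =>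
    hasWeakDeriv_Psi hbd h hs (mem_multiIndices.1 hα).2 _, fun δ hδ => ?_⟩
  set A : ℝ := ∑ α ∈ multiIndices n 0 k, ‖Psi Ω k a s α‖ + 1 with hA
  have hA0 : 0 < A := by positivity
  obtain ⟨_, ⟨φ, rfl⟩, hφ⟩ := Metric.mem_closure_iff.1 hy (δ / A) (by positivity)
  refine ⟨φ, fun α hα => ?_⟩
  have hαk := (mem_multiIndices.1 hα).2
  have h1 : ‖Psi Ω k a s α (FL Ω y) - tL2 (mderiv α φ)‖ < δ := by
    rw [← Psi_FL_shiftOp hbd h hs hαk, ← map_sub, ← map_sub]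
    refine ((Psi Ω k a s α).le_opNorm _).trans_lt ?_
    rw [LinearIsometry.norm_map, ← dist_eq_norm]
    have h2 : ‖Psi Ω k a s α‖ < A := by
      have := Finset.single_le_sum (f := fun α => ‖Psi Ω k a s α‖) (fun _ _ => norm_nonneg _) hα
      linarith
    calc _ ≤ ‖Psi Ω k a s α‖ * (δ / A) := by gcongr
      _ < A * (δ / A) := by gcongr
      _ = δ := by field_simp
  rw [Lp.norm_def] at h1
  rw [eLpNorm_congr_ae (g := (Psi Ω k a s α (FL Ω y) - tL2 (mderiv α φ) : L2 Ω))]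
  · exact (ENNReal.lt_ofReal_iff_toReal_lt (Lp.eLpNorm_ne_top _)).2 h1
  · filter_upwards [Lp.coeFn_sub (Psi Ω k a s α (FL Ω y)) (tL2 (mderiv α φ)),
      tL2_coe (mderiv α φ)] with x h1 h2
    rw [h1, Pi.sub_apply, h2]

/-- Convergence of test functions in `H^k` implies convergence of `(P + s^k) φ` in `L²`, and the
limit `y = (P + s^k) u` lies in the closure of the range; continuity of `G` gives `u = G y`. -/
theorem exists_of_memH0 (h : SymBound k a c s₀) (hs : s₀ ≤ s) {u : L2 Ω} (hu : MemH0 Ω k u) :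
    ∃ y ∈ (kerP Ω k a s)ᗮ, u = Psi Ω k a s 0 (FL Ω y) := by
  obtain ⟨D, hD, happ⟩ := hu
  have h0 : (0 : Fin n → ℕ) ∈ multiIndices n 0 k := mem_multiIndices.2 (by simp [mlen])
  have hD0 : D 0 = u := by
    apply Lp.ext
    exact hasWeakDeriv_ae_eq (hD 0 h0) (hasWeakDeriv_zero_self (locallyIntegrableOn_L2 hbd u))
  choose φ hφ using fun j : ℕ => happ (1 / ((j : ℝ) + 1)) (by positivity)
  have hlim : ∀ α ∈ multiIndices n 0 k,
      Filter.Tendsto (fun j => tL2 (mderiv α (φ j))) Filter.atTop (nhds (D α)) := by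
    intro α hα
    rw [tendsto_iff_norm_sub_tendsto_zero]
    refine squeeze_zero (fun _ => norm_nonneg _) (fun j => ?_)
      (tendsto_one_div_add_atTop_nhds_zero_nat (𝕜 := ℝ))
    rw [norm_sub_rev, Lp.norm_def]
    refine ENNReal.toReal_le_of_le_ofReal (by positivity) ?_
    refine le_trans (le_of_eq (eLpNorm_congr_ae ?_)) (hφ j α hα).le
    filter_upwards [Lp.coeFn_sub (D α) (tL2 (mderiv α (φ j))),
      tL2_coe (mderiv α (φ j))] with x h1 h2
    rw [h1, Pi.sub_apply, h2]
  have hlim0 : Filter.Tendsto (fun j => tL2 (φ j)) Filter.atTop (nhds u) := by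
    have := hlim 0 h0
    simpa only [mderiv_zero, hD0] using this
  set y : L2 Ω := ∑ α ∈ multiIndices n 0 k, a α • D α + ((s : ℂ) ^ k) • u with hy
  have hylim : Filter.Tendsto (fun j => tL2 (shiftOp k a s (φ j))) Filter.atTop (nhds y) := by
    have e : ∀ j, tL2 (shiftOp k a s (φ j)) =
        ∑ α ∈ multiIndices n 0 k, a α • tL2 (mderiv α (φ j)) + ((s : ℂ) ^ k) • tL2 (φ j) := by
      intro j
      change tL2Lin Ω _ = ∑ α ∈ multiIndices n 0 k, a α • tL2Lin Ω _ + ((s : ℂ) ^ k) • tL2Lin Ω _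
      rw [shiftOp, constCoeffOp]
      simp only [map_add, map_sum, map_smul]
    simp only [e]
    exact (tendsto_finsetSum _ fun α hα => (hlim α hα).const_smul _).add (hlim0.const_smul _)
  refine ⟨y, ?_, ?_⟩
  · rw [mem_kerP_orthogonal_iff]
    exact mem_closure_of_tendsto hylim (Filter.Eventually.of_forall fun j => ⟨φ j, rfl⟩)
  · have h00 : mlen (0 : Fin n → ℕ) ≤ k := by simp [mlen]
    have h1 := ((Psi Ω k a s 0).continuous.tendsto _).comp
      (((FL Ω).continuous.tendsto y).comp hylim)
    refine tendsto_nhds_unique hlim0 (h1.congr fun j => ?_)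
    have := Psi_FL_shiftOp hbd h hs h00 (φ j)
    rw [mderiv_zero] at this
    exact this

theorem distribEq_Psi_FL (h : SymBound k a c s₀) (hs : s₀ ≤ s) (g : L2 Ω) :
    DistribEq Ω k a (Psi Ω k a s 0 (FL Ω g)) (g - ((s : ℂ) ^ k) • Psi Ω k a s 0 (FL Ω g)) := by
  have := distribEq_Psi hbd h hs (FL Ω g)
  rwa [FLadj_FL] at this

/-- `G g` is one solution of `(P + s^k) w = g` in `Ω`, so any other differs from it by an element of
the kernel. With `distribEq_add_kerP` this describes `H^k_P(Ω)`. -/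
theorem sub_mem_kerP (h : SymBound k a c s₀) (hs : s₀ ≤ s) {w g : L2 Ω}
    (hw : DistribEq Ω k a w (g - ((s : ℂ) ^ k) • w)) :
    w - Psi Ω k a s 0 (FL Ω g) ∈ kerP Ω k a s := by
  rw [mem_kerP hbd h.hsa]
  have h1 := distribEq_add hw (distribEq_smul (-1 : ℂ) (distribEq_Psi_FL hbd h hs g))
  have e1 : w - Psi Ω k a s 0 (FL Ω g) = w + (-1 : ℂ) • Psi Ω k a s 0 (FL Ω g) := by module
  rw [e1]
  convert h1 using 1
  module

theorem distribEq_add_kerP (h : SymBound k a c s₀) (hs : s₀ ≤ s) {x : L2 Ω} (g : L2 Ω)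
    (hx : x ∈ kerP Ω k a s) : DistribEq Ω k a (Psi Ω k a s 0 (FL Ω g) + x)
      (g - ((s : ℂ) ^ k) • (Psi Ω k a s 0 (FL Ω g) + x)) := by
  rw [mem_kerP hbd h.hsa] at hx
  have h1 := distribEq_add (distribEq_Psi_FL hbd h hs g) hx
  convert h1 using 1
  module

end

end BornOp

end

/-! ### Concentration of the kernel at the boundary and coercivity of `V` -/

noncomputable section

namespace BornOp

variable {n : ℕ} {Ω : Opens (Rn n)} {k : ℕ} {a : (Fin n → ℕ) → ℂ} {c s₀ s : ℝ}

theorem re_inner_nonneg {X : Type*} [MeasurableSpace X] {μ : Measure X} {f g : Lp ℂ 2 μ}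
    (h : ∀ᵐ x ∂μ, 0 ≤ (inner ℂ (f x) (g x)).re) : 0 ≤ (inner ℂ f g).re := by
  rw [L2.inner_def]
  have := integral_re (L2.integrable_inner (𝕜 := ℂ) f g)
  simp only [RCLike.re_eq_complex_re] at this
  rw [← this]
  exact integral_nonneg_of_ae h

section

variable (hbd : Bornology.IsBounded (Ω : Set (Rn n)))

include hbd

theorem exists_cutoff_kerP (h : SymBound k a c s₀) (χ : 𝓓(Ω, ℂ)) :
    ∃ C : ℝ, 0 ≤ C ∧ ∀ s, s₀ ≤ s → ∃ Q : L2 Ω →L[ℂ] L2x n, ‖Q‖ ≤ C ∧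
      ∀ f, cutOp Ω χ ((kerP Ω k a s).starProjection f) = Psi Ω k a s 0 (Q f) := by
  obtain ⟨C, hC, hQ⟩ := exists_cutoff_factor hbd h χ
  refine ⟨C, hC, fun s hs => ?_⟩
  obtain ⟨Q, hQn, hQe⟩ := hQ s hs (kerP Ω k a s).starProjection 0 fun f => by
    rw [zero_apply]
    exact (mem_kerP hbd h.hsa).1 (Submodule.starProjection_apply_mem _ f)
  refine ⟨Q, hQn.trans ?_, hQe⟩
  rw [norm_zero, add_zero]
  exact mul_le_of_le_one_right hC (Submodule.starProjection_norm_le _)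

/-- Away from the boundary a kernel element is `(P + s^k)⁻¹` of something bounded uniformly in `s`,
which costs the full factor `s^{-k}`. -/
theorem norm_cutOp_kerP_le (h : SymBound k a c s₀) (χ : 𝓓(Ω, ℂ)) :
    ∃ C : ℝ, 0 ≤ C ∧ ∀ s, s₀ ≤ s →
      ‖cutOp Ω χ ∘L (kerP Ω k a s).starProjection‖ ≤ C / s ^ k := by
  obtain ⟨C, hC, hQ⟩ := exists_cutoff_kerP hbd h χ
  have hc := h.hc
  refine ⟨(2 * Real.pi) ^ k / c * C, by positivity, fun s hs => ?_⟩
  have hs1 := h.one_le hs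
  obtain ⟨Q, hQn, hQe⟩ := hQ s hs
  have e1 : cutOp Ω χ ∘L (kerP Ω k a s).starProjection = Psi Ω k a s 0 ∘L Q := by
    ext1 f
    exact hQe f
  have h0 := norm_Psi_le (Ω := Ω) h hs (α := 0) (by simp [mlen])
  rw [e1]
  calc _ ≤ ‖Psi Ω k a s 0‖ * ‖Q‖ := ContinuousLinearMap.opNorm_comp_le _ _
    _ ≤ ((2 * Real.pi) ^ k / c / s ^ k) * C := by
      simp only [mlen, Pi.zero_apply, Finset.sum_const_zero, Nat.sub_zero] at h0
      gcongr
    _ = _ := by ring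

/-- A potential with values in a half-plane near the boundary is coercive on the kernel of
`P + s^k` for large `s`. -/
theorem exists_coercive_kerP (h : SymBound k a c s₀) {V : Rn n → ℂ}
    (hV : MemLp V ∞ (volume.restrict (Ω : Set (Rn n)))) (hVc : CoerciveNearBoundary Ω V) :
    ∃ z : ℂ, z ≠ 0 ∧ ∃ d : ℝ, 0 < d ∧ ∃ s₁ : ℝ, s₀ ≤ s₁ ∧ ∀ s, s₁ ≤ s → ∀ x ∈ kerP Ω k a s,
      d * ‖x‖ ^ 2 ≤ (inner ℂ x (z • mulOp (volume.restrict (Ω : Set (Rn n))) V x)).re := by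
  obtain ⟨U, hU, hfr, z, δ, hz, hδ, hVU⟩ := hVc
  have hK : IsCompact (closure (Ω : Set (Rn n)) \ U) :=
    hbd.isCompact_closure.diff hU
  have hKΩ : closure (Ω : Set (Rn n)) \ U ⊆ Ω := by
    rintro x ⟨hx, hxU⟩
    by_contra hxΩ
    exact hxU (hfr ⟨hx, by rwa [Ω.isOpen.interior_eq]⟩)
  obtain ⟨χ, O, -, hKO, hχ⟩ := exists_testFunction_eq_one hK hKΩ
  obtain ⟨C, hC, hcut⟩ := norm_cutOp_kerP_le hbd h χ
  obtain ⟨M, hM⟩ : ∃ M : ℝ, ∀ᵐ x ∂volume.restrict (Ω : Set (Rn n)), ‖V x‖ ≤ M := by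
    refine ⟨(eLpNorm V ∞ (volume.restrict (Ω : Set (Rn n)))).toReal, ?_⟩
    filter_upwards [enorm_ae_le_eLpNormEssSup V (volume.restrict (Ω : Set (Rn n)))] with x hx
    rw [eLpNorm_exponent_top, ← toReal_enorm]
    exact ENNReal.toReal_mono (by simpa using hV.2.ne) hx
  -- Chosen so that `Re (z V) - δ + L |χ|² ≥ 0` on all of `Ω`: near the boundary by the half-plane
  -- condition, elsewhere because `χ = 1` there and `L` outweighs both `δ` and `|z V|`.
  set L : ℝ := δ + ‖z‖ * |M| with hL
  have hL0 : 0 ≤ L := by positivity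
  -- For such `s` the interior mass satisfies `L ‖χ x‖² ≤ L C² / s ‖x‖² ≤ (δ / 2) ‖x‖²`, so half of
  -- `δ` remains.
  refine ⟨z, hz, δ / 2, by positivity, max s₀ (2 * L * C ^ 2 / δ), le_max_left _ _,
    fun s hs x hx => ?_⟩
  have hs0 : s₀ ≤ s := (le_max_left _ _).trans hs
  have hs1 := h.one_le hs0
  have hs2 : 2 * L * C ^ 2 / δ ≤ s := (le_max_right _ _).trans hs
  have hχx : ‖cutOp Ω χ x‖ ≤ C / s ^ k * ‖x‖ := by
    have := (cutOp Ω χ ∘L (kerP Ω k a s).starProjection).le_of_opNorm_le (hcut s hs0) x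
    rwa [ContinuousLinearMap.comp_apply, Submodule.starProjection_eq_self_iff.2 hx] at this
  have hχx2 : L * ‖cutOp Ω χ x‖ ^ 2 ≤ δ / 2 * ‖x‖ ^ 2 := by
    have h1 : (C / s ^ k) ^ 2 ≤ C ^ 2 / s := by
      rw [div_pow, ← pow_mul]
      gcongr
      exact le_self_pow₀ hs1 (by have := h.hk; omega)
    have h2 : L * (C ^ 2 / s) ≤ δ / 2 := by
      rw [div_le_iff₀ hδ] at hs2
      rw [← mul_div_assoc, div_le_iff₀ (by positivity)]
      linarith
    calc L * ‖cutOp Ω χ x‖ ^ 2 ≤ L * (C / s ^ k * ‖x‖) ^ 2 := by gcongr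
      _ = L * (C / s ^ k) ^ 2 * ‖x‖ ^ 2 := by ring
      _ ≤ L * (C ^ 2 / s) * ‖x‖ ^ 2 := by gcongr
      _ ≤ _ := by gcongr
  set y : L2 Ω := mulOp (volume.restrict (Ω : Set (Rn n))) V x with hy
  have hpos := re_inner_nonneg (f := x)
    (g := z • y - (δ : ℂ) • x + (L : ℂ) • (ContinuousLinearMap.adjoint (cutOp Ω χ) (cutOp Ω χ x)))
    (by
      rw [cutOp, adjoint_mulOp (memLp_top_testFunction χ _)]
      filter_upwards [Lp.coeFn_add (z • y - (δ : ℂ) • x) ((L : ℂ) •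
          mulOp (volume.restrict (Ω : Set (Rn n))) (fun x => (starRingEnd ℂ) (χ x))
            (mulOp (volume.restrict (Ω : Set (Rn n))) χ x)),
        Lp.coeFn_sub (z • y) ((δ : ℂ) • x), Lp.coeFn_smul z y, Lp.coeFn_smul (δ : ℂ) x,
        Lp.coeFn_smul (L : ℂ) (mulOp (volume.restrict (Ω : Set (Rn n)))
          (fun x => (starRingEnd ℂ) (χ x)) (mulOp (volume.restrict (Ω : Set (Rn n))) χ x)),
        mulOp_coe (memLp_top_testFunction χ (volume.restrict (Ω : Set (Rn n)))) x,
        mulOp_coe (memLp_top_testFunction χ (volume.restrict (Ω : Set (Rn n)))).star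
          (mulOp (volume.restrict (Ω : Set (Rn n))) χ x),
        mulOp_coe hV x, hVU, hM, ae_restrict_mem Ω.isOpen.measurableSet]
        with t h1 h2 h3 h4 h5 h6 h7 h8 h9 h10 h11
      rw [h1, Pi.add_apply, h2, Pi.sub_apply, h3, h4, h5, Pi.smul_apply, Pi.smul_apply,
        Pi.smul_apply, smul_eq_mul, smul_eq_mul, smul_eq_mul]
      have h7' := h7
      change (mulOp (volume.restrict (Ω : Set (Rn n))) (fun x => (starRingEnd ℂ) (χ x)) _ : L2 Ω) t
        = (starRingEnd ℂ) (χ t) * _ at h7'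
      rw [h7', h6, h8, RCLike.inner_apply]
      have e1 : (z * (V t * x t) - δ * x t + L * ((starRingEnd ℂ) (χ t) * (χ t * x t))) *
          (starRingEnd ℂ) (x t) = (z * V t - δ + L * (χ t * (starRingEnd ℂ) (χ t))) *
            (x t * (starRingEnd ℂ) (x t)) := by ring
      rw [e1, Complex.mul_conj, Complex.mul_conj, Complex.re_mul_ofReal]
      refine mul_nonneg ?_ (Complex.normSq_nonneg _)
      rw [← Complex.ofReal_mul, Complex.add_re, Complex.sub_re, Complex.ofReal_re,
        Complex.ofReal_re]
      by_cases htU : t ∈ U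
      · have := h9 htU
        have := mul_nonneg hL0 (Complex.normSq_nonneg (χ t))
        linarith
      · rw [hχ t (hKO ⟨subset_closure h11, htU⟩), map_one, mul_one]
        have h12 := (Complex.abs_re_le_norm (z * V t)).trans_eq (norm_mul _ _)
        have h13 : ‖z‖ * ‖V t‖ ≤ ‖z‖ * |M| := by
          gcongr
          exact h10.trans (le_abs_self M)
        have := neg_abs_le (z * V t).re
        linarith)
  rw [inner_add_right, inner_sub_right, inner_smul_right x x, inner_smul_right x _ (L : ℂ),
    ContinuousLinearMap.adjoint_inner_right, inner_self_eq_norm_sq_to_K,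
    inner_self_eq_norm_sq_to_K, Complex.add_re, Complex.sub_re] at hpos
  have e2 : ∀ r q : ℝ, ((r : ℂ) * ((q : ℝ) : ℂ) ^ 2).re = r * q ^ 2 := by
    intro r q
    rw [← Complex.ofReal_pow, ← Complex.ofReal_mul, Complex.ofReal_re]
  have e3 := e2 δ ‖x‖
  have e4 := e2 L ‖cutOp Ω χ x‖
  simp only [Complex.coe_algebraMap] at hpos
  rw [e3, e4] at hpos
  linarith

end

end BornOp

end

/-! ### The lower order operator `W` -/

noncomputable section

namespace BornOp

variable {n : ℕ} {Ω : Opens (Rn n)} {k e : ℕ} {a : (Fin n → ℕ) → ℂ} {c s₀ s : ℝ}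
  {W : (Fin n → ℕ) → Rn n → ℂ}

/-- The operator `W (P + s^k)⁻¹` on the Fourier side. -/
def WPsi (Ω : Opens (Rn n)) (k : ℕ) (a : (Fin n → ℕ) → ℂ) (s : ℝ) (e : ℕ)
    (W : (Fin n → ℕ) → Rn n → ℂ) : L2x n →L[ℂ] L2 Ω :=
  ∑ α ∈ multiIndices n 1 e, mulOp (volume.restrict (Ω : Set (Rn n))) (W α) ∘L Psi Ω k a s α

theorem exists_norm_WPsi_le (h : SymBound k a c s₀) (he : e < k) :
    ∃ C : ℝ, 0 ≤ C ∧ ∀ s, s₀ ≤ s → ‖WPsi Ω k a s e W‖ ≤ C / s ^ (k - e) := by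
  have hc := h.hc
  refine ⟨∑ α ∈ multiIndices n 1 e, ‖mulOp (volume.restrict (Ω : Set (Rn n))) (W α)‖ *
    ((2 * Real.pi) ^ k / c), by positivity, fun s hs => ?_⟩
  have hs1 := h.one_le hs
  rw [Finset.sum_div]
  refine (norm_sum_le _ _).trans (Finset.sum_le_sum fun α hα => ?_)
  have hαe := (mem_multiIndices.1 hα).2
  refine (ContinuousLinearMap.opNorm_comp_le _ _).trans ?_
  rw [mul_div_assoc]
  gcongr
  refine (norm_Psi_le h hs (by omega)).trans ?_
  gcongr

theorem mulOp_WPsi_coe (hW : ∀ α ∈ multiIndices n 1 e,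
      MemLp (W α) ∞ (volume.restrict (Ω : Set (Rn n)))) (v : L2x n) :
    ∀ᵐ x ∂volume.restrict (Ω : Set (Rn n)),
      WPsi Ω k a s e W v x = ∑ α ∈ multiIndices n 1 e, W α x * Psi Ω k a s α v x := by
  have h1 : WPsi Ω k a s e W v = ∑ α ∈ multiIndices n 1 e,
      mulOp (volume.restrict (Ω : Set (Rn n))) (W α) (Psi Ω k a s α v) := by
    rw [WPsi, sum_apply]
    rfl
  rw [h1]
  have h2 : ∀ᵐ x ∂volume.restrict (Ω : Set (Rn n)), ∀ α ∈ multiIndices n 1 e,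
      mulOp (volume.restrict (Ω : Set (Rn n))) (W α) (Psi Ω k a s α v) x =
        W α x * Psi Ω k a s α v x :=
    (Finset.eventually_all _).2 fun α hα => mulOp_coe (hW α hα) _
  filter_upwards [finset_sum_Lp_coe (multiIndices n 1 e) fun α =>
    mulOp (volume.restrict (Ω : Set (Rn n))) (W α) (Psi Ω k a s α v), h2] with x hx1 hx2
  rw [hx1]
  exact Finset.sum_congr rfl hx2

theorem lowerOrderEq_unique {w z₁ z₂ : L2 Ω} (h₁ : LowerOrderEq Ω e W w z₁)
    (h₂ : LowerOrderEq Ω e W w z₂) : z₁ = z₂ := by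
  obtain ⟨D₁, hD₁, hz₁⟩ := h₁
  obtain ⟨D₂, hD₂, hz₂⟩ := h₂
  apply Lp.ext
  have h3 : ∀ᵐ x ∂volume.restrict (Ω : Set (Rn n)), ∀ α ∈ multiIndices n 1 e, D₁ α x = D₂ α x :=
    (Finset.eventually_all _).2 fun α hα => hasWeakDeriv_ae_eq (hD₁ α hα) (hD₂ α hα)
  filter_upwards [hz₁, hz₂, h3] with x hx1 hx2 hx3
  rw [hx1, hx2]
  exact Finset.sum_congr rfl fun α hα => by rw [hx3 α hα]

section

variable (hbd : Bornology.IsBounded (Ω : Set (Rn n)))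

include hbd

theorem isCompactOperator_WPsi (h : SymBound k a c s₀) (hs : s₀ ≤ s) (he : e < k) :
    IsCompactOperator (WPsi Ω k a s e W) :=
  isCompactOperator_sum _ fun _ hα => (isCompactOperator_Psi hbd h hs
    ((mem_multiIndices.1 hα).2.trans_lt he)).clm_comp _

theorem hasWeakDeriv_add {α : Fin n → ℕ} {u v : L2 Ω} {f g : Rn n → ℂ}
    (hf : HasWeakDeriv Ω α u f) (hg : HasWeakDeriv Ω α v g) :
    HasWeakDeriv Ω α (u + v : L2 Ω) (f + g) := by
  refine ⟨locallyIntegrableOn_L2 hbd _, hf.2.1.add hg.2.1, fun φ => ?_⟩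
  have hi : ∀ {q : Rn n → ℂ}, LocallyIntegrableOn q (Ω : Set (Rn n)) →
      IntegrableOn (fun x => q x * φ x) (Ω : Set (Rn n)) := by
    intro q hq
    have h1 := (hq.integrableOn_compact_subset φ.tsupport_subset φ.hasCompactSupport)
    have h2 : IntegrableOn (fun x => q x * φ x) (tsupport φ) :=
      h1.mul_continuousOn φ.continuous.continuousOn φ.hasCompactSupport
    have h3 : Integrable (fun x => q x * φ x) :=
      (integrableOn_iff_integrable_of_support_subset fun x hx => subset_tsupport φ
        (right_ne_zero_of_mul hx)).1 h2
    exact h3.integrableOn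
  have e1 : ∫ x in (Ω : Set (Rn n)), (u + v : L2 Ω) x * mderiv α φ x =
      (∫ x in (Ω : Set (Rn n)), u x * mderiv α φ x) +
        ∫ x in (Ω : Set (Rn n)), v x * mderiv α φ x := by
    rw [← integral_add (integrable_L2_mul hbd u _) (integrable_L2_mul hbd v _)]
    refine integral_congr_ae ?_
    filter_upwards [Lp.coeFn_add u v] with x hx
    rw [hx, Pi.add_apply, add_mul]
  rw [e1, mul_add, ← hf.2.2, ← hg.2.2, ← integral_add (hi hf.2.1) (hi hg.2.1)]
  refine integral_congr_ae (Filter.Eventually.of_forall fun x => ?_)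
  simp only [Pi.add_apply, add_mul]

theorem lowerOrderEq_add {u v p q : L2 Ω} (hu : LowerOrderEq Ω e W u p)
    (hv : LowerOrderEq Ω e W v q) : LowerOrderEq Ω e W (u + v) (p + q) := by
  obtain ⟨D₁, hD₁, hz₁⟩ := hu
  obtain ⟨D₂, hD₂, hz₂⟩ := hv
  refine ⟨fun α => D₁ α + D₂ α, fun α hα => hasWeakDeriv_add hbd (hD₁ α hα) (hD₂ α hα), ?_⟩
  filter_upwards [hz₁, hz₂, Lp.coeFn_add p q] with x h1 h2 h3
  rw [h3, Pi.add_apply, h1, h2, ← Finset.sum_add_distrib]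
  exact Finset.sum_congr rfl fun α _ => by rw [Pi.add_apply, mul_add]

theorem lowerOrderEq_Psi (h : SymBound k a c s₀) (hs : s₀ ≤ s) (he : e < k)
    (hW : ∀ α ∈ multiIndices n 1 e, MemLp (W α) ∞ (volume.restrict (Ω : Set (Rn n))))
    (v : L2x n) : LowerOrderEq Ω e W (Psi Ω k a s 0 v) (WPsi Ω k a s e W v) :=
  ⟨fun α => Psi Ω k a s α v, fun _ hα => hasWeakDeriv_Psi hbd h hs
    ((mem_multiIndices.1 hα).2.trans he.le) v, mulOp_WPsi_coe hW v⟩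

/-- Solutions of `(P + s^k) w = g ∈ L²` have weak derivatives up to order `k`. -/
theorem exists_hasWeakDeriv_of_distribEq (h : SymBound k a c s₀) (hs : s₀ ≤ s) {w g : L2 Ω}
    (hw : DistribEq Ω k a w (g - ((s : ℂ) ^ k) • w)) {α : Fin n → ℕ} (hα : mlen α ≤ k) :
    ∃ D : Rn n → ℂ, HasWeakDeriv Ω α w D := by
  refine exists_hasWeakDeriv_of_cutoff hbd w α fun χ => ?_
  obtain ⟨C, -, hC⟩ := exists_cutoff_factor hbd h χ
  -- A single pair `(w, g)` is viewed as a pair of operators from `ℂ`, and the factorisation is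
  -- evaluated at `1`.
  obtain ⟨Q, -, hQ⟩ := hC s hs (ContinuousLinearMap.toSpanSingleton ℂ w)
    (ContinuousLinearMap.toSpanSingleton ℂ g) fun z => by
      have := distribEq_smul z hw
      simp only [ContinuousLinearMap.toSpanSingleton_apply]
      convert this using 1
      rw [smul_sub, smul_comm]
  have h1 := hQ 1
  rw [ContinuousLinearMap.toSpanSingleton_apply, one_smul] at h1
  rw [h1]
  exact ⟨_, hasWeakDeriv_Psi hbd h hs hα _⟩

/-- By locality, the weak derivatives of `w` and of `χ w` agree where `χ = 1`, and elsewhere the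
coefficients vanish. So `W w` can be computed from `χ w`, which is in the range of the multiplier.
-/
theorem lowerOrderEq_of_cutoff (h : SymBound k a c s₀) (hs : s₀ ≤ s) (he : e < k)
    (hW : ∀ α ∈ multiIndices n 1 e, MemLp (W α) ∞ (volume.restrict (Ω : Set (Rn n))))
    {U : Set (Rn n)} (hU : IsOpen U) {χ : 𝓓(Ω, ℂ)} (hχ : ∀ x ∈ U, χ x = 1)
    (hWU : ∀ α ∈ multiIndices n 1 e, ∀ᵐ x ∂volume.restrict (Ω : Set (Rn n)), x ∉ U → W α x = 0)
    {w g : L2 Ω} (hw : DistribEq Ω k a w (g - ((s : ℂ) ^ k) • w)) {v : L2x n}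
    (hv : cutOp Ω χ w = Psi Ω k a s 0 v) : LowerOrderEq Ω e W w (WPsi Ω k a s e W v) := by
  have hD : ∀ α : Fin n → ℕ, ∃ D : Rn n → ℂ, mlen α ≤ k → HasWeakDeriv Ω α w D := by
    intro α
    by_cases hα : mlen α ≤ k
    · obtain ⟨D, hD⟩ := exists_hasWeakDeriv_of_distribEq hbd h hs hw hα
      exact ⟨D, fun _ => hD⟩
    · exact ⟨0, fun h => (hα h).elim⟩
  choose D hD using hD
  refine ⟨D, fun α hα => hD α ((mem_multiIndices.1 hα).2.trans he.le), ?_⟩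
  have hDU : ∀ᵐ x ∂volume.restrict (Ω : Set (Rn n)), ∀ α ∈ multiIndices n 1 e, x ∈ U →
      Psi Ω k a s α v x = D α x := by
    refine (Finset.eventually_all _).2 fun α hα => ?_
    have hαk := (mem_multiIndices.1 hα).2.trans he.le
    refine hasWeakDeriv_ae_eq_on hU (hasWeakDeriv_Psi hbd h hs hαk v) (hD α hαk) ?_
    rw [← hv]
    filter_upwards [cutOp_coe χ w] with x hx hxU
    rw [hx, hχ x hxU, one_mul]
  filter_upwards [mulOp_WPsi_coe (k := k) (a := a) (s := s) hW v, hDU,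
    (Finset.eventually_all _).2 hWU] with x h1 h2 h3
  rw [h1]
  refine Finset.sum_congr rfl fun α hα => ?_
  by_cases hxU : x ∈ U
  · rw [h2 α hα hxU]
  · rw [h3 α hα hxU, zero_mul, zero_mul]

end

/-- A cut-off equal to one on a neighbourhood of the supports of the coefficients. -/
theorem exists_testFunction_support (hW : ∀ α ∈ multiIndices n 1 e, MemSobolevC Ω (mlen α) ∞ (W α)) :
    ∃ χ : 𝓓(Ω, ℂ), ∃ U : Set (Rn n), IsOpen U ∧ (∀ x ∈ U, χ x = 1) ∧
      ∀ α ∈ multiIndices n 1 e, ∀ᵐ x ∂volume.restrict (Ω : Set (Rn n)), x ∉ U → W α x = 0 := by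
  have h1 : ∀ α : Fin n → ℕ, ∃ K : Set (Rn n), IsCompact K ∧ K ⊆ Ω ∧ (α ∈ multiIndices n 1 e →
      ∀ᵐ x ∂volume.restrict (Ω : Set (Rn n)), x ∉ K → W α x = 0) := by
    intro α
    by_cases hα : α ∈ multiIndices n 1 e
    · obtain ⟨-, -, K, hK, hKΩ, hKW⟩ := hW α hα
      exact ⟨K, hK, hKΩ, fun _ => hKW⟩
    · exact ⟨∅, isCompact_empty, Set.empty_subset _, fun h => (hα h).elim⟩
  choose K hK hKΩ hKW using h1
  obtain ⟨χ, U, hU, hKU, hχ⟩ := exists_testFunction_eq_one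
    ((multiIndices n 1 e).isCompact_biUnion fun α _ => hK α)
    (Set.iUnion₂_subset fun α _ => hKΩ α)
  refine ⟨χ, U, hU, hχ, fun α hα => ?_⟩
  filter_upwards [hKW α hα] with x hx hxU
  exact hx fun hxK => hxU (hKU (Set.mem_biUnion hα hxK))

end BornOp

end

/-! ### The Born approximation in coordinates and its inversion -/

noncomputable section

namespace BornOp

variable {n : ℕ} {Ω : Opens (Rn n)} {k e : ℕ} {a : (Fin n → ℕ) → ℂ} {c s₀ s : ℝ}
  {W : (Fin n → ℕ) → Rn n → ℂ} {V : Rn n → ℂ} {μ ν : ℕ}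

/-- The operator `(P + s^k)⁻¹`, cut down to `Ω`. -/
def resolventCut (Ω : Opens (Rn n)) (k : ℕ) (a : (Fin n → ℕ) → ℂ) (s : ℝ) : L2 Ω →L[ℂ] L2 Ω :=
  Psi Ω k a s 0 ∘L (FL Ω).toContinuousLinearMap

/-- The operator `W (P + s^k)⁻¹` with `(P + s^k)⁻¹` cut down to `Ω`. -/
def lowerResolvent (Ω : Opens (Rn n)) (k : ℕ) (a : (Fin n → ℕ) → ℂ) (s : ℝ) (e : ℕ)
    (W : (Fin n → ℕ) → Rn n → ℂ) : L2 Ω →L[ℂ] L2 Ω :=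
  WPsi Ω k a s e W ∘L (FL Ω).toContinuousLinearMap

theorem norm_comp_FL_le {E : Type*} [NormedAddCommGroup E] [NormedSpace ℂ E]
    (T : L2x n →L[ℂ] E) : ‖T ∘L (FL Ω).toContinuousLinearMap‖ ≤ ‖T‖ := by
  refine (ContinuousLinearMap.opNorm_comp_le _ _).trans ?_
  exact mul_le_of_le_one_right (norm_nonneg _) (FL Ω).norm_toContinuousLinearMap_le

/-- The Born approximation in the coordinates `u = G y`, `w = G g + x` with `G` the inverse of
`P + s^k`, `y ⟂ ker (P + s^k)` and `x ∈ ker (P + s^k)`, where `WP` is `W` on the kernel. -/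
def BornCoord (Ω : Opens (Rn n)) (k e : ℕ) (a : (Fin n → ℕ) → ℂ) (W : (Fin n → ℕ) → Rn n → ℂ)
    (V : Rn n → ℂ) (s : ℝ) (WP : L2 Ω →L[ℂ] L2 Ω) : Prop :=
  ∀ (μ ν : ℕ) (lam : ℝ), ∀ y ∈ (kerP Ω k a s)ᗮ, ∀ g, ∀ x ∈ kerP Ω k a s, ∀ q,
    BornGraph Ω k e a W V μ ν lam (resolventCut Ω k a s y, resolventCut Ω k a s g + x) q ↔
      q = ((y - ((s : ℂ) ^ k) • resolventCut Ω k a s y) +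
        (μ : ℂ) • lowerResolvent Ω k a s e W y + (((lam : ℂ) ^ ν)⁻¹ •
          (lowerResolvent Ω k a s e W g + WP x) +
          mulOp (volume.restrict (Ω : Set (Rn n))) V (resolventCut Ω k a s g + x)),
        g - ((s : ℂ) ^ k) • (resolventCut Ω k a s g + x))

/-- The lower order part of the Born approximation, as an operator acting on `y + x`. -/
def bornError (Ω : Opens (Rn n)) (k : ℕ) (a : (Fin n → ℕ) → ℂ) (s : ℝ) (e : ℕ)
    (W : (Fin n → ℕ) → Rn n → ℂ) (WP : L2 Ω →L[ℂ] L2 Ω) (μ ν : ℕ) (lam : ℝ) :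
    L2 Ω →L[ℂ] L2 Ω :=
  (μ : ℂ) • (lowerResolvent Ω k a s e W ∘L
    (ContinuousLinearMap.id ℂ _ - (kerP Ω k a s).starProjection)) +
  ((lam : ℂ) ^ ν)⁻¹ • (WP ∘L (kerP Ω k a s).starProjection)

/-- The operator `(λ^{-ν} W + V) (P + s^k)⁻¹`. -/
def bornCross (Ω : Opens (Rn n)) (k : ℕ) (a : (Fin n → ℕ) → ℂ) (s : ℝ) (e : ℕ)
    (W : (Fin n → ℕ) → Rn n → ℂ) (V : Rn n → ℂ) (ν : ℕ) (lam : ℝ) : L2 Ω →L[ℂ] L2 Ω :=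
  mulOp (volume.restrict (Ω : Set (Rn n))) V ∘L resolventCut Ω k a s +
    ((lam : ℂ) ^ ν)⁻¹ • lowerResolvent Ω k a s e W

section

variable (hbd : Bornology.IsBounded (Ω : Set (Rn n)))

include hbd

/-- Weak derivatives and distributional images are unique, so the existential data in the graph may
be replaced by any known ones. -/
theorem bornGraph_iff (hV : MemLp V ∞ (volume.restrict (Ω : Set (Rn n)))) {lam : ℝ}
    {u w Pu Pw Wu Ww : L2 Ω} (hu : MemH0 Ω k u) (hPu : DistribEq Ω k a u Pu)
    (hPw : DistribEq Ω k a w Pw) (hWu : LowerOrderEq Ω e W u Wu) (hWw : LowerOrderEq Ω e W w Ww)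
    (q : L2 Ω × L2 Ω) :
    BornGraph Ω k e a W V μ ν lam (u, w) q ↔
      q = (Pu + (μ : ℂ) • Wu + (((lam : ℂ) ^ ν)⁻¹ • Ww +
        mulOp (volume.restrict (Ω : Set (Rn n))) V w), Pw) := by
  have key : ∀ᵐ x ∂volume.restrict (Ω : Set (Rn n)),
      (Pu + (μ : ℂ) • Wu + (((lam : ℂ) ^ ν)⁻¹ • Ww +
        mulOp (volume.restrict (Ω : Set (Rn n))) V w) : L2 Ω) x =
        (Pu x + (μ : ℂ) * Wu x) + (((lam : ℂ) ^ ν)⁻¹ * Ww x + V x * w x) := by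
    filter_upwards [Lp.coeFn_add (Pu + (μ : ℂ) • Wu) (((lam : ℂ) ^ ν)⁻¹ • Ww +
        mulOp (volume.restrict (Ω : Set (Rn n))) V w), Lp.coeFn_add Pu ((μ : ℂ) • Wu),
      Lp.coeFn_add (((lam : ℂ) ^ ν)⁻¹ • Ww) (mulOp (volume.restrict (Ω : Set (Rn n))) V w),
      Lp.coeFn_smul (μ : ℂ) Wu, Lp.coeFn_smul (((lam : ℂ) ^ ν)⁻¹) Ww, mulOp_coe hV w]
      with x h1 h2 h3 h4 h5 h6
    rw [h1, Pi.add_apply, h2, h3, Pi.add_apply, Pi.add_apply, h4, h5, h6, Pi.smul_apply,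
      Pi.smul_apply, smul_eq_mul, smul_eq_mul]
  constructor
  · rintro ⟨-, -, Pu', Wu', Ww', h1, h2, h3, h4, h5⟩
    obtain rfl := distribEq_unique hbd h1 hPu
    obtain rfl := lowerOrderEq_unique h2 hWu
    obtain rfl := lowerOrderEq_unique h3 hWw
    refine Prod.ext (Lp.ext ?_) (distribEq_unique hbd h5 hPw)
    filter_upwards [h4, key] with x hx1 hx2
    rw [hx1, hx2]
  · rintro rfl
    exact ⟨hu, ⟨Pw, hPw⟩, Pu, Wu, Ww, hPu, hWu, hWw, key, hPw⟩

/-- On the kernel, `W` acts as `W (P + s^k)⁻¹ Q`, where `Q` is the uniformly bounded factor of the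
cut-off projection. Hence it is `O(s^{e-k})`, although kernel elements need not be regular up to the
boundary. -/
theorem exists_bornGraph_coord (h : SymBound k a c s₀) (he : e < k)
    (hV : MemLp V ∞ (volume.restrict (Ω : Set (Rn n))))
    (hW : ∀ α ∈ multiIndices n 1 e, MemSobolevC Ω (mlen α) ∞ (W α)) :
    ∃ C : ℝ, 0 ≤ C ∧ ∀ s, s₀ ≤ s → ∃ WP : L2 Ω →L[ℂ] L2 Ω, ‖WP‖ ≤ C / s ^ (k - e) ∧
      BornCoord Ω k e a W V s WP := by
  obtain ⟨χ, U, hU, hχ, hWU⟩ := exists_testFunction_support hW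
  obtain ⟨C, hC, hQ⟩ := exists_cutoff_kerP hbd h χ
  obtain ⟨C', hC', hWn⟩ := exists_norm_WPsi_le (Ω := Ω) (W := W) h he
  have hW' := fun α hα => (hW α hα).1
  refine ⟨C' * C, by positivity, fun s hs => ?_⟩
  obtain ⟨Q, hQn, hQe⟩ := hQ s hs
  have hs1 := h.one_le hs
  refine ⟨WPsi Ω k a s e W ∘L Q, ?_, fun μ ν lam y hy g x hx q => ?_⟩
  · refine (ContinuousLinearMap.opNorm_comp_le _ _).trans ?_
    have h1 := hWn s hs
    calc _ ≤ C' / s ^ (k - e) * C := by gcongr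
      _ = _ := by ring
  · refine bornGraph_iff hbd hV (memH0_Psi hbd h hs hy) (distribEq_Psi_FL hbd h hs y)
      (distribEq_add_kerP hbd h hs g hx) (lowerOrderEq_Psi hbd h hs he hW' _)
      (lowerOrderEq_add hbd (lowerOrderEq_Psi hbd h hs he hW' _) ?_) q
    refine lowerOrderEq_of_cutoff hbd h hs he hW' hU hχ hWU ((mem_kerP hbd h.hsa).1 hx) ?_
    change cutOp Ω χ x = Psi Ω k a s 0 (Q x)
    rw [← hQe x, Submodule.starProjection_eq_self_iff.2 hx]

theorem existsUnique_bornGraph (h : SymBound k a c s₀) (hs : s₀ ≤ s) {WP : L2 Ω →L[ℂ] L2 Ω}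
    (hgraph : BornCoord Ω k e a W V s WP) {lam : ℝ} {u w : L2 Ω} (hu : MemH0 Ω k u)
    (hw : MemHP Ω k a w) : ∃! q : L2 Ω × L2 Ω, BornGraph Ω k e a W V μ ν lam (u, w) q := by
  obtain ⟨Pw, hw⟩ := hw
  obtain ⟨y, hy, rfl⟩ := exists_of_memH0 hbd h hs hu
  set g : L2 Ω := Pw + ((s : ℂ) ^ k) • w with hg
  have hw' : DistribEq Ω k a w (g - ((s : ℂ) ^ k) • w) := by rwa [hg, add_sub_cancel_right]
  have hx := sub_mem_kerP hbd h hs hw'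
  have hwx : w = resolventCut Ω k a s g + (w - Psi Ω k a s 0 (FL Ω g)) := (add_sub_cancel _ _).symm
  have key := hgraph μ ν lam y hy g _ hx
  rw [← hwx] at key
  exact ⟨_, (key _).2 rfl, fun q hq => (key q).1 hq⟩

/-- In the coordinates the terms `s^k G y` and `s^k w` cancel against the spectral shift. The second
row identifies `g`, and the first becomes the block equation for `y + x`, whose two components are
recovered by the projection. -/
theorem bornGraph_sub_iff (h : SymBound k a c s₀) (hs : s₀ ≤ s) {WP S : L2 Ω →L[ℂ] L2 Ω}
    (hgraph : BornCoord Ω k e a W V s WP) {lam : ℝ}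
    (hS1 : ∀ f, S f - (kerP Ω k a s).starProjection (S f) +
      mulOp (volume.restrict (Ω : Set (Rn n))) V ((kerP Ω k a s).starProjection (S f)) +
      bornError Ω k a s e W WP μ ν lam (S f) = f)
    (hS2 : ∀ z, S (z - (kerP Ω k a s).starProjection z +
      mulOp (volume.restrict (Ω : Set (Rn n))) V ((kerP Ω k a s).starProjection z) +
      bornError Ω k a s e W WP μ ν lam z) = z)
    (f g : L2 Ω) (q : L2 Ω × L2 Ω) :
    BornGraph Ω k e a W V μ ν lam q (f - ((s : ℂ) ^ k) • q.1, g - ((s : ℂ) ^ k) • q.2) ↔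
      q = (resolventCut Ω k a s (S (f - bornCross Ω k a s e W V ν lam g) -
          (kerP Ω k a s).starProjection (S (f - bornCross Ω k a s e W V ν lam g))),
        resolventCut Ω k a s g +
          (kerP Ω k a s).starProjection (S (f - bornCross Ω k a s e W V ν lam g))) := by
  set Vo := mulOp (volume.restrict (Ω : Set (Rn n))) V with hVo
  set G := resolventCut Ω k a s with hG
  set WG := lowerResolvent Ω k a s e W with hWG
  set p := (kerP Ω k a s).starProjection with hp
  set θ : ℂ := ((lam : ℂ) ^ ν)⁻¹ with hθ
  set E := bornError Ω k a s e W WP μ ν lam with hE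
  set X := bornCross Ω k a s e W V ν lam with hX
  constructor
  · intro hq
    have hw := hq.2.1
    obtain ⟨y, hy, hqy⟩ := exists_of_memH0 hbd h hs hq.1
    have hw' : DistribEq Ω k a q.2 (g - ((s : ℂ) ^ k) • q.2) := by
      obtain ⟨-, -, -, -, -, -, -, -, -, h1⟩ := hq
      exact h1
    have hx := sub_mem_kerP hbd h hs hw'
    set x := q.2 - Psi Ω k a s 0 (FL Ω g) with hxdef
    have hqx : q.2 = G g + x := (add_sub_cancel _ _).symm
    have hqq : q = (G y, G g + x) := Prod.ext hqy hqx
    rw [hqq, hgraph μ ν lam y hy g x hx] at hq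
    have h1 : f - ((s : ℂ) ^ k) • G y = (y - ((s : ℂ) ^ k) • G y) + (μ : ℂ) • WG y +
      (θ • (WG g + WP x) + Vo (G g + x)) := congrArg Prod.fst hq
    have hpx : p x = x := Submodule.starProjection_eq_self_iff.2 hx
    have hpy : p y = 0 := (Submodule.starProjection_apply_eq_zero_iff _).2 hy
    have hpz : p (y + x) = x := by rw [map_add, hpx, hpy, zero_add]
    have hEz : E (y + x) = (μ : ℂ) • WG y + θ • WP x := by
      change (μ : ℂ) • WG (y + x - p (y + x)) + θ • WP (p (y + x)) = _
      rw [hpz, add_sub_cancel_right]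
    have h2 := hS2 (y + x)
    have hXg : X g = Vo (G g) + θ • WG g := rfl
    have h3 : f - X g = (y + x) - p (y + x) + Vo (p (y + x)) + E (y + x) := by
      rw [hpz, hEz, hXg, add_sub_cancel_right]
      rw [map_add] at h1
      linear_combination (norm := module) h1
    have h4 : S (f - X g) = y + x := by rw [h3]; exact h2
    rw [hqq, h4, hpz, add_sub_cancel_right]
  · intro hq
    set w := S (f - X g) with hw
    have hy : w - p w ∈ (kerP Ω k a s)ᗮ := Submodule.sub_starProjection_mem_orthogonal w
    have hx : p w ∈ kerP Ω k a s := Submodule.starProjection_apply_mem _ w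
    rw [hq, hgraph μ ν lam _ hy g _ hx]
    refine Prod.ext ?_ rfl
    have h1 := hS1 (f - X g)
    rw [← hw] at h1
    have hEz : E w = (μ : ℂ) • WG (w - p w) + θ • WP (p w) := rfl
    have hXg : X g = Vo (G g) + θ • WG g := rfl
    change f - ((s : ℂ) ^ k) • G (w - p w) = (w - p w - ((s : ℂ) ^ k) • G (w - p w)) +
      (μ : ℂ) • WG (w - p w) + (θ • (WG g + WP (p w)) + Vo (G g + p w))
    rw [map_add Vo]
    change w - p w + Vo (p w) + E w = f - X g at h1
    rw [hEz, hXg] at h1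
    linear_combination (norm := module) -h1

/-- The Born approximation is inverted, in block form, for large `s`. -/
theorem exists_block_inverse (h : SymBound k a c s₀) (he : e < k)
    (hV : MemLp V ∞ (volume.restrict (Ω : Set (Rn n)))) (hVc : CoerciveNearBoundary Ω V)
    (hW : ∀ α ∈ multiIndices n 1 e, MemSobolevC Ω (mlen α) ∞ (W α))
    (hμ : μ = 0 ∨ μ = 1) (hν : ν = 0 ∨ ν = 1) :
    ∃ s₁ : ℝ, s₀ ≤ s₁ ∧ ∃ C : ℝ, 0 ≤ C ∧ ∀ s, s₁ ≤ s → ∃ S X : L2 Ω →L[ℂ] L2 Ω,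
      ‖S‖ ≤ C ∧ ‖X‖ ≤ C * (s ^ ((1 - ν) * e) / s ^ k) ∧ IsCompactOperator X ∧
      (∀ u w : L2 Ω, MemH0 Ω k u → MemHP Ω k a w →
        ∃! q : L2 Ω × L2 Ω, BornGraph Ω k e a W V μ ν (s ^ k) (u, w) q) ∧
      ∀ (f g : L2 Ω) (p : L2 Ω × L2 Ω),
        BornGraph Ω k e a W V μ ν (s ^ k) p
          (f - ((s ^ k : ℝ) : ℂ) • p.1, g - ((s ^ k : ℝ) : ℂ) • p.2) ↔
        p = (resolventCut Ω k a s (S (f - X g) - (kerP Ω k a s).starProjection (S (f - X g))),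
          resolventCut Ω k a s g + (kerP Ω k a s).starProjection (S (f - X g))) := by
  obtain ⟨z, hz, d, hd, s₁, hs₁, hcoer⟩ := exists_coercive_kerP hbd h hV hVc
  obtain ⟨C₁, hC₁, hcoord⟩ := exists_bornGraph_coord hbd h he hV hW
  obtain ⟨C₂, hC₂, hWn⟩ := exists_norm_WPsi_le (Ω := Ω) (W := W) h he
  set Vo := mulOp (volume.restrict (Ω : Set (Rn n))) V with hVo
  obtain ⟨η, hη, C₃, hC₃, hinv⟩ := exists_inverse_block (H := L2 Ω) ‖Vo‖ d hd z hz
  have hc := h.hc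
  set A : ℝ := (2 * Real.pi) ^ k / c with hA
  have hA0 : 0 ≤ A := by positivity
  -- The error has norm at most `(2 C₂ + C₁) / s^(k-e)`, the `2` bounding `1 - Π`; since `k - e ≥ 1`
  -- this is at most `η` beyond the threshold.
  refine ⟨max s₁ ((2 * C₂ + C₁) / η), hs₁.trans (le_max_left _ _), C₃ + (‖Vo‖ * A + C₂),
    by positivity, fun s hs => ?_⟩
  have hss₁ : s₁ ≤ s := (le_max_left _ _).trans hs
  have hs0 : s₀ ≤ s := hs₁.trans hss₁
  have hs1 := h.one_le hs0
  have hsη : (2 * C₂ + C₁) / η ≤ s := (le_max_right _ _).trans hs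
  obtain ⟨WP, hWP, hgraph⟩ := hcoord s hs0
  have hWs := hWn s hs0
  set G := resolventCut Ω k a s with hG
  set WG := lowerResolvent Ω k a s e W with hWG
  set p := (kerP Ω k a s).starProjection with hp
  have hpn : ‖p‖ ≤ 1 := Submodule.starProjection_norm_le _
  have hGn : ‖G‖ ≤ A / s ^ k := by
    refine (norm_comp_FL_le _).trans ?_
    have := norm_Psi_le (Ω := Ω) h hs0 (α := 0) (by simp [mlen])
    simpa only [mlen, Pi.zero_apply, Finset.sum_const_zero, Nat.sub_zero] using this
  have hWGn : ‖WG‖ ≤ C₂ / s ^ (k - e) := (norm_comp_FL_le _).trans hWs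
  set θ : ℂ := (((s ^ k : ℝ) : ℂ) ^ ν)⁻¹ with hθ
  have hθn : ‖θ‖ = ((s ^ k) ^ ν)⁻¹ := by
    rw [hθ, norm_inv, norm_pow, Complex.norm_real, Real.norm_of_nonneg (by positivity)]
  have hθ1 : ‖θ‖ ≤ 1 := by
    rw [hθn]
    exact inv_le_one_of_one_le₀ (one_le_pow₀ (one_le_pow₀ hs1))
  have hμ1 : ‖(μ : ℂ)‖ ≤ 1 := by
    rcases hμ with rfl | rfl <;> simp
  set E : L2 Ω →L[ℂ] L2 Ω :=
    (μ : ℂ) • (WG ∘L (ContinuousLinearMap.id ℂ _ - p)) + θ • (WP ∘L p) with hE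
  have hEn : ‖E‖ ≤ η := by
    have h1 : ‖ContinuousLinearMap.id ℂ (L2 Ω) - p‖ ≤ 2 := by
      refine (norm_sub_le _ _).trans ?_
      have := ContinuousLinearMap.norm_id_le (𝕜 := ℂ) (E := L2 Ω)
      linarith
    have h2 : ‖WG ∘L (ContinuousLinearMap.id ℂ _ - p)‖ ≤ C₂ / s ^ (k - e) * 2 :=
      (ContinuousLinearMap.opNorm_comp_le _ _).trans (by gcongr)
    have h3 : ‖WP ∘L p‖ ≤ C₁ / s ^ (k - e) * 1 :=
      (ContinuousLinearMap.opNorm_comp_le _ _).trans (by gcongr)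
    have h4 : s ≤ s ^ (k - e) := le_self_pow₀ hs1 (by omega)
    calc ‖E‖ ≤ ‖(μ : ℂ)‖ * ‖WG ∘L (ContinuousLinearMap.id ℂ _ - p)‖ + ‖θ‖ * ‖WP ∘L p‖ := by
          refine (norm_add_le _ _).trans (le_of_eq ?_)
          rw [norm_smul, norm_smul]
      _ ≤ 1 * (C₂ / s ^ (k - e) * 2) + 1 * (C₁ / s ^ (k - e) * 1) := by gcongr
      _ = (2 * C₂ + C₁) / s ^ (k - e) := by ring
      _ ≤ (2 * C₂ + C₁) / s := by gcongr
      _ ≤ η := by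
        rw [div_le_iff₀ hη] at hsη
        rw [div_le_iff₀ (by positivity)]
        linarith
  obtain ⟨S, hSn, hS1, hS2⟩ := hinv (kerP Ω k a s) Vo E le_rfl (hcoer s hss₁) hEn
  set X : L2 Ω →L[ℂ] L2 Ω := Vo ∘L G + θ • WG with hX
  have hlam : ((s ^ k : ℝ) : ℂ) = (s : ℂ) ^ k := by push_cast; rfl
  refine ⟨S, X, hSn.trans (by linarith [mul_nonneg (norm_nonneg Vo) hA0]), ?_, ?_, ?_, ?_⟩
  · have h1 : ‖Vo ∘L G‖ ≤ ‖Vo‖ * (A / s ^ k) :=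
      (ContinuousLinearMap.opNorm_comp_le _ _).trans (by gcongr)
    have h2 : ‖θ • WG‖ ≤ C₂ * (s ^ ((1 - ν) * e) / s ^ k) := by
      rw [norm_smul, hθn]
      have h3 : s ^ e / s ^ k = 1 / s ^ (k - e) := by
        rw [div_eq_div_iff (by positivity) (by positivity), one_mul, ← pow_add]
        congr 1
        omega
      have h4 : (1 : ℝ) ≤ s ^ (k - e) := one_le_pow₀ hs1
      -- For `ν = 0` the bound `s^(e-k)` of `W G` is used as it stands. For `ν = 1` the prefactor
      -- `λ⁻¹ = s^{-k}` already suffices.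
      rcases hν with rfl | rfl
      · simp only [pow_zero, inv_one, one_mul, Nat.sub_zero]
        rw [h3, mul_one_div]
        exact hWGn
      · simp only [pow_one, Nat.sub_self, zero_mul, pow_zero]
        calc (s ^ k)⁻¹ * ‖WG‖ ≤ (s ^ k)⁻¹ * (C₂ / 1) := by
              gcongr
              exact hWGn.trans (by gcongr)
          _ = _ := by ring
    have h5 : (1 : ℝ) ≤ s ^ ((1 - ν) * e) := one_le_pow₀ hs1
    have h6 : A / s ^ k ≤ A * (s ^ ((1 - ν) * e) / s ^ k) := by
      rw [mul_div_assoc']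
      gcongr
      exact le_mul_of_one_le_right hA0 h5
    calc ‖X‖ ≤ ‖Vo‖ * (A * (s ^ ((1 - ν) * e) / s ^ k)) + C₂ * (s ^ ((1 - ν) * e) / s ^ k) := by
          refine (norm_add_le _ _).trans (add_le_add (h1.trans ?_) h2)
          gcongr
      _ = (‖Vo‖ * A + C₂) * (s ^ ((1 - ν) * e) / s ^ k) := by ring
      _ ≤ _ := mul_le_mul_of_nonneg_right (by linarith) (by positivity)
  · have h1 : IsCompactOperator G := (isCompactOperator_Psi hbd h hs0 (α := 0)
      (by simp [mlen]; exact h.hk)).comp_clm _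
    have h2 : IsCompactOperator WG := (isCompactOperator_WPsi hbd h hs0 he).comp_clm _
    exact (h1.clm_comp Vo).add (h2.smul θ)
  · exact fun u w hu hw => existsUnique_bornGraph hbd h hs0 hgraph hu hw
  · rw [hlam]
    exact fun f g q => bornGraph_sub_iff hbd h hs0 hgraph hS1 hS2 f g q

end

end BornOp

end

/-! ### Entries of the resolvent matrix -/

noncomputable section

namespace BornOp

variable {n : ℕ} {Ω : Opens (Rn n)} {k : ℕ} {a : (Fin n → ℕ) → ℂ} {c s₀ s : ℝ}
  {S X : L2 Ω →L[ℂ] L2 Ω}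

/-- The operator `∂^α (P + s^k)⁻¹ (1 - Π) S`, where `Π` projects onto `ker (P + s^k)`. -/
def derivRes (Ω : Opens (Rn n)) (k : ℕ) (a : (Fin n → ℕ) → ℂ) (s : ℝ) (S : L2 Ω →L[ℂ] L2 Ω)
    (α : Fin n → ℕ) : L2 Ω →L[ℂ] L2 Ω :=
  Psi Ω k a s α ∘L (FL Ω).toContinuousLinearMap ∘L
    (ContinuousLinearMap.id ℂ _ - (kerP Ω k a s).starProjection) ∘L S

/-- The component `Π S` of the resolvent, where `Π` projects onto `ker (P + s^k)`. -/
def kerRes (Ω : Opens (Rn n)) (k : ℕ) (a : (Fin n → ℕ) → ℂ) (s : ℝ) (S : L2 Ω →L[ℂ] L2 Ω) :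
    L2 Ω →L[ℂ] L2 Ω :=
  (kerP Ω k a s).starProjection ∘L S

/-- The component `(P + s^k)⁻¹ - Π S X` of the resolvent. -/
def diagRes (Ω : Opens (Rn n)) (k : ℕ) (a : (Fin n → ℕ) → ℂ) (s : ℝ) (S X : L2 Ω →L[ℂ] L2 Ω) :
    L2 Ω →L[ℂ] L2 Ω :=
  resolventCut Ω k a s + kerRes Ω k a s S ∘L (-X)

theorem resolvent_apply (f g : L2 Ω) :
    (derivRes Ω k a s S 0 f + (derivRes Ω k a s S 0 ∘L (-X)) g,
      kerRes Ω k a s S f + diagRes Ω k a s S X g) =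
    (resolventCut Ω k a s (S (f - X g) - (kerP Ω k a s).starProjection (S (f - X g))),
      resolventCut Ω k a s g + (kerP Ω k a s).starProjection (S (f - X g))) := by
  have e1 : derivRes Ω k a s S 0 (f - X g) =
      derivRes Ω k a s S 0 f + derivRes Ω k a s S 0 ((-X) g) := by
    rw [sub_eq_add_neg, map_add]
    rfl
  have e2 : kerRes Ω k a s S (f - X g) = kerRes Ω k a s S f + kerRes Ω k a s S ((-X) g) := by
    rw [sub_eq_add_neg, map_add]
    rfl
  refine Prod.ext e1.symm ?_
  change kerRes Ω k a s S f + (resolventCut Ω k a s g + kerRes Ω k a s S ((-X) g)) =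
    resolventCut Ω k a s g + kerRes Ω k a s S (f - X g)
  rw [e2]
  abel

theorem norm_kerRes_le : ‖kerRes Ω k a s S‖ ≤ ‖S‖ := by
  refine (ContinuousLinearMap.opNorm_comp_le _ _).trans ?_
  exact mul_le_of_le_one_left (norm_nonneg _) (Submodule.starProjection_norm_le _)

theorem norm_derivRes_le (h : SymBound k a c s₀) (hs : s₀ ≤ s) {α : Fin n → ℕ}
    (hα : mlen α ≤ k) :
    ‖derivRes Ω k a s S α‖ ≤ (2 * Real.pi) ^ k / c / s ^ (k - mlen α) * (2 * ‖S‖) := by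
  have hc := h.hc
  have hs1 := h.one_le hs
  have h1 : ‖ContinuousLinearMap.id ℂ (L2 Ω) - (kerP Ω k a s).starProjection‖ ≤ 2 := by
    refine (norm_sub_le _ _).trans ?_
    have := ContinuousLinearMap.norm_id_le (𝕜 := ℂ) (E := L2 Ω)
    have := (kerP Ω k a s).starProjection_norm_le
    linarith
  have h2 := norm_Psi_le (Ω := Ω) h hs hα
  refine (ContinuousLinearMap.opNorm_comp_le _ _).trans (mul_le_mul h2 ?_ (norm_nonneg _)
    (by positivity))
  rw [LinearIsometry.norm_toContinuousLinearMap_comp]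
  exact (ContinuousLinearMap.opNorm_comp_le _ _).trans (by gcongr)

/-- The first term is of order `λ⁻¹`; the second inherits the size of `X` because `Π S` is merely
bounded. -/
theorem norm_diagRes_le (h : SymBound k a c s₀) (hs : s₀ ≤ s) :
    ‖diagRes Ω k a s S X‖ ≤ (2 * Real.pi) ^ k / c / s ^ k + ‖S‖ * ‖X‖ := by
  refine (norm_add_le _ _).trans (add_le_add ?_ ?_)
  · refine (norm_comp_FL_le _).trans ?_
    have := norm_Psi_le (Ω := Ω) h hs (α := 0) (by simp [mlen])
    simpa only [mlen, Pi.zero_apply, Finset.sum_const_zero, Nat.sub_zero] using this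
  · refine (ContinuousLinearMap.opNorm_comp_le _ _).trans ?_
    rw [norm_neg]
    gcongr
    exact norm_kerRes_le

section

variable (hbd : Bornology.IsBounded (Ω : Set (Rn n)))

include hbd

theorem isDerivOp_derivRes (h : SymBound k a c s₀) (hs : s₀ ≤ s) {α : Fin n → ℕ}
    (hα : mlen α ≤ k) : IsDerivOp Ω α (derivRes Ω k a s S 0) (derivRes Ω k a s S α) :=
  fun _ => hasWeakDeriv_Psi hbd h hs hα _

theorem isCompactOperator_derivRes (h : SymBound k a c s₀) (hs : s₀ ≤ s) {α : Fin n → ℕ}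
    (hα : mlen α < k) : IsCompactOperator (derivRes Ω k a s S α) :=
  (isCompactOperator_Psi hbd h hs hα).comp_clm _

theorem isCompactOperator_diagRes (h : SymBound k a c s₀) (hs : s₀ ≤ s)
    (hX : IsCompactOperator X) : IsCompactOperator (diagRes Ω k a s S X) := by
  have h1 : IsCompactOperator (resolventCut Ω k a s) := (isCompactOperator_Psi hbd h hs (α := 0)
    (by simp only [mlen, Pi.zero_apply, Finset.sum_const_zero]; exact h.hk)).comp_clm _
  have h2 : IsCompactOperator (-X : L2 Ω →L[ℂ] L2 Ω) := hX.neg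
  have h3 : IsCompactOperator (kerRes Ω k a s S ∘L (-X)) :=
    h2.clm_comp (kerRes Ω k a s S)
  exact h1.add h3

theorem distribEq_kerRes (h : SymBound k a c s₀) (f : L2 Ω) : DistribEq Ω k a
    (kerRes Ω k a s S f) ((0 : L2 Ω →L[ℂ] L2 Ω) f - ((s : ℂ) ^ k) • kerRes Ω k a s S f) := by
  rw [zero_apply]
  exact (mem_kerP hbd h.hsa).1 (Submodule.starProjection_apply_mem _ _)

theorem distribEq_diagRes (h : SymBound k a c s₀) (hs : s₀ ≤ s) (f : L2 Ω) : DistribEq Ω k a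
    (diagRes Ω k a s S X f)
    (ContinuousLinearMap.id ℂ _ f - ((s : ℂ) ^ k) • diagRes Ω k a s S X f) :=
  distribEq_add_kerP hbd h hs f (Submodule.starProjection_apply_mem _ _)

/-- Cut-offs of solution operators of `P + s^k` are compact, with compact derivatives. -/
theorem isCompactOperator_cutOp (h : SymBound k a c s₀) (hs : s₀ ≤ s) {A B : L2 Ω →L[ℂ] L2 Ω}
    (hAB : ∀ f, DistribEq Ω k a (A f) (B f - ((s : ℂ) ^ k) • A f)) (χ : 𝓓(Ω, ℂ)) :
    IsCompactOperator (cutOp Ω χ ∘L A) ∧ ∀ α : Fin n → ℕ, mlen α < k →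
      ∃ T : L2 Ω →L[ℂ] L2 Ω, IsDerivOp Ω α (cutOp Ω χ ∘L A) T ∧ IsCompactOperator T := by
  obtain ⟨C, -, hC⟩ := exists_cutoff_factor hbd h χ
  obtain ⟨Q, -, hQ⟩ := hC s hs A B hAB
  have e1 : cutOp Ω χ ∘L A = Psi Ω k a s 0 ∘L Q := by
    ext1 f
    exact hQ f
  rw [e1]
  have hcomp : ∀ α : Fin n → ℕ, mlen α < k → IsCompactOperator (Psi Ω k a s α ∘L Q) :=
    fun α hα => (isCompactOperator_Psi hbd h hs hα).comp_clm Q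
  refine ⟨hcomp 0 (by simp only [mlen, Pi.zero_apply, Finset.sum_const_zero]; exact h.hk),
    fun α hα => ⟨Psi Ω k a s α ∘L Q, fun f => hasWeakDeriv_Psi hbd h hs hα.le (Q f), hcomp α hα⟩⟩

end

theorem _root_.IsCompactOperator.comp_right {T : L2 Ω →L[ℂ] L2 Ω} (h : IsCompactOperator T)
    (Y : L2 Ω →L[ℂ] L2 Ω) : IsCompactOperator (T ∘L Y) := h.comp_clm Y

theorem _root_.IsDerivOp.comp {α : Fin n → ℕ} {R T : L2 Ω →L[ℂ] L2 Ω} (h : IsDerivOp Ω α R T)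
    (Y : L2 Ω →L[ℂ] L2 Ω) : IsDerivOp Ω α (R ∘L Y) (T ∘L Y) := fun f => h (Y f)

theorem isCutoffOp_cutOp (χ : 𝓓(Ω, ℂ)) (R : L2 Ω →L[ℂ] L2 Ω) :
    IsCutoffOp Ω χ R (cutOp Ω χ ∘L R) := fun f => cutOp_coe χ (R f)

end BornOp

end

/-! ### The resolvent and its bounds in terms of `λ` -/

open BornOp
theorem proposition1 {n : ℕ} (hn : 1 ≤ n) (k : ℕ) (hk : 1 ≤ k)
    (a : (Fin n → ℕ) → ℂ) (hell : IsEllipticOp k a) (hsa : IsFormallySelfAdjointOp k a)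
    (hbb : IsBoundedBelowOp k a)
    (Ω : Opens (Rn n)) (hne : (Ω : Set (Rn n)).Nonempty)
    (hbd : Bornology.IsBounded (Ω : Set (Rn n)))
    (V : Rn n → ℂ) (hV : MemLp V ∞ (volume.restrict (Ω : Set (Rn n))))
    (hVc : CoerciveNearBoundary Ω V)
    (e : ℕ) (he : e < k) (W : (Fin n → ℕ) → Rn n → ℂ)
    (hW : ∀ α ∈ multiIndices n 1 e, MemSobolevC Ω (mlen α) ∞ (W α))
    (μ ν : ℕ) (hμ : μ = 0 ∨ μ = 1) (hν : ν = 0 ∨ ν = 1) :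
    ∃ lam₀ : ℝ, 0 < lam₀ ∧
    ∃ R₁₁ R₁₂ R₂₁ R₂₂ : ℝ → (L2 Ω →L[ℂ] L2 Ω),
    ∃ D₁₁ D₁₂ : (Fin n → ℕ) → ℝ → (L2 Ω →L[ℂ] L2 Ω),
    ∃ cR₂₁ cR₂₂ : 𝓓(Ω, ℂ) → ℝ → (L2 Ω →L[ℂ] L2 Ω),
      (∀ lam : ℝ, lam₀ ≤ lam →
        -- `B` is a well-defined map on the whole of `H^k_0(Ω) × H^k_P(Ω)`
        (∀ u w : L2 Ω, MemH0 Ω k u → MemHP Ω k a w →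
          ∃! q : L2 Ω × L2 Ω, BornGraph Ω k e a W V μ ν lam (u, w) q) ∧
        -- `B + lam` is bijective
        (∀ f g : L2 Ω, ∃! p : L2 Ω × L2 Ω,
          BornGraph Ω k e a W V μ ν lam p (f - (lam : ℂ) • p.1, g - (lam : ℂ) • p.2)) ∧
        -- the matrix of the `R`'s is the inverse of `B + lam`
        (∀ f g : L2 Ω,
          BornGraph Ω k e a W V μ ν lam
            (R₁₁ lam f + R₁₂ lam g, R₂₁ lam f + R₂₂ lam g)
            (f - (lam : ℂ) • (R₁₁ lam f + R₁₂ lam g),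
              g - (lam : ℂ) • (R₂₁ lam f + R₂₂ lam g))) ∧
        -- `D₁₁ α = ∂^α R₁₁`, `D₁₂ α = ∂^α R₁₂`, `cR₂₁ χ = χ R₂₁` and `cR₂₂ χ = χ R₂₂`
        (∀ α : Fin n → ℕ, mlen α ≤ k →
          IsDerivOp Ω α (R₁₁ lam) (D₁₁ α lam) ∧ IsDerivOp Ω α (R₁₂ lam) (D₁₂ α lam)) ∧
        (∀ χ : 𝓓(Ω, ℂ),
          IsCutoffOp Ω χ (R₂₁ lam) (cR₂₁ χ lam) ∧ IsCutoffOp Ω χ (R₂₂ lam) (cR₂₂ χ lam)) ∧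
        -- compactness
        IsCompactOperator (R₁₁ lam) ∧ IsCompactOperator (R₁₂ lam) ∧
        IsCompactOperator (R₂₂ lam) ∧
        (∀ χ : 𝓓(Ω, ℂ), IsCompactOperator (cR₂₁ χ lam)) ∧
        (∀ α : Fin n → ℕ, 1 ≤ mlen α → mlen α < k →
          IsCompactOperator (D₁₁ α lam) ∧ IsCompactOperator (D₁₂ α lam) ∧
          ∀ χ : 𝓓(Ω, ℂ),
            (∃ T : L2 Ω →L[ℂ] L2 Ω,
              IsDerivOp Ω α (cR₂₁ χ lam) T ∧ IsCompactOperator T) ∧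
            (∃ T : L2 Ω →L[ℂ] L2 Ω,
              IsDerivOp Ω α (cR₂₂ χ lam) T ∧ IsCompactOperator T))) ∧
      -- operator norm bounds
      (∃ C : ℝ, ∀ lam : ℝ, lam₀ ≤ lam → ∀ α : Fin n → ℕ, mlen α ≤ k →
        ‖D₁₁ α lam‖ ≤ C * lam ^ ((mlen α : ℝ) / k - 1)) ∧
      (∀ ε : ℝ, 0 < ε → ∃ C : ℝ, ∀ lam : ℝ, lam₀ ≤ lam → ∀ α : Fin n → ℕ, mlen α ≤ k →
        ‖D₁₂ α lam‖ ≤ C * lam ^ (ε + (1 - (ν : ℝ)) * e / k + (mlen α : ℝ) / k - 2)) ∧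
      (∀ ε : ℝ, 0 < ε → ∃ C : ℝ, ∀ lam : ℝ, lam₀ ≤ lam →
        ‖R₂₂ lam‖ ≤ C * lam ^ (ε + (e : ℝ) / k - 1)) ∧
      (∃ C : ℝ, ∀ lam : ℝ, lam₀ ≤ lam → ‖R₂₁ lam‖ ≤ C) ∧
      (∀ χ : 𝓓(Ω, ℂ), ∃ C : ℝ, ∀ lam : ℝ, lam₀ ≤ lam →
        ‖cR₂₁ χ lam‖ ≤ C * lam ^ (-(1 : ℝ) / k)) := by
  obtain ⟨c, hc, s₀, hs₀, hlow⟩ := exists_psym_add_ge hk hell hsa hbb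
  have h : SymBound k a c s₀ := ⟨hk, hc, hs₀, hsa, hlow⟩
  obtain ⟨s₁, hs₁, C, hC, hblock⟩ := exists_block_inverse hbd h he hV hVc hW hμ hν
  choose! S X hSn hXn hXc hwd hres using hblock
  have hk0 : (k : ℝ) ≠ 0 := by positivity
  -- The parameter `s = λ^(1/k)`; the threshold `s ≥ s₁` becomes `λ ≥ s₁^k`.
  set σ : ℝ → ℝ := fun lam => lam ^ (1 / (k : ℝ)) with hσ
  have hs₁1 : 1 ≤ s₁ := h.one_le hs₁
  have hlam1 : ∀ lam : ℝ, s₁ ^ k ≤ lam → 1 ≤ lam := fun lam hl => (one_le_pow₀ hs₁1).trans hl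
  have hσpow : ∀ lam : ℝ, s₁ ^ k ≤ lam → ∀ j : ℕ, σ lam ^ j = lam ^ ((j : ℝ) / k) := by
    intro lam hl j
    rw [hσ, ← Real.rpow_natCast, ← Real.rpow_mul (by linarith [hlam1 lam hl]), one_div_mul_eq_div]
  have hσk : ∀ lam : ℝ, s₁ ^ k ≤ lam → σ lam ^ k = lam := by
    intro lam hl
    rw [hσpow lam hl, div_self hk0, Real.rpow_one]
  have hσ0 : ∀ lam : ℝ, s₁ ^ k ≤ lam → 0 ≤ σ lam := fun lam hl =>
    Real.rpow_nonneg (by linarith [hlam1 lam hl]) _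
  have hσ₁ : ∀ lam : ℝ, s₁ ^ k ≤ lam → s₁ ≤ σ lam := by
    intro lam hl
    rw [← pow_le_pow_iff_left₀ (by linarith) (hσ0 lam hl) (by omega : k ≠ 0), hσk lam hl]
    exact hl
  have hσ₀ : ∀ lam : ℝ, s₁ ^ k ≤ lam → s₀ ≤ σ lam := fun lam hl => hs₁.trans (hσ₁ lam hl)
  set A : ℝ := (2 * Real.pi) ^ k / c with hA
  have hA0 : 0 ≤ A := by positivity
  have hDn : ∀ lam : ℝ, s₁ ^ k ≤ lam → ∀ α : Fin n → ℕ, mlen α ≤ k →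
      ‖derivRes Ω k a (σ lam) (S (σ lam)) α‖ ≤ 2 * A * C * lam ^ ((mlen α : ℝ) / k - 1) := by
    intro lam hl α hα
    have hl0 : 0 < lam := by linarith [hlam1 lam hl]
    refine (norm_derivRes_le h (hσ₀ lam hl) hα).trans ?_
    have e1 : (mlen α : ℝ) / k - 1 = -(((k - mlen α : ℕ) : ℝ) / k) := by
      rw [Nat.cast_sub hα]
      field_simp
      ring
    rw [hσpow lam hl, e1, Real.rpow_neg hl0.le, ← hA]
    have h1 := hSn (σ lam) (hσ₁ lam hl)
    calc _ ≤ A / lam ^ (((k - mlen α : ℕ) : ℝ) / k) * (2 * C) := by gcongr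
      _ = _ := by ring
  have hXn' : ∀ lam : ℝ, s₁ ^ k ≤ lam →
      ‖X (σ lam)‖ ≤ C * lam ^ ((1 - (ν : ℝ)) * e / k - 1) := by
    intro lam hl
    have hl0 : 0 < lam := by linarith [hlam1 lam hl]
    have h1 := hXn (σ lam) (hσ₁ lam hl)
    have e1 : (((1 - ν) * e : ℕ) : ℝ) = (1 - (ν : ℝ)) * e := by
      rcases hν with rfl | rfl <;> simp
    rwa [hσpow lam hl, hσk lam hl, e1, ← Real.rpow_sub_one hl0.ne'] at h1
  refine ⟨s₁ ^ k, by positivity,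
    fun lam => derivRes Ω k a (σ lam) (S (σ lam)) 0,
    fun lam => derivRes Ω k a (σ lam) (S (σ lam)) 0 ∘L (-X (σ lam)),
    fun lam => kerRes Ω k a (σ lam) (S (σ lam)),
    fun lam => diagRes Ω k a (σ lam) (S (σ lam)) (X (σ lam)),
    fun α lam => derivRes Ω k a (σ lam) (S (σ lam)) α,
    fun α lam => derivRes Ω k a (σ lam) (S (σ lam)) α ∘L (-X (σ lam)),
    fun χ lam => cutOp Ω χ ∘L kerRes Ω k a (σ lam) (S (σ lam)),
    fun χ lam => cutOp Ω χ ∘L diagRes Ω k a (σ lam) (S (σ lam)) (X (σ lam)),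
    fun lam hl => ?_, ⟨2 * A * C, hDn⟩, fun ε hε => ⟨2 * A * C * C, fun lam hl α hα => ?_⟩,
    fun ε hε => ⟨A + C * C, fun lam hl => ?_⟩, ⟨C, fun lam hl => ?_⟩, fun χ => ?_⟩
  · have hs := hσ₀ lam hl
    have hwd' := hwd (σ lam) (hσ₁ lam hl)
    have hres' := hres (σ lam) (hσ₁ lam hl)
    rw [hσk lam hl] at hwd' hres'
    have h0k : mlen (0 : Fin n → ℕ) < k := by
      simp only [mlen, Pi.zero_apply, Finset.sum_const_zero]
      exact hk
    have hinv := fun f g => (hres' f g _).2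
      (resolvent_apply (s := σ lam) (S := S (σ lam)) (X := X (σ lam)) f g)
    dsimp only at hinv
    refine ⟨hwd', fun f g => ⟨_, (hres' f g _).2 rfl, fun p hp => (hres' f g p).1 hp⟩,
      hinv, fun α hα => ⟨isDerivOp_derivRes hbd h hs hα,
        (isDerivOp_derivRes hbd h hs hα).comp _⟩,
      fun χ => ⟨isCutoffOp_cutOp χ _, isCutoffOp_cutOp χ _⟩,
      isCompactOperator_derivRes hbd h hs h0k,
      (isCompactOperator_derivRes hbd h hs h0k).comp_right _,
      isCompactOperator_diagRes hbd h hs (hXc _ (hσ₁ lam hl)),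
      fun χ => (isCompactOperator_cutOp hbd h hs (distribEq_kerRes hbd h) χ).1,
      fun α _ hα => ⟨isCompactOperator_derivRes hbd h hs hα,
        (isCompactOperator_derivRes hbd h hs hα).comp_right _, fun χ =>
        ⟨(isCompactOperator_cutOp hbd h hs (distribEq_kerRes hbd h) χ).2 α hα,
          (isCompactOperator_cutOp hbd h hs (distribEq_diagRes hbd h hs) χ).2 α hα⟩⟩⟩
  · have hl0 : 0 < lam := by linarith [hlam1 lam hl]
    refine (ContinuousLinearMap.opNorm_comp_le _ _).trans ?_
    rw [norm_neg]
    -- The product has the stated exponent with `ε = 0`; `λ ≥ 1` allows adding `ε`, so the constant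
    -- does not even depend on it.
    have e1 : lam ^ ((mlen α : ℝ) / k - 1) * lam ^ ((1 - (ν : ℝ)) * e / k - 1) ≤
        lam ^ (ε + (1 - (ν : ℝ)) * e / k + (mlen α : ℝ) / k - 2) := by
      rw [← Real.rpow_add hl0]
      exact Real.rpow_le_rpow_of_exponent_le (hlam1 lam hl) (by linarith)
    calc _ ≤ (2 * A * C * lam ^ ((mlen α : ℝ) / k - 1)) *
          (C * lam ^ ((1 - (ν : ℝ)) * e / k - 1)) :=
          mul_le_mul (hDn lam hl α hα) (hXn' lam hl) (norm_nonneg _) (by positivity)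
      _ = 2 * A * C * C *
          (lam ^ ((mlen α : ℝ) / k - 1) * lam ^ ((1 - (ν : ℝ)) * e / k - 1)) := by ring
      _ ≤ _ := by gcongr
  · have hl0 : 0 < lam := by linarith [hlam1 lam hl]
    refine (norm_diagRes_le h (hσ₀ lam hl)).trans ?_
    have hek : (0 : ℝ) ≤ (e : ℝ) / k := by positivity
    -- The stated bound for `R₂₂` does not exploit `ν = 1`; the exponent of `X` is simply enlarged
    -- to `e / k - 1`.
    have hνe : (1 - (ν : ℝ)) * e / k ≤ (e : ℝ) / k := by
      rcases hν with rfl | rfl <;> simp [hek]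
    have h1 : 1 / lam ≤ lam ^ (ε + (e : ℝ) / k - 1) := by
      rw [one_div, ← Real.rpow_neg_one]
      exact Real.rpow_le_rpow_of_exponent_le (hlam1 lam hl) (by linarith)
    have h2 : lam ^ ((1 - (ν : ℝ)) * e / k - 1) ≤ lam ^ (ε + (e : ℝ) / k - 1) :=
      Real.rpow_le_rpow_of_exponent_le (hlam1 lam hl) (by linarith)
    have h3 := hXn' lam hl
    have h4 := hSn (σ lam) (hσ₁ lam hl)
    rw [hσk lam hl, ← hA]
    calc A / lam + ‖S (σ lam)‖ * ‖X (σ lam)‖ ≤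
          A / lam + C * (C * lam ^ ((1 - (ν : ℝ)) * e / k - 1)) := by gcongr
      _ = A * (1 / lam) + C * C * lam ^ ((1 - (ν : ℝ)) * e / k - 1) := by ring
      _ ≤ A * lam ^ (ε + (e : ℝ) / k - 1) + C * C * lam ^ (ε + (e : ℝ) / k - 1) := by gcongr
      _ = _ := by ring
  · exact norm_kerRes_le.trans (hSn _ (hσ₁ lam hl))
  · obtain ⟨K, hK, hcut⟩ := norm_cutOp_kerP_le hbd h χ
    refine ⟨K * C, fun lam hl => ?_⟩
    have hl1 := hlam1 lam hl
    have hl0 : 0 < lam := by linarith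
    have h1 := hcut (σ lam) (hσ₀ lam hl)
    have h2 := hSn (σ lam) (hσ₁ lam hl)
    rw [hσk lam hl] at h1
    -- The concentration estimate gives the stronger decay `λ⁻¹`, and `k ≥ 1` weakens it to the
    -- stated power.
    have h3 : 1 / lam ≤ lam ^ (-(1 : ℝ) / k) := by
      rw [one_div, ← Real.rpow_neg_one]
      refine Real.rpow_le_rpow_of_exponent_le hl1 ?_
      rw [neg_div, neg_le_neg_iff]
      exact div_le_one_of_le₀ (by exact_mod_cast hk) (by positivity)
    change ‖(cutOp Ω χ ∘L (kerP Ω k a (σ lam)).starProjection) ∘L S (σ lam)‖ ≤ _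
    calc _ ≤ K / lam * C := (ContinuousLinearMap.opNorm_comp_le _ _).trans (by gcongr)
      _ = K * C * (1 / lam) := by ring
      _ ≤ _ := by gcongr
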